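/- Let $d\in\mathbb N$, $d\ge 1$, and $\alpha>0$. All functions are complex-valued, $\mathbb R^d_+=(0,\infty)^d$, $v(x)=(x_1^2,\dots,x_d^2)$ for $x\in\mathbb R^d$, and $w(x)=(\sqrt{x_1},\dots,\sqrt{x_d})$ for $x\in[0,\infty)^d$. For $n\in\mathbb N_0^d$ put $|n|=\sum_j n_j$, $n!=\prod_j n_j!$, $(-1)^n=(-1)^{|n|}$, and $\binom{\gamma}{n}=\prod_{j}\frac{\gamma_j(\gamma_j-1)\cdots(\gamma_j-n_j+1)}{n_j!}$ for $\gamma\in\mathbb R^d$; $\mathbf{1/2}$ and $\mathbf{3/2}$ denote the constant vectors. The Laguerre functions are $l_n(x)=\prod_j L_{n_j}(x_j)e^{-x_j/2}$ with $L_m(t)=\frac{e^t}{m!}\frac{d^m}{dt^m}(e^{-t}t^m)$, and the Hermite functions are $h_n(x)=\prod_j(2^{n_j}n_j!\sqrt\pi)^{-1/2}e^{-x_j^2/2}H_{n_j}(x_j)$ with $H_m(t)=(-1)^me^{t^2}\frac{d^m}{dt^m}e^{-t^2}$. The Laguerre coefficients of $g$ on $\mathbb R^d_+$ are $\int_{\mathbb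 R^d_+}g\,l_n\,dx$, and the Hermite coefficients of $g$ on $\mathbb R^d$ are $\int_{\mathbb R^d}g\,h_n\,dx$. For $\beta>0$, $\ell_\beta(\mathbb N_0^d)$ is the set of $\{c_n\}_{n\in\mathbb N_0^d}\subset\mathbb C$ with $\sup_n|c_n|e^{h|n|^{1/(2\beta)}}<\infty$ for some $h>0$; $\{c_{2n}\}_n\in\ell_\beta$ means that the sequence equal to $c_k$ at the indices $k\in 2\mathbb N_0^d$ and to $0$ at all other indices is in $\ell_\beta$. $\mathcal S(\mathbb R^d_+)$ is the space of smooth functions on $\mathbb R^d_+$ all of whose derivatives extend continuously to $[0,\infty)^d$ and are rapidly decreasing; its elements are identified with their continuous extensions to $[0,\infty)^d$. With the Laguerre operator $E=-\sum_j\big(x_j\partial_j^2+\partial_j-\frac{x_j}{4}+\frac12\big)$, $\mathbf G^\alpha_\alpha(\mathbb R^d_+)$ is the space of $f\in\mathcal S(\mathbb R^d_+)$ such that for some $h>0$ $$\sup_{N\ge 0}\frac{\|E^Nf\|_{L^2(\mathbb R^d_+)}}{h^NN!^{\alpha}}<\infty .$$ With the Hermite operator $H=|x|^2-\Delta$, the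 Pilipović space $\mathcal H_{\beta}(\mathbb R^d)$ is the space of $f\in C^\infty(\mathbb R^d)$ such that for some $h,C>0$ one has $\|H^Nf\|_{L^\infty(\mathbb R^d)}\le C h^NN!^{2\beta}$ for all $N\ge0$, and $\mathcal H_{\beta,\mathrm{even}}(\mathbb R^d)$ is its subspace of functions that are even in each variable separately. **Theorem.** (i) Let $f\in\mathbf G^\alpha_\alpha(\mathbb R^d_+)$ have Laguerre coefficients $a_n$. Then $f\circ v\in\mathcal H_{\alpha/2,\mathrm{even}}(\mathbb R^d)$, its Hermite coefficients $b_{2n}$ satisfy $\{b_{2n}\}_n\in\ell_{\alpha/2}(\mathbb N_0^d)$, $f\circ v=\sum_{n\in\mathbb N_0^d}b_{2n}h_{2n}$ with absolute convergence at every point of $\mathbb R^d$, and for every $n\in\mathbb N_0^d$ $$b_{2n}=\frac{(-1)^n\pi^{d/4}\sqrt{(2n)!}}{2^{|n|}\,n!}\sum_{k\in\mathbb N_0^d}a_{k+n}\binom{k-\mathbf{1/2}}{k},$$ where the series converges absolutely. (ii) Let $f\in\mathcal H_{\alpha/2,\mathrm{even}}(\mathbb R^d)$ have Hermite coefficients $a_{n}$.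 Then $g=f|_{\mathbb R^d_+}\circ w$ belongs to $\mathbf G^\alpha_\alpha(\mathbb R^d_+)$, its Laguerre coefficients $b_n$ satisfy $\{b_n\}_n\in\ell_{\alpha/2}(\mathbb N_0^d)$, $g=\sum_{n\in\mathbb N_0^d}b_nl_n$ with absolute convergence at every point of $[0,\infty)^d$, and for every $n\in\mathbb N_0^d$ $$b_n=\frac{(-1)^n2^{|n|}}{\pi^{d/4}}\sum_{k\in\mathbb N_0^d}\binom{k-\mathbf{3/2}}{k}\frac{(-1)^{|k|}2^{|k|}(k+n)!\,a_{2(k+n)}}{\sqrt{(2(k+n))!}},$$ where the series converges absolutely. -/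

import Mathlib

open scoped ContDiff Nat
open MeasureTheory

namespace PilipovicOrthant

noncomputable section

/-! ### Multi-indices -/

/-- Multi-indices `n ∈ ℕ₀^d`. -/
abbrev MultiIndex (d : ℕ) : Type := Fin d → ℕ

/-- The length `|n| = n₁ + ⋯ + n_d`. -/
def len {d : ℕ} (n : MultiIndex d) : ℕ := ∑ j, n j

/-- The factorial `n! = n₁! ⋯ n_d!`. -/
def mfact {d : ℕ} (n : MultiIndex d) : ℕ := ∏ j, (n j)!

/-- The generalized binomial coefficient
`(γ choose m) = ∏ⱼ γⱼ (γⱼ - 1) ⋯ (γⱼ - mⱼ + 1) / mⱼ!` for `γ ∈ ℝ^d`, `m ∈ ℕ₀^d`. -/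
def mbinom {d : ℕ} (γ : Fin d → ℝ) (m : MultiIndex d) : ℝ :=
  ∏ j, (∏ i ∈ Finset.range (m j), (γ j - (i : ℝ))) / ((m j)! : ℝ)

/-! ### Orthants and the two substitutions -/

/-- The open orthant `ℝ^d_+ = (0, ∞)^d`. -/
def orthant (d : ℕ) : Set (Fin d → ℝ) := {x | ∀ j, 0 < x j}

/-- The closed orthant `[0, ∞)^d`. -/
def closedOrthant (d : ℕ) : Set (Fin d → ℝ) := {x | ∀ j, 0 ≤ x j}

/-- `v(x) = (x₁², …, x_d²)`. -/
def vMap {d : ℕ} (x : Fin d → ℝ) : Fin d → ℝ := fun j => x j ^ 2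

/-- `w(x) = (√x₁, …, √x_d)`. -/
def wMap {d : ℕ} (x : Fin d → ℝ) : Fin d → ℝ := fun j => √(x j)

/-! ### Laguerre and Hermite functions -/

/-- The Laguerre polynomial `L_n(t) = (e^t / n!) (d/dt)^n (e^{-t} t^n)`. -/
def laguerrePoly (n : ℕ) (t : ℝ) : ℝ :=
  Real.exp t / (n ! : ℝ) * iteratedDeriv n (fun s : ℝ => Real.exp (-s) * s ^ n) t

/-- The Laguerre function `l_n(x) = ∏ⱼ L_{nⱼ}(xⱼ) e^{-xⱼ/2}`. -/
def laguerreFun {d : ℕ} (n : MultiIndex d) (x : Fin d → ℝ) : ℝ :=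
  ∏ j, laguerrePoly (n j) (x j) * Real.exp (-(x j) / 2)

/-- The (physicists') Hermite polynomial `H_n(t) = (-1)^n e^{t²} (d/dt)^n e^{-t²}`. -/
def hermitePoly (n : ℕ) (t : ℝ) : ℝ :=
  (-1) ^ n * Real.exp (t ^ 2) * iteratedDeriv n (fun s : ℝ => Real.exp (-s ^ 2)) t

/-- The Hermite function
`h_n(x) = ∏ⱼ (2^{nⱼ} nⱼ! √π)^{-1/2} e^{-xⱼ²/2} H_{nⱼ}(xⱼ)`. -/
def hermiteFun {d : ℕ} (n : MultiIndex d) (x : Fin d → ℝ) : ℝ :=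
  ∏ j, (√((2 : ℝ) ^ (n j) * ((n j)! : ℝ) * √Real.pi))⁻¹ *
    Real.exp (-(x j) ^ 2 / 2) * hermitePoly (n j) (x j)

/-- The Laguerre coefficient `a_n(f) = ∫_{ℝ^d_+} f(x) l_n(x) dx`. -/
def laguerreCoeff {d : ℕ} (f : (Fin d → ℝ) → ℂ) (n : MultiIndex d) : ℂ :=
  ∫ x in orthant d, f x * (laguerreFun n x : ℂ)

/-- The Hermite coefficient `a_n(f) = ∫_{ℝ^d} f(x) h_n(x) dx`. -/
def hermiteCoeff {d : ℕ} (f : (Fin d → ℝ) → ℂ) (n : MultiIndex d) : ℂ :=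
  ∫ x, f x * (hermiteFun n x : ℂ)

/-! ### The sequence spaces -/

/-- `a ∈ ℓ_α(ℕ₀^d)`: for some `h > 0`, `sup_n |a_n| e^{h |n|^{1/(2α)}} < ∞`. -/
def MemEll {d : ℕ} (α : ℝ) (a : MultiIndex d → ℂ) : Prop :=
  ∃ h : ℝ, 0 < h ∧ ∃ C : ℝ, ∀ n,
    ‖a n‖ * Real.exp (h * (len n : ℝ) ^ (1 / (2 * α))) ≤ C

open Classical in
/-- The sequence which agrees with `c` at the indices `2n`, `n ∈ ℕ₀^d`, and vanishes at all other
indices; "`{c_{2n}} ∈ ℓ_α`" means that this sequence lies in `ℓ_α`. -/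
def evenPart {d : ℕ} (c : MultiIndex d → ℂ) : MultiIndex d → ℂ :=
  fun k => if ∀ j, Even (k j) then c k else 0

/-! ### Differential operators -/

/-- The partial derivative `∂f/∂xⱼ`. -/
def pderiv {d : ℕ} (j : Fin d) (f : (Fin d → ℝ) → ℂ) : (Fin d → ℝ) → ℂ :=
  fun x => fderiv ℝ f x (Pi.single j 1)

/-- The Laguerre operator `E = -∑ⱼ (xⱼ ∂ⱼ² + ∂ⱼ - xⱼ/4 + 1/2)`. -/
def laguerreOp {d : ℕ} (f : (Fin d → ℝ) → ℂ) : (Fin d → ℝ) → ℂ :=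
  fun x => -∑ j, ((x j : ℂ) * pderiv j (pderiv j f) x + pderiv j f x
    - (x j : ℂ) / 4 * f x + 1 / 2 * f x)

/-- The Hermite operator `H = |x|² - Δ = ∑ⱼ (xⱼ² - ∂ⱼ²)`. -/
def hermiteOp {d : ℕ} (f : (Fin d → ℝ) → ℂ) : (Fin d → ℝ) → ℂ :=
  fun x => ∑ j, ((x j : ℂ) ^ 2 * f x - pderiv j (pderiv j f) x)

/-! ### The function spaces -/

/-- `f ∈ 𝒮(ℝ^d_+)`: `f` is smooth on the open orthant, all its derivatives extend continuously to
the closed orthant (the values of `f` on the closed orthant being those of the continuous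
extension), and they decay there faster than any power. The values of `f` outside the closed
orthant are irrelevant. -/
structure MemSchwartzOrthant {d : ℕ} (f : (Fin d → ℝ) → ℂ) : Prop where
  smooth : ContDiffOn ℝ ∞ f (orthant d)
  cont : ContinuousOn f (closedOrthant d)
  extends_cont : ∀ m : ℕ, ∃ g : (Fin d → ℝ) → ((Fin d → ℝ) [×m]→L[ℝ] ℂ),
    ContinuousOn g (closedOrthant d) ∧ Set.EqOn g (iteratedFDeriv ℝ m f) (orthant d)
  decay : ∀ k m : ℕ, ∃ C : ℝ, ∀ x ∈ orthant d, ‖x‖ ^ k * ‖iteratedFDeriv ℝ m f x‖ ≤ C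

/-- The Pilipović space `𝐆^α_α(ℝ^d_+)` of Roumieu type on the orthant: `f ∈ 𝒮(ℝ^d_+)` such that,
for some `h > 0`, `sup_N ‖E^N f‖_{L²(ℝ^d_+)} / (h^N N!^α) < ∞`. -/
def MemG {d : ℕ} (α : ℝ) (f : (Fin d → ℝ) → ℂ) : Prop :=
  MemSchwartzOrthant f ∧
    ∃ h : ℝ, 0 < h ∧ ∃ C : ℝ, ∀ N : ℕ,
      eLpNorm (laguerreOp^[N] f) 2 (volume.restrict (orthant d)) ≤
        ENNReal.ofReal (C * h ^ N * (N ! : ℝ) ^ α)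

/-- The Pilipović space `𝓗_α(ℝ^d)` of Roumieu type: smooth `f` such that, for some `h > 0` and
`C > 0`, `‖H^N f‖_{L^∞(ℝ^d)} ≤ C h^N N!^{2α}` for all `N`. -/
def MemH {d : ℕ} (α : ℝ) (f : (Fin d → ℝ) → ℂ) : Prop :=
  ContDiff ℝ ∞ f ∧
    ∃ h : ℝ, 0 < h ∧ ∃ C : ℝ, 0 < C ∧ ∀ (N : ℕ) (x : Fin d → ℝ),
      ‖(hermiteOp^[N] f) x‖ ≤ C * h ^ N * (N ! : ℝ) ^ (2 * α)

/-- The space `𝓗_{α,even}(ℝ^d)` of functions in `𝓗_α(ℝ^d)` that are even in each variable. -/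
def MemHEven {d : ℕ} (α : ℝ) (f : (Fin d → ℝ) → ℂ) : Prop :=
  MemH α f ∧ ∀ (j : Fin d) (x : Fin d → ℝ), f (Function.update x j (-(x j))) = f x

end

end PilipovicOrthant

namespace PilipovicOrthant

/-! ### Hermite polynomials and functions of one variable -/

/-! Both function spaces are sequence spaces in disguise. The functions `l_n` and `h_n` are
eigenfunctions of `E` and `H` with eigenvalues `|n|` and `2|n| + d`, so bounds of the form `h^N
N!^α` on the iterates of the operator amount to decay `exp(-h (|n|+1)^{1/α})` of the coefficients
(`ExpDecay`). From functions to coefficients one uses the symmetry of the operators and sums over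
`N` (`MemG.expDecay_laguerreCoeff`, `MemH.expDecay_hermiteCoeff`, `expDecay_of_pow_bound`). In the
other direction one applies the operator to the series term by term (`memG_of_expDecay`,
`memH_of_expDecay`), which needs bounds on the basis functions and all their derivatives that are
uniform in `x` and polynomial in `n`.

The substitution `t = x²` acts triangularly on the two bases. With `A_j = (-1)^j H_{2j} / (4^j j!)`,
which is the Laguerre polynomial of type `-1/2` at `x²`, the generating functions of `L_n(x²)` and
`A_n(x)` differ by the factor `(1-t)^{-1/2}`. Hence `L_n(x²) = ∑ c_{n-j} A_j(x)` with the Taylor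
coefficients `c` of `(1-t)^{-1/2}`, and the inverse relation uses those of `(1-t)^{1/2}`
(`laguerrePoly_sq`). These coefficients are the binomials of the theorem, and the remaining
constants are the ratios between `A_j` and the normalized Hermite functions.

Integrating the series term by term turns the connection formula into the two formulas for the
coefficients: the `n`-th new coefficient is a combination of the old ones at `k + n`, with factors
of at most polynomial growth. Since `|k + n|` dominates both `|k|` and `|n|`, exponential decay
survives (`ExpDecay.conv`). The composed function is bounded and continuous, so it is the sum of its
own series by completeness of the basis (`hasSum_hermite`, `hasSum_laguerre`), and membership in the
target space follows from the decay. Completeness is a moment argument: an exponentially decaying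
function with vanishing moments has vanishing Fourier transform (`eq_zero_of_moments`). -/

lemma contDiff_gauss : ContDiff ℝ ∞ (fun s : ℝ => Real.exp (-s ^ 2)) := by fun_prop

lemma hasDerivAt_iteratedDeriv_of_contDiff {f : ℝ → ℝ} (hf : ContDiff ℝ ∞ f) (n : ℕ) (t : ℝ) :
    HasDerivAt (iteratedDeriv n f) (iteratedDeriv (n + 1) f t) t := by
  rw [iteratedDeriv_succ]
  exact ((hf.differentiable_iteratedDeriv n (by exact_mod_cast WithTop.coe_lt_top n)) t).hasDerivAt

/-- Leibniz' rule applied to `g' = -2t g` for the Gaussian `g`, carried out by induction. This is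
the three-term recursion of the Hermite polynomials before multiplication by `e^{t²}`. -/
lemma iteratedDeriv_gauss_succ_succ (n : ℕ) (t : ℝ) :
    iteratedDeriv (n + 2) (fun s : ℝ => Real.exp (-s ^ 2)) t =
      -2 * t * iteratedDeriv (n + 1) (fun s : ℝ => Real.exp (-s ^ 2)) t
        - 2 * (n + 1) * iteratedDeriv n (fun s : ℝ => Real.exp (-s ^ 2)) t := by
  have h1 : iteratedDeriv 1 (fun s : ℝ => Real.exp (-s ^ 2)) =
      fun t => -2 * t * Real.exp (-t ^ 2) := by
    rw [iteratedDeriv_one]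
    funext t
    have : HasDerivAt (fun s : ℝ => Real.exp (-s ^ 2)) (Real.exp (-t ^ 2) * (-(2 * t))) t := by
      have := ((hasDerivAt_pow 2 t).neg).exp
      simpa using this
    rw [this.deriv]; ring
  induction n generalizing t with
  | zero =>
    have h2 := hasDerivAt_iteratedDeriv_of_contDiff contDiff_gauss 1 t
    have h0 := hasDerivAt_iteratedDeriv_of_contDiff contDiff_gauss 0 t
    rw [iteratedDeriv_zero] at h0
    have h3 : HasDerivAt (fun t : ℝ => -2 * t * Real.exp (-t ^ 2))
        (-2 * Real.exp (-t ^ 2) +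
          -2 * t * iteratedDeriv 1 (fun s : ℝ => Real.exp (-s ^ 2)) t) t := by
      convert! ((hasDerivAt_id t).const_mul (-2)).mul h0 using 1
      simp
    rw [h1] at h2
    have := h2.unique h3
    simp only [iteratedDeriv_zero]
    rw [this]
    push_cast
    ring
  | succ n ih =>
    have h3 := hasDerivAt_iteratedDeriv_of_contDiff contDiff_gauss (n + 2) t
    have h2 := hasDerivAt_iteratedDeriv_of_contDiff contDiff_gauss (n + 1) t
    have h1 := hasDerivAt_iteratedDeriv_of_contDiff contDiff_gauss n t
    have h4 := (((hasDerivAt_id t).const_mul (-2)).mul h2).sub (h1.const_mul (2 * ((n : ℝ) + 1)))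
    have : iteratedDeriv (n + 2) (fun s : ℝ => Real.exp (-s ^ 2)) =
      fun t => -2 * t * iteratedDeriv (n + 1) (fun s : ℝ => Real.exp (-s ^ 2)) t
        - 2 * (n + 1) * iteratedDeriv n (fun s : ℝ => Real.exp (-s ^ 2)) t := funext ih
    rw [this] at h3
    have := h3.unique h4
    rw [show n + 1 + 2 = n + 2 + 1 from rfl, this]
    simp only [id]
    push_cast
    ring

lemma hermitePoly_zero (t : ℝ) : hermitePoly 0 t = 1 := by
  simp [hermitePoly, ← Real.exp_add]

lemma hermitePoly_one (t : ℝ) : hermitePoly 1 t = 2 * t := by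
  have h : HasDerivAt (fun s : ℝ => Real.exp (-s ^ 2)) (Real.exp (-t ^ 2) * (-(2 * t))) t := by
    simpa using ((hasDerivAt_pow 2 t).neg).exp
  have h2 : Real.exp (t ^ 2) * Real.exp (-t ^ 2) = 1 := by simp [← Real.exp_add]
  rw [hermitePoly, iteratedDeriv_one, h.deriv]
  linear_combination (2 * t) * h2

lemma hermitePoly_succ_succ (n : ℕ) (t : ℝ) :
    hermitePoly (n + 2) t = 2 * t * hermitePoly (n + 1) t - 2 * (n + 1) * hermitePoly n t := by
  rw [hermitePoly, iteratedDeriv_gauss_succ_succ]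
  simp only [hermitePoly, pow_succ]
  ring

lemma hasDerivAt_hermitePoly (n : ℕ) (t : ℝ) :
    HasDerivAt (hermitePoly n) (2 * t * hermitePoly n t - hermitePoly (n + 1) t) t := by
  have h1 := hasDerivAt_iteratedDeriv_of_contDiff contDiff_gauss n t
  have h2 := ((hasDerivAt_pow 2 t).exp.const_mul ((-1 : ℝ) ^ n)).mul h1
  convert! h2 using 1
  simp only [hermitePoly, pow_succ]
  push_cast
  ring

lemma hasDerivAt_hermitePoly_succ (n : ℕ) (t : ℝ) :
    HasDerivAt (hermitePoly (n + 1)) (2 * (n + 1) * hermitePoly n t) t := by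
  convert hasDerivAt_hermitePoly (n + 1) t using 1
  rw [hermitePoly_succ_succ]; ring

lemma hasDerivAt_hermitePoly' (n : ℕ) (t : ℝ) :
    HasDerivAt (hermitePoly n) (2 * n * hermitePoly (n - 1) t) t := by
  cases n with
  | zero =>
    convert hasDerivAt_hermitePoly 0 t using 1
    simp [hermitePoly_zero, hermitePoly_one]
  | succ n => simpa using hasDerivAt_hermitePoly_succ n t

lemma hermitePoly_eq_eval (n : ℕ) : ∃ P : Polynomial ℝ, ∀ t, hermitePoly n t = P.eval t := by
  induction n using Nat.strong_induction_on with
  | _ n ih =>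
    match n with
    | 0 => exact ⟨1, by simp [hermitePoly_zero]⟩
    | 1 => exact ⟨2 * Polynomial.X, by simp [hermitePoly_one]⟩
    | n + 2 =>
      obtain ⟨P, hP⟩ := ih n (by omega)
      obtain ⟨Q, hQ⟩ := ih (n + 1) (by omega)
      exact ⟨2 * Polynomial.X * Q - Polynomial.C (2 * ((n : ℝ) + 1)) * P, fun t => by
        simp [hermitePoly_succ_succ, hP, hQ]⟩

/-- The normalizing constant of the `n`-th Hermite function. -/
noncomputable def herConst (n : ℕ) : ℝ := (√((2 : ℝ) ^ n * (n ! : ℝ) * √Real.pi))⁻¹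

/-- The Hermite function of one variable. -/
noncomputable def her (n : ℕ) (t : ℝ) : ℝ :=
  herConst n * Real.exp (-t ^ 2 / 2) * hermitePoly n t

/-- The Laguerre function of one variable. -/
noncomputable def lag (n : ℕ) (t : ℝ) : ℝ := laguerrePoly n t * Real.exp (-t / 2)

lemma herConst_pos (n : ℕ) : 0 < herConst n := by
  unfold herConst
  have := Real.pi_pos
  positivity

lemma herConst_succ (n : ℕ) : herConst (n + 1) * √(2 * (n + 1)) = herConst n := by
  have h : (2 : ℝ) ^ (n + 1) * ((n + 1)! : ℝ) * √Real.pi =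
      (2 * (n + 1)) * ((2 : ℝ) ^ n * (n ! : ℝ) * √Real.pi) := by
    rw [Nat.factorial_succ]; push_cast; ring
  have h0 : (0 : ℝ) < 2 * (n + 1) := by positivity
  have h1 : √((2 : ℝ) * (n + 1)) ≠ 0 := by positivity
  rw [herConst, herConst, h, Real.sqrt_mul h0.le, mul_inv]
  field_simp

lemma herConst_mul_hermitePoly_succ (n : ℕ) (t : ℝ) :
    herConst n * Real.exp (-t ^ 2 / 2) * hermitePoly (n + 1) t = √(2 * (n + 1)) * her (n + 1) t := by
  rw [her, ← herConst_succ]; ring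

lemma herConst_mul_deriv (n : ℕ) (t : ℝ) :
    herConst n * Real.exp (-t ^ 2 / 2) * (2 * n * hermitePoly (n - 1) t) =
      √(2 * n) * her (n - 1) t := by
  cases n with
  | zero => simp
  | succ n =>
    have h0 : (0 : ℝ) ≤ 2 * (n + 1) := by positivity
    have := Real.mul_self_sqrt h0
    simp only [Nat.add_sub_cancel, her, ← herConst_succ n]
    push_cast
    linear_combination
      (-(herConst (n + 1) * Real.exp (-t ^ 2 / 2) * hermitePoly n t)) * this

/-- The derivative of `H_n` is known both from the definition and as `2n H_{n-1}`; equating the two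
gives the recursion. At `n = 0` the truncated index `n - 1` is harmless, because its coefficient
`√(2n)` vanishes. -/
lemma mul_her (n : ℕ) (t : ℝ) :
    t * her n t = √(2 * (n + 1)) / 2 * her (n + 1) t + √(2 * n) / 2 * her (n - 1) t := by
  have h := (hasDerivAt_hermitePoly n t).unique (hasDerivAt_hermitePoly' n t)
  have h1 := herConst_mul_hermitePoly_succ n t
  have h2 := herConst_mul_deriv n t
  rw [her]
  linear_combination (herConst n * Real.exp (-t ^ 2 / 2)) / 2 * h + h1 / 2 + h2 / 2

lemma hasDerivAt_exp_neg_sq_half (t : ℝ) :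
    HasDerivAt (fun t : ℝ => Real.exp (-t ^ 2 / 2)) (-t * Real.exp (-t ^ 2 / 2)) t := by
  have := (((hasDerivAt_pow 2 t).neg).div_const 2).exp
  convert! this using 1
  simp; ring

lemma hasDerivAt_her (n : ℕ) (t : ℝ) :
    HasDerivAt (her n) (√(2 * n) / 2 * her (n - 1) t - √(2 * (n + 1)) / 2 * her (n + 1) t) t := by
  have h := ((hasDerivAt_exp_neg_sq_half t).const_mul (herConst n)).mul
    (hasDerivAt_hermitePoly' n t)
  convert! h using 1
  have h2 := herConst_mul_deriv n t
  have h3 := mul_her n t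
  rw [her] at h3
  linear_combination h3 - h2

lemma deriv_her (n : ℕ) : deriv (her n) =
    fun t => √(2 * n) / 2 * her (n - 1) t - √(2 * (n + 1)) / 2 * her (n + 1) t :=
  funext fun t => (hasDerivAt_her n t).deriv

lemma contDiff_her (n : ℕ) : ContDiff ℝ ∞ (her n) := by
  obtain ⟨P, hP⟩ := hermitePoly_eq_eval n
  have : her n = fun t => herConst n * Real.exp (-t ^ 2 / 2) * P.eval t :=
    funext fun t => by rw [her, hP]
  rw [this]
  have : ContDiff ℝ ∞ (fun t => P.eval t) := by simpa using P.contDiff_aeval (𝕜 := ℝ) ∞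
  fun_prop

/-- The Hermite differential equation: the ladder formula for the derivative is used twice, and the
neighbouring functions are eliminated with `mul_her`. The case `n = 0` is separate because there `(n
- 1) + 1 ≠ n`. -/
lemma hasDerivAt_deriv_her (n : ℕ) (t : ℝ) :
    HasDerivAt (deriv (her n)) ((t ^ 2 - (2 * n + 1)) * her n t) t := by
  rw [deriv_her]
  convert! ((hasDerivAt_her (n - 1) t).const_mul (√(2 * n) / 2)).sub
    ((hasDerivAt_her (n + 1) t).const_mul (√(2 * (n + 1)) / 2)) using 1
  have h1 := mul_her n t
  have h2 := mul_her (n - 1) t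
  have h3 := mul_her (n + 1) t
  have e1 : (0 : ℝ) ≤ 2 * (n + 1) := by positivity
  have e1' := Real.mul_self_sqrt e1
  cases n with
  | zero =>
    have e3 : √(2 : ℝ) * √2 = 2 := Real.mul_self_sqrt zero_le_two
    simp at h1 h2 h3 ⊢
    linear_combination t * h1 + √2 / 2 * h3 + her 0 t / 2 * e3
  | succ n =>
    have e2 : (0 : ℝ) ≤ 2 * ((n + 1 : ℕ) : ℝ) := by positivity
    have e2' := Real.mul_self_sqrt e2
    simp only [Nat.add_sub_cancel] at h1 h2 h3 ⊢
    push_cast at *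
    linear_combination t * h1 + √(2 * (n + 1 + 1)) / 2 * h3 + √(2 * (n + 1)) / 2 * h2
      + her (n + 1) t / 2 * e1' + her (n + 1) t / 2 * e2'

/-! ### Laguerre polynomials and functions of one variable -/

lemma contDiff_exp_mul_pow (n : ℕ) : ContDiff ℝ ∞ (fun s : ℝ => Real.exp (-s) * s ^ n) := by
  fun_prop

lemma iteratedDeriv_id_mul {f : ℝ → ℝ} (hf : ContDiff ℝ ∞ f) (n : ℕ) (t : ℝ) :
    iteratedDeriv (n + 1) (fun s => s * f s) t =
      t * iteratedDeriv (n + 1) f t + (n + 1) * iteratedDeriv n f t := by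
  induction n generalizing t with
  | zero =>
    have h0 := hasDerivAt_iteratedDeriv_of_contDiff hf 0 t
    rw [iteratedDeriv_zero] at h0
    have := ((hasDerivAt_id t).mul h0).deriv
    rw [zero_add, iteratedDeriv_one]
    rw [iteratedDeriv_zero, CharP.cast_eq_zero]
    convert! this using 1
    simp; ring
  | succ n ih =>
    rw [iteratedDeriv_succ, funext ih]
    have h1 := hasDerivAt_iteratedDeriv_of_contDiff hf (n + 1) t
    have h2 := hasDerivAt_iteratedDeriv_of_contDiff hf n t
    have := (((hasDerivAt_id t).mul h1).add (h2.const_mul ((n : ℝ) + 1))).deriv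
    convert! this using 1
    simp; ring

lemma laguerrePoly_zero (t : ℝ) : laguerrePoly 0 t = 1 := by
  simp [laguerrePoly, ← Real.exp_add]

/-- The derivative `L_n'` of the Laguerre polynomial. -/
noncomputable def laguerrePoly' (n : ℕ) (t : ℝ) : ℝ :=
  laguerrePoly n t + Real.exp t / (n ! : ℝ) *
    iteratedDeriv (n + 1) (fun s : ℝ => Real.exp (-s) * s ^ n) t

lemma hasDerivAt_laguerrePoly (n : ℕ) (t : ℝ) :
    HasDerivAt (laguerrePoly n) (laguerrePoly' n t) t := by
  have h := hasDerivAt_iteratedDeriv_of_contDiff (contDiff_exp_mul_pow n) n t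
  exact ((Real.hasDerivAt_exp t).div_const _).mul h

/-- Write `e^{-s} s^{n+1}` as `s` times `e^{-s} s^n`; in Leibniz' rule only two terms survive.
Differentiating the same product once before the remaining `n` derivatives gives the companion
`iteratedDeriv_laguerre_succ`. -/
lemma laguerrePoly_succ (n : ℕ) (t : ℝ) :
    (n + 1) * laguerrePoly (n + 1) t =
      t * (laguerrePoly' n t - laguerrePoly n t) + (n + 1) * laguerrePoly n t := by
  have h : (fun s : ℝ => Real.exp (-s) * s ^ (n + 1)) =
      fun s => s * (Real.exp (-s) * s ^ n) := by funext s; ring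
  have h0 : (n ! : ℝ) ≠ 0 := by positivity
  have h1 : (n : ℝ) + 1 ≠ 0 := by positivity
  rw [laguerrePoly', laguerrePoly, laguerrePoly, h,
    iteratedDeriv_id_mul (contDiff_exp_mul_pow n), Nat.factorial_succ]
  push_cast
  field_simp
  ring

lemma iteratedDeriv_laguerre_succ (n : ℕ) (t : ℝ) :
    iteratedDeriv (n + 1) (fun s : ℝ => Real.exp (-s) * s ^ (n + 1)) t =
      -iteratedDeriv n (fun s : ℝ => Real.exp (-s) * s ^ (n + 1)) t +
        (n + 1) * iteratedDeriv n (fun s : ℝ => Real.exp (-s) * s ^ n) t := by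
  have hd : deriv (fun s : ℝ => Real.exp (-s) * s ^ (n + 1)) =
      fun s => -(Real.exp (-s) * s ^ (n + 1)) + (n + 1) * (Real.exp (-s) * s ^ n) := by
    funext s
    have := ((hasDerivAt_neg s).exp.mul (hasDerivAt_pow (n + 1) s)).deriv
    convert! this using 1
    simp; ring
  rw [iteratedDeriv_succ', hd]
  have c1 := (contDiff_exp_mul_pow (n + 1)).contDiffAt (x := t)
  have c2 := (contDiff_exp_mul_pow n).contDiffAt (x := t)
  have hn : ((n : ℕ∞) : ℕ∞ω) ≤ ∞ := by exact_mod_cast le_top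
  rw [iteratedDeriv_fun_add (c1.neg.of_le hn) ((contDiffAt_const.mul c2).of_le hn),
    iteratedDeriv_fun_neg, iteratedDeriv_const_mul_field]

/-- At `t = x²` this is the recursion required by `connection_of_deriv`. Summed over the index it
gives `deriv_lag`. -/
lemma laguerrePoly'_succ (n : ℕ) (t : ℝ) :
    laguerrePoly' (n + 1) t = laguerrePoly' n t - laguerrePoly n t := by
  have h3 := hasDerivAt_iteratedDeriv_of_contDiff (contDiff_exp_mul_pow (n + 1)) (n + 1) t
  have h1 := hasDerivAt_iteratedDeriv_of_contDiff (contDiff_exp_mul_pow (n + 1)) n t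
  have h2 := hasDerivAt_iteratedDeriv_of_contDiff (contDiff_exp_mul_pow n) n t
  have h4 := h1.neg.add (h2.const_mul ((n : ℝ) + 1))
  have e := h3.unique (h4.congr_of_eventuallyEq
    (Filter.Eventually.of_forall (iteratedDeriv_laguerre_succ n)))
  have h0 : (n ! : ℝ) ≠ 0 := by positivity
  have h1 : (n : ℝ) + 1 ≠ 0 := by positivity
  rw [laguerrePoly', laguerrePoly', e, laguerrePoly, laguerrePoly, Nat.factorial_succ]
  push_cast
  field_simp
  ring

lemma laguerrePoly'_zero (t : ℝ) : laguerrePoly' 0 t = 0 := by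
  have h := hasDerivAt_laguerrePoly 0 t
  rw [funext laguerrePoly_zero] at h
  exact h.unique (hasDerivAt_const t 1)

lemma mul_laguerrePoly' (n : ℕ) (t : ℝ) :
    t * laguerrePoly' n t = n * (laguerrePoly n t - laguerrePoly (n - 1) t) := by
  cases n with
  | zero => simp [laguerrePoly'_zero]
  | succ n =>
    have h := laguerrePoly_succ n t
    rw [laguerrePoly'_succ]
    simp only [Nat.add_sub_cancel]
    push_cast
    linear_combination -h

lemma mul_laguerrePoly (n : ℕ) (t : ℝ) :
    t * laguerrePoly n t = (2 * n + 1) * laguerrePoly n t - n * laguerrePoly (n - 1) t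
      - (n + 1) * laguerrePoly (n + 1) t := by
  linear_combination mul_laguerrePoly' n t + laguerrePoly_succ n t

lemma laguerrePoly_zero_right (n : ℕ) : laguerrePoly n 0 = 1 := by
  induction n with
  | zero => exact laguerrePoly_zero 0
  | succ n ih =>
    have h := laguerrePoly_succ n 0
    have h1 : (n : ℝ) + 1 ≠ 0 := by positivity
    rw [ih] at h
    apply mul_left_cancel₀ h1
    linarith

lemma laguerrePoly_eq_eval (n : ℕ) : ∃ P : Polynomial ℝ, ∀ t, laguerrePoly n t = P.eval t := by
  induction n using Nat.strong_induction_on with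
  | _ n ih =>
    cases n with
    | zero => exact ⟨1, by simp [laguerrePoly_zero]⟩
    | succ n =>
      obtain ⟨P, hP⟩ := ih n (by omega)
      obtain ⟨Q, hQ⟩ := ih (n - 1) (by omega)
      refine ⟨Polynomial.C ((n : ℝ) + 1)⁻¹ * (Polynomial.C (2 * (n : ℝ) + 1) * P -
        Polynomial.C (n : ℝ) * Q - Polynomial.X * P), fun t => ?_⟩
      have h := mul_laguerrePoly n t
      have h1 : (n : ℝ) + 1 ≠ 0 := by positivity
      rw [hP, hQ] at h
      simp only [Polynomial.eval_mul, Polynomial.eval_C, Polynomial.eval_sub, Polynomial.eval_X]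
      rw [eq_inv_mul_iff_mul_eq₀ h1]
      linarith

lemma contDiff_laguerrePoly (n : ℕ) : ContDiff ℝ ∞ (laguerrePoly n) := by
  obtain ⟨P, hP⟩ := laguerrePoly_eq_eval n
  rw [funext hP]
  simpa using P.contDiff_aeval (𝕜 := ℝ) ∞

lemma contDiff_lag (n : ℕ) : ContDiff ℝ ∞ (lag n) := by
  have := contDiff_laguerrePoly n
  unfold lag
  fun_prop

lemma mul_lag (n : ℕ) (t : ℝ) :
    t * lag n t = (2 * n + 1) * lag n t - n * lag (n - 1) t - (n + 1) * lag (n + 1) t := by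
  simp only [lag]
  linear_combination Real.exp (-t / 2) * mul_laguerrePoly n t

lemma hasDerivAt_exp_neg_half (t : ℝ) :
    HasDerivAt (fun t : ℝ => Real.exp (-t / 2)) (-(Real.exp (-t / 2) / 2)) t := by
  have := ((hasDerivAt_neg t).div_const 2).exp
  convert this using 1
  ring

lemma hasDerivAt_lag (n : ℕ) (t : ℝ) :
    HasDerivAt (lag n) ((laguerrePoly' n t - laguerrePoly n t / 2) * Real.exp (-t / 2)) t := by
  have h := (hasDerivAt_laguerrePoly n t).mul (hasDerivAt_exp_neg_half t)
  convert! h using 1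
  ring

/-- No factor `1/t` occurs, unlike in `mul_deriv_lag`, so bounds on derivatives hold up to the
boundary point `0`. -/
lemma deriv_lag (n : ℕ) : deriv (lag n) =
    fun t => -(1 / 2) * lag n t - ∑ j ∈ Finset.range n, lag j t := by
  have hL : ∀ t, laguerrePoly' n t = -∑ j ∈ Finset.range n, laguerrePoly j t := by
    intro t
    induction n with
    | zero => simp [laguerrePoly'_zero]
    | succ n ih => rw [laguerrePoly'_succ, ih, Finset.sum_range_succ]; ring
  funext t
  rw [(hasDerivAt_lag n t).deriv, hL]
  simp only [lag, ← Finset.sum_mul]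
  ring

lemma mul_deriv_lag (n : ℕ) (t : ℝ) :
    t * deriv (lag n) t = n * (lag n t - lag (n - 1) t) - t / 2 * lag n t := by
  rw [(hasDerivAt_lag n t).deriv]
  simp only [lag]
  linear_combination Real.exp (-t / 2) * mul_laguerrePoly' n t

/-- Differentiate `mul_deriv_lag` once; the derivative of `l_{n-1}` is then eliminated through
`laguerrePoly'_succ`. -/
lemma lag_ode (n : ℕ) (t : ℝ) :
    t * deriv (deriv (lag n)) t + deriv (lag n) t - t / 4 * lag n t + lag n t / 2 =
      -n * lag n t := by
  have hdd : HasDerivAt (deriv (lag n)) (deriv (deriv (lag n)) t) t :=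
    (((contDiff_infty_iff_deriv.1 (contDiff_lag n)).2.differentiable (by simp)) t).hasDerivAt
  have hd : ∀ m, HasDerivAt (lag m) (deriv (lag m) t) t := fun m =>
    ((contDiff_lag m).differentiable (by simp) t).hasDerivAt
  have h1 := (hasDerivAt_id t).mul hdd
  have h2 := (((hd n).sub (hd (n - 1))).const_mul (n : ℝ)).sub
    (((hasDerivAt_id t).div_const 2).mul (hd n))
  have e := (h1.congr_of_eventuallyEq (Filter.Eventually.of_forall
    fun s => (mul_deriv_lag n s).symm)).unique h2
  have h3 : (n : ℝ) * deriv (lag n) t = n * deriv (lag (n - 1)) t -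
      n / 2 * (lag n t + lag (n - 1) t) := by
    cases n with
    | zero => simp
    | succ n =>
      simp only [Nat.add_sub_cancel, (hasDerivAt_lag _ t).deriv, laguerrePoly'_succ, lag]
      ring
  have h4 := mul_deriv_lag n t
  simp only [id] at e
  linear_combination e + h3 - h4 / 2

/-! ### Exponential decay, integrability, orthonormality -/

lemma abs_eval_le_exp (P : Polynomial ℝ) {c : ℝ} (hc : 0 < c) :
    ∃ C : ℝ, 0 ≤ C ∧ ∀ t : ℝ, |P.eval t| ≤ C * Real.exp (c * |t|) := by
  induction P using Polynomial.induction_on' with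
  | add P Q hP hQ =>
    obtain ⟨C, hC, h⟩ := hP
    obtain ⟨D, hD, h'⟩ := hQ
    refine ⟨C + D, by positivity, fun t => ?_⟩
    rw [Polynomial.eval_add, add_mul]
    exact (abs_add_le _ _).trans (add_le_add (h t) (h' t))
  | monomial n a =>
    refine ⟨|a| * (n ! / c ^ n), by positivity, fun t => ?_⟩
    rw [Polynomial.eval_monomial, abs_mul, abs_pow, mul_assoc]
    gcongr
    have h := Real.pow_div_factorial_le_exp (c * |t|) (by positivity) n
    rw [div_le_iff₀ (by positivity), mul_pow] at h
    rw [div_mul_eq_mul_div, le_div_iff₀ (by positivity)]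
    linarith

lemma her_exp_decay (n : ℕ) : ∃ C : ℝ, 0 ≤ C ∧ ∀ t, |her n t| ≤ C * Real.exp (-|t| / 2) := by
  obtain ⟨P, hP⟩ := hermitePoly_eq_eval n
  obtain ⟨C, hC, h⟩ := abs_eval_le_exp P (c := 1 / 2) (by norm_num)
  refine ⟨herConst n * Real.exp (1 / 2) * C, by have := herConst_pos n; positivity, fun t => ?_⟩
  rw [her, hP, abs_mul, abs_mul, abs_of_pos (herConst_pos n), Real.abs_exp]
  -- This is `(|t| - 1)² ≥ 0`. Half of the resulting rate absorbs the polynomial factor.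
  have h1 : Real.exp (-t ^ 2 / 2) ≤ Real.exp (1 / 2) * Real.exp (-|t|) := by
    rw [← Real.exp_add, Real.exp_le_exp]
    nlinarith [sq_nonneg (|t| - 1), sq_abs t]
  have h2 : Real.exp (-|t| / 2) = Real.exp (-|t|) * Real.exp (1 / 2 * |t|) := by
    rw [← Real.exp_add]; ring_nf
  have := herConst_pos n
  calc herConst n * Real.exp (-t ^ 2 / 2) * |Polynomial.eval t P|
      ≤ herConst n * (Real.exp (1 / 2) * Real.exp (-|t|)) * (C * Real.exp (1 / 2 * |t|)) := by
        gcongr; exact h t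
    _ = _ := by rw [h2]; ring

lemma lag_exp_decay (n : ℕ) :
    ∃ C : ℝ, 0 ≤ C ∧ ∀ t, 0 ≤ t → |lag n t| ≤ C * Real.exp (-t / 4) := by
  obtain ⟨P, hP⟩ := laguerrePoly_eq_eval n
  obtain ⟨C, hC, h⟩ := abs_eval_le_exp P (c := 1 / 4) (by norm_num)
  refine ⟨C, hC, fun t ht => ?_⟩
  have h1 := h t
  rw [abs_of_nonneg ht] at h1
  rw [lag, hP, abs_mul, Real.abs_exp]
  have h2 : Real.exp (-t / 4) = Real.exp (1 / 4 * t) * Real.exp (-t / 2) := by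
    rw [← Real.exp_add]; ring_nf
  rw [h2, ← mul_assoc]
  gcongr

lemma continuous_her (n : ℕ) : Continuous (her n) := (contDiff_her n).continuous

lemma continuous_lag (n : ℕ) : Continuous (lag n) := (contDiff_lag n).continuous

lemma integrable_exp_neg_abs_mul {c : ℝ} (hc : 0 < c) :
    Integrable (fun t : ℝ => Real.exp (-c * |t|)) := by
  rw [← integrableOn_univ, ← Set.Iic_union_Ioi (a := (0 : ℝ))]
  refine IntegrableOn.union ?_ ?_
  · refine (integrableOn_exp_mul_Iic hc 0).congr_fun (fun t ht => ?_) measurableSet_Iic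
    simp [abs_of_nonpos (Set.mem_Iic.1 ht)]
  · refine (integrableOn_exp_mul_Ioi (neg_lt_zero.2 hc) 0).congr_fun (fun t ht => ?_)
      measurableSet_Ioi
    simp [abs_of_pos (Set.mem_Ioi.1 ht)]

lemma her_mul_her_bound (n m : ℕ) :
    ∃ C : ℝ, 0 ≤ C ∧ ∀ t, |her n t * her m t| ≤ C * Real.exp (-1 * |t|) := by
  obtain ⟨C, hC, h⟩ := her_exp_decay n
  obtain ⟨D, hD, h'⟩ := her_exp_decay m
  refine ⟨C * D, by positivity, fun t => ?_⟩
  have e : Real.exp (-1 * |t|) = Real.exp (-|t| / 2) * Real.exp (-|t| / 2) := by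
    rw [← Real.exp_add]; ring_nf
  rw [abs_mul, e]
  calc _ ≤ C * Real.exp (-|t| / 2) * (D * Real.exp (-|t| / 2)) := by
        gcongr
        exacts [h t, h' t]
    _ = _ := by ring

lemma integrable_her_mul_her (n m : ℕ) : Integrable (fun t => her n t * her m t) := by
  obtain ⟨C, hC, h⟩ := her_mul_her_bound n m
  exact ((integrable_exp_neg_abs_mul one_pos).const_mul C).mono'
    ((continuous_her n).mul (continuous_her m)).aestronglyMeasurable (.of_forall h)

lemma tendsto_her_mul_her (n m : ℕ) :
    Filter.Tendsto (fun t => her n t * her m t) Filter.atTop (nhds 0) ∧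
    Filter.Tendsto (fun t => her n t * her m t) Filter.atBot (nhds 0) := by
  obtain ⟨C, hC, h⟩ := her_mul_her_bound n m
  have h0 : Filter.Tendsto (fun s : ℝ => C * Real.exp (-1 * s)) Filter.atTop (nhds 0) := by
    have := (Real.tendsto_exp_neg_atTop_nhds_zero).const_mul C
    simpa using this
  exact ⟨squeeze_zero_norm h (h0.comp Filter.tendsto_abs_atTop_atTop),
    squeeze_zero_norm h (h0.comp Filter.tendsto_abs_atBot_atTop)⟩

/-- By the differential equation the Wronskian of `h_n` and `h_m` has derivative `2(m - n) h_n h_m`,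
and it vanishes at both ends. -/
lemma integral_her_mul_her_of_ne {n m : ℕ} (hnm : n ≠ m) : ∫ t, her n t * her m t = 0 := by
  have hd : ∀ k t, HasDerivAt (her k) (deriv (her k) t) t := fun k t =>
    ((contDiff_her k).differentiable (by simp) t).hasDerivAt
  have hW : ∀ t, HasDerivAt (fun t => deriv (her n) t * her m t - her n t * deriv (her m) t)
      (2 * ((m : ℝ) - n) * (her n t * her m t)) t := fun t => by
    convert! ((hasDerivAt_deriv_her n t).mul (hd m t)).sub
      ((hd n t).mul (hasDerivAt_deriv_her m t)) using 1
    ring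
  have hW' : (fun t => deriv (her n) t * her m t - her n t * deriv (her m) t) =
      fun t => √(2 * n) / 2 * (her (n - 1) t * her m t) -
        √(2 * (n + 1)) / 2 * (her (n + 1) t * her m t) -
        (√(2 * m) / 2 * (her n t * her (m - 1) t) -
        √(2 * (m + 1)) / 2 * (her n t * her (m + 1) t)) := by
    funext t; rw [deriv_her, deriv_her]; ring
  have key := integral_of_hasDerivAt_of_tendsto (m := 0) (n := 0) hW
    ((integrable_her_mul_her n m).const_mul _) ?_ ?_
  · rw [integral_const_mul] at key
    have : (2 : ℝ) * ((m : ℝ) - n) ≠ 0 :=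
      mul_ne_zero two_ne_zero (sub_ne_zero.2 (by exact_mod_cast hnm.symm))
    simpa [this, sub_eq_zero] using key
  · rw [hW']
    simpa using ((((tendsto_her_mul_her (n - 1) m).2.const_mul _).sub
      ((tendsto_her_mul_her (n + 1) m).2.const_mul _)).sub
      (((tendsto_her_mul_her n (m - 1)).2.const_mul _).sub
      ((tendsto_her_mul_her n (m + 1)).2.const_mul _)))
  · rw [hW']
    simpa using ((((tendsto_her_mul_her (n - 1) m).1.const_mul _).sub
      ((tendsto_her_mul_her (n + 1) m).1.const_mul _)).sub
      (((tendsto_her_mul_her n (m - 1)).1.const_mul _).sub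
      ((tendsto_her_mul_her n (m + 1)).1.const_mul _)))

/-- Expand `t h_n h_{n+1}` by the recursion applied to either factor and integrate. Orthogonality
leaves the same multiple of the two squared norms. -/
lemma integral_her_mul_self (n : ℕ) : ∫ t, her n t * her n t = 1 := by
  induction n with
  | zero =>
    have h : ∀ t, her 0 t * her 0 t = (√Real.pi)⁻¹ * Real.exp (-1 * t ^ 2) := fun t => by
      have e : Real.exp (-1 * t ^ 2) = Real.exp (-t ^ 2 / 2) * Real.exp (-t ^ 2 / 2) := by
        rw [← Real.exp_add]; ring_nf
      have e2 : herConst 0 * herConst 0 = (√Real.pi)⁻¹ := by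
        simp only [herConst]
        rw [← mul_inv, Real.mul_self_sqrt (by positivity)]
        simp
      rw [her, hermitePoly_zero, e, ← e2]
      ring
    simp_rw [h]
    rw [integral_const_mul, integral_gaussian, div_one]
    have := Real.pi_pos
    exact inv_mul_cancel₀ (by positivity)
  | succ n ih =>
    have h : ∀ t, √(2 * (n + 1)) / 2 * (her (n + 1) t * her (n + 1) t) +
        √(2 * n) / 2 * (her (n - 1) t * her (n + 1) t) =
        √(2 * (n + 2)) / 2 * (her (n + 2) t * her n t) +
        √(2 * (n + 1)) / 2 * (her n t * her n t) := fun t => by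
      have h1 := mul_her n t
      have h2 := mul_her (n + 1) t
      rw [show ((n + 1 : ℕ) : ℝ) + 1 = n + 2 by push_cast; ring] at h2
      simp only [Nat.add_sub_cancel] at h2
      push_cast at h2
      linear_combination her n t * h2 - her (n + 1) t * h1
    have h' := congrArg (fun f : ℝ → ℝ => ∫ t, f t) (funext h)
    rw [integral_add ((integrable_her_mul_her _ _).const_mul _)
      ((integrable_her_mul_her _ _).const_mul _), integral_add
      ((integrable_her_mul_her _ _).const_mul _) ((integrable_her_mul_her _ _).const_mul _)] at h'
    simp only [integral_const_mul] at h'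
    rw [integral_her_mul_her_of_ne (show n - 1 ≠ n + 1 by omega),
      integral_her_mul_her_of_ne (show n + 2 ≠ n by omega), ih] at h'
    have : √((2 : ℝ) * (n + 1)) / 2 ≠ 0 := by positivity
    apply mul_left_cancel₀ this
    linarith

lemma integral_her_mul_her (n m : ℕ) : ∫ t, her n t * her m t = if n = m then 1 else 0 := by
  split_ifs with h
  · subst h; exact integral_her_mul_self n
  · exact integral_her_mul_her_of_ne h

lemma lag_mul_lag_bound (n m : ℕ) :
    ∃ C : ℝ, 0 ≤ C ∧ ∀ t, 0 ≤ t → |lag n t * lag m t| ≤ C * Real.exp (-(1 / 2) * t) := by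
  obtain ⟨C, hC, h⟩ := lag_exp_decay n
  obtain ⟨D, hD, h'⟩ := lag_exp_decay m
  refine ⟨C * D, by positivity, fun t ht => ?_⟩
  have e : Real.exp (-(1 / 2) * t) = Real.exp (-t / 4) * Real.exp (-t / 4) := by
    rw [← Real.exp_add]; ring_nf
  rw [abs_mul, e]
  calc _ ≤ C * Real.exp (-t / 4) * (D * Real.exp (-t / 4)) := by
        gcongr
        exacts [h t ht, h' t ht]
    _ = _ := by ring

lemma integrableOn_lag_mul_lag (n m : ℕ) :
    IntegrableOn (fun t => lag n t * lag m t) (Set.Ioi 0) := by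
  obtain ⟨C, hC, h⟩ := lag_mul_lag_bound n m
  refine ((exp_neg_integrableOn_Ioi 0 (b := 1 / 2) (by norm_num)).const_mul C).mono'
    ((continuous_lag n).mul (continuous_lag m)).aestronglyMeasurable ?_
  filter_upwards [ae_restrict_mem measurableSet_Ioi] with t ht
  exact h t (le_of_lt ht)

lemma tendsto_mul_lag_mul_lag (n m : ℕ) :
    Filter.Tendsto (fun t => lag n t * lag m t) Filter.atTop (nhds 0) := by
  obtain ⟨C, hC, h⟩ := lag_mul_lag_bound n m
  have h0 : Filter.Tendsto (fun s : ℝ => C * Real.exp (-(1 / 2) * s)) Filter.atTop (nhds 0) := by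
    have h1 : Filter.Tendsto (fun s : ℝ => (1 / 2) * s) Filter.atTop Filter.atTop :=
      Filter.tendsto_id.const_mul_atTop (by norm_num)
    have := ((Real.tendsto_exp_neg_atTop_nhds_zero).comp h1).const_mul C
    simpa [Function.comp_def] using this
  refine squeeze_zero_norm' ?_ h0
  filter_upwards [Filter.eventually_ge_atTop 0] with t ht
  exact h t ht

/-- In Sturm–Liouville form the quantity to differentiate is `t` times the Wronskian. The factor `t`
removes the boundary term at `0`. -/
lemma integral_lag_mul_lag_of_ne {n m : ℕ} (hnm : n ≠ m) :
    ∫ t in Set.Ioi 0, lag n t * lag m t = 0 := by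
  have hd : ∀ k t, HasDerivAt (lag k) (deriv (lag k) t) t := fun k t =>
    ((contDiff_lag k).differentiable (by simp) t).hasDerivAt
  have hdd : ∀ k t, HasDerivAt (deriv (lag k)) (deriv (deriv (lag k)) t) t := fun k t =>
    (((contDiff_infty_iff_deriv.1 (contDiff_lag k)).2.differentiable (by simp)) t).hasDerivAt
  have hW : ∀ t, HasDerivAt (fun t => t * (deriv (lag n) t * lag m t - lag n t * deriv (lag m) t))
      (((m : ℝ) - n) * (lag n t * lag m t)) t := fun t => by
    convert! (hasDerivAt_id t).mul (((hdd n t).mul (hd m t)).sub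
      ((hd n t).mul (hdd m t))) using 1
    simp only [id, Pi.sub_apply, Pi.mul_apply]
    linear_combination lag n t * lag_ode m t - lag m t * lag_ode n t
  have hW' : (fun t => t * (deriv (lag n) t * lag m t - lag n t * deriv (lag m) t)) =
      fun t => n * (lag n t * lag m t - lag (n - 1) t * lag m t) -
        m * (lag n t * lag m t - lag n t * lag (m - 1) t) := by
    funext t
    linear_combination lag m t * mul_deriv_lag n t - lag n t * mul_deriv_lag m t
  have key := integral_Ioi_of_hasDerivAt_of_tendsto' (m := 0) (a := 0) (fun t _ => hW t)
    ((integrableOn_lag_mul_lag n m).const_mul _) ?_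
  · rw [integral_const_mul] at key
    have : (m : ℝ) - n ≠ 0 := sub_ne_zero.2 (by exact_mod_cast hnm.symm)
    simpa [this] using key
  · rw [hW']
    simpa using (((tendsto_mul_lag_mul_lag n m).sub
      (tendsto_mul_lag_mul_lag (n - 1) m)).const_mul (n : ℝ)).sub
      (((tendsto_mul_lag_mul_lag n m).sub
      (tendsto_mul_lag_mul_lag n (m - 1))).const_mul (m : ℝ))

/-- The product `t l_n l_{n+1}` is expanded in two ways, as for the Hermite functions. -/
lemma integral_lag_mul_self (n : ℕ) : ∫ t in Set.Ioi 0, lag n t * lag n t = 1 := by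
  induction n with
  | zero =>
    have h : ∀ t, lag 0 t * lag 0 t = Real.exp (-t) := fun t => by
      rw [lag, laguerrePoly_zero, one_mul, ← Real.exp_add]; ring_nf
    simp_rw [h]
    exact integral_exp_neg_Ioi_zero
  | succ n ih =>
    have h : ∀ t, ((n : ℝ) + 1) * (lag (n + 1) t * lag (n + 1) t) +
        n * (lag (n - 1) t * lag (n + 1) t) =
        (-2) * (lag n t * lag (n + 1) t) +
        (((n : ℝ) + 1) * (lag n t * lag n t) +
        ((n : ℝ) + 2) * (lag (n + 2) t * lag n t)) := fun t => by
      have h1 := mul_lag n t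
      have h2 := mul_lag (n + 1) t
      simp only [Nat.add_sub_cancel] at h2
      push_cast at h2
      linear_combination lag (n + 1) t * h1 - lag n t * h2
    have h' := congrArg (fun f : ℝ → ℝ => ∫ t in Set.Ioi 0, f t) (funext h)
    have I := fun (c : ℝ) n m => (integrableOn_lag_mul_lag n m).const_mul c
    have I2 : Integrable (fun t => ((n : ℝ) + 1) * (lag n t * lag n t) +
        ((n : ℝ) + 2) * (lag (n + 2) t * lag n t)) (volume.restrict (Set.Ioi 0)) :=
      (I _ _ _).add (I _ _ _)
    rw [integral_add (I _ _ _) (I _ _ _), integral_add (I _ _ _) I2,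
      integral_add (I _ _ _) (I _ _ _)] at h'
    simp only [integral_const_mul] at h'
    rw [integral_lag_mul_lag_of_ne (show n - 1 ≠ n + 1 by omega),
      integral_lag_mul_lag_of_ne (show n + 2 ≠ n by omega),
      integral_lag_mul_lag_of_ne (show n ≠ n + 1 by omega), ih] at h'
    have : (n : ℝ) + 1 ≠ 0 := by positivity
    apply mul_left_cancel₀ this
    linarith

lemma integral_lag_mul_lag (n m : ℕ) :
    ∫ t in Set.Ioi 0, lag n t * lag m t = if n = m then 1 else 0 := by
  split_ifs with h
  · subst h; exact integral_lag_mul_self n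
  · exact integral_lag_mul_lag_of_ne h

/-! ### Connection coefficients -/

/-- The coefficients of `(1 - t)^{-1/2}`. -/
noncomputable def connCoeff (k : ℕ) : ℝ :=
  ∏ i ∈ Finset.range k, ((i : ℝ) + 1 / 2) / ((i : ℝ) + 1)

/-- The coefficients of `(1 - t)^{1/2}`. -/
noncomputable def connCoeffInv (k : ℕ) : ℝ :=
  ∏ i ∈ Finset.range k, ((i : ℝ) - 1 / 2) / ((i : ℝ) + 1)

lemma mul_connCoeff_succ (k : ℕ) : (k + 1) * connCoeff (k + 1) = (k + 1 / 2) * connCoeff k := by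
  have h1 : (k : ℝ) + 1 ≠ 0 := by positivity
  rw [connCoeff, Finset.prod_range_succ, ← connCoeff]
  field_simp

lemma mul_connCoeffInv_succ (k : ℕ) :
    (k + 1) * connCoeffInv (k + 1) = (k - 1 / 2) * connCoeffInv k := by
  have h1 : (k : ℝ) + 1 ≠ 0 := by positivity
  rw [connCoeffInv, Finset.prod_range_succ, ← connCoeffInv]
  field_simp

lemma abs_connCoeff_le (k : ℕ) : |connCoeff k| ≤ 1 := by
  rw [connCoeff, Finset.abs_prod]
  refine Finset.prod_le_one (fun _ _ => abs_nonneg _) fun i _ => ?_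
  rw [abs_of_nonneg (by positivity), div_le_one (by positivity)]
  linarith

lemma abs_connCoeffInv_le (k : ℕ) : |connCoeffInv k| ≤ 1 := by
  rw [connCoeffInv, Finset.abs_prod]
  refine Finset.prod_le_one (fun _ _ => abs_nonneg _) fun i _ => ?_
  have hi : (0 : ℝ) ≤ i := by positivity
  rw [abs_le, le_div_iff₀ (by positivity), div_le_one (by positivity)]
  constructor <;> linarith

/-- Coefficient form of `(1-t)^{1/2} = (1-t) (1-t)^{-1/2}`. -/
lemma connCoeffInv_succ (k : ℕ) : connCoeffInv (k + 1) = connCoeff (k + 1) - connCoeff k := by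
  induction k with
  | zero => norm_num [connCoeff, connCoeffInv]
  | succ k ih =>
    have h1 := mul_connCoeffInv_succ (k + 1)
    have h2 := mul_connCoeff_succ (k + 1)
    have h3 := mul_connCoeff_succ k
    push_cast at h1 h2
    have h0 : (k : ℝ) + 1 + 1 ≠ 0 := by positivity
    apply mul_left_cancel₀ h0
    rw [h1, ih]
    linear_combination -h2 + h3

/-- Coefficient form of `(1-t)^{-1} (1-t)^{1/2} = (1-t)^{-1/2}`; the partial sums telescope by
`connCoeffInv_succ`. -/
lemma sum_connCoeffInv (n : ℕ) :
    ∑ j ∈ Finset.range (n + 1), connCoeffInv (n - j) = connCoeff n := by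
  have h := Finset.sum_range_reflect connCoeffInv (n + 1)
  simp only [Nat.add_sub_cancel] at h
  rw [h]
  induction n with
  | zero => simp [connCoeff, connCoeffInv]
  | succ n ih =>
    have h := Finset.sum_range_reflect connCoeffInv (n + 1)
    simp only [Nat.add_sub_cancel] at h
    rw [Finset.sum_range_succ, ih h, connCoeffInv_succ]
    ring

/-- The square of `(1-t)^{-1/2}` is the geometric series. For the convolution `S_m`, the symmetry `j
↔ m - j` gives `m S_m = 2 ∑ c_{m-j} j c_j`. The recursion `(j+1) c_{j+1} = (j + 1/2) c_j` then
yields `(n+1) S_{n+1} = n S_n + S_n`. -/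
lemma sum_connCoeff_mul (n : ℕ) :
    ∑ j ∈ Finset.range (n + 1), connCoeff (n - j) * connCoeff j = 1 := by
  have refl : ∀ m, ∑ j ∈ Finset.range (m + 1), (((m - j : ℕ) : ℝ) * connCoeff (m - j)) * connCoeff j
      = ∑ j ∈ Finset.range (m + 1), connCoeff (m - j) * (j * connCoeff j) := fun m => by
    rw [← Finset.sum_range_reflect]
    refine Finset.sum_congr rfl fun j hj => ?_
    have : j ≤ m := Nat.lt_succ_iff.1 (Finset.mem_range.1 hj)
    simp only [Nat.add_sub_cancel, Nat.sub_sub_self this]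
    ring
  have tot : ∀ m : ℕ, (m : ℝ) * ∑ j ∈ Finset.range (m + 1), connCoeff (m - j) * connCoeff j =
      2 * ∑ j ∈ Finset.range (m + 1), connCoeff (m - j) * (j * connCoeff j) := fun m => by
    rw [two_mul]
    nth_rw 1 [← refl m]
    rw [← Finset.sum_add_distrib, Finset.mul_sum]
    refine Finset.sum_congr rfl fun j hj => ?_
    have : j ≤ m := Nat.lt_succ_iff.1 (Finset.mem_range.1 hj)
    rw [Nat.cast_sub this]
    ring
  induction n with
  | zero => simp [connCoeff]
  | succ n ih =>
    have h1 := tot (n + 1)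
    rw [Finset.sum_range_succ' (fun j => connCoeff (n + 1 - j) * (j * connCoeff j))] at h1
    simp only [Nat.add_sub_add_right, Nat.cast_add, Nat.cast_one, mul_connCoeff_succ] at h1
    simp only [add_mul, mul_add, Finset.sum_add_distrib] at h1
    rw [mul_left_comm] at h1
    have h2 := tot n
    have h3 : ∑ x ∈ Finset.range (n + 1), connCoeff (n - x) * (2⁻¹ * connCoeff x) =
        2⁻¹ * ∑ x ∈ Finset.range (n + 1), connCoeff (n - x) * connCoeff x := by
      rw [Finset.mul_sum]; exact Finset.sum_congr rfl fun _ _ => by ring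
    rw [ih] at h2 h3
    have h0 : (n : ℝ) + 1 ≠ 0 := by positivity
    apply mul_left_cancel₀ h0
    simp at h1
    rw [h3] at h1
    linarith

/-- Two sequences of functions with `u₀ = 1` and `u_{n+1}' = u_n' - 2 x u_n` are connected by any
convolution that connects their values at the origin. -/
lemma connection_of_deriv {u w u' w' : ℕ → ℝ → ℝ} (c : ℕ → ℝ)
    (hu : ∀ n x, HasDerivAt (u n) (u' n x) x) (hw : ∀ n x, HasDerivAt (w n) (w' n x) x)
    (hu0 : ∀ x, u' 0 x = 0) (hw0 : ∀ x, w' 0 x = 0)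
    (hu' : ∀ n x, u' (n + 1) x = u' n x - 2 * x * u n x)
    (hw' : ∀ n x, w' (n + 1) x = w' n x - 2 * x * w n x)
    (h0 : ∀ n, u n 0 = ∑ j ∈ Finset.range (n + 1), c (n - j) * w j 0) (n : ℕ) (x : ℝ) :
    u n x = ∑ j ∈ Finset.range (n + 1), c (n - j) * w j x := by
  have hder : ∀ n x, HasDerivAt (fun x => u n x - ∑ j ∈ Finset.range (n + 1), c (n - j) * w j x)
      (u' n x - ∑ j ∈ Finset.range (n + 1), c (n - j) * w' j x) x := fun n x =>
    (hu n x).sub (HasDerivAt.fun_sum fun j _ => (hw j x).const_mul _)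
  have concl : ∀ n, (∀ x, u' n x - ∑ j ∈ Finset.range (n + 1), c (n - j) * w' j x = 0) →
      ∀ x, u n x = ∑ j ∈ Finset.range (n + 1), c (n - j) * w j x := fun n h x => by
    have := is_const_of_deriv_eq_zero (fun x => (hder n x).differentiableAt)
      (fun x => by rw [(hder n x).deriv, h]) x 0
    simp only [h0 n, sub_self] at this
    linarith
  induction n generalizing x with
  | zero => exact concl 0 (fun x => by simp [hu0, hw0]) x
  | succ n ih =>
    have hn : ∀ x, u' n x - ∑ j ∈ Finset.range (n + 1), c (n - j) * w' j x = 0 := fun x => by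
      have h1 := hder n x
      have : (fun x => u n x - ∑ j ∈ Finset.range (n + 1), c (n - j) * w j x) = fun _ => 0 :=
        funext fun y => by rw [ih y, sub_self]
      rw [this] at h1
      exact h1.unique (hasDerivAt_const x 0)
    -- The term `j = 0` has zero derivative. By the recursions the remaining terms give the
    -- derivative of the `n`-th difference minus `2x` times that difference, and both vanish by
    -- induction.
    refine concl (n + 1) (fun x => ?_) x
    rw [Finset.sum_range_succ', hw0, mul_zero, add_zero]
    simp only [Nat.add_sub_add_right, hw', hu', mul_sub, Finset.sum_sub_distrib]
    have h2 : ∑ j ∈ Finset.range (n + 1), c (n - j) * (2 * x * w j x) = 2 * x * u n x := by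
      rw [ih x, Finset.mul_sum]
      exact Finset.sum_congr rfl fun _ _ => by ring
    rw [h2]
    linarith [hn x]

/-- The even Hermite polynomials, normalized as the Laguerre polynomials of type `-1/2`
evaluated at `x²`. -/
noncomputable def evenHermite (n : ℕ) (x : ℝ) : ℝ :=
  (-1) ^ n / (4 ^ n * n !) * hermitePoly (2 * n) x

/-- The derivative of `evenHermite n`. -/
noncomputable def evenHermite' (n : ℕ) (x : ℝ) : ℝ :=
  (-1) ^ n / (4 ^ n * n !) * (2 * (2 * n : ℕ) * hermitePoly (2 * n - 1) x)

/-- Combine `H_{2n+2}' = 4(n+1) H_{2n+1}` with `H_{2n+1} = 2x H_{2n} - H_{2n}'`. The normalization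
is chosen so that the factor `4(n+1)` cancels up to sign. -/
lemma evenHermite'_succ (n : ℕ) (x : ℝ) :
    evenHermite' (n + 1) x = evenHermite' n x - 2 * x * evenHermite n x := by
  have h := (hasDerivAt_hermitePoly (2 * n) x).unique (hasDerivAt_hermitePoly' (2 * n) x)
  rw [evenHermite', evenHermite', evenHermite, ← h, show 2 * (n + 1) - 1 = 2 * n + 1 by omega,
    Nat.factorial_succ]
  have h0 : (n : ℝ) + 1 ≠ 0 := by positivity
  have h1 : (n ! : ℝ) ≠ 0 := by positivity
  push_cast
  field_simp
  ring

lemma evenHermite_zero_right (n : ℕ) : evenHermite n 0 = connCoeff n := by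
  induction n with
  | zero => simp [evenHermite, hermitePoly_zero, connCoeff]
  | succ n ih =>
    have h := hermitePoly_succ_succ (2 * n) 0
    have h0 : (n : ℝ) + 1 ≠ 0 := by positivity
    have h1 : (n ! : ℝ) ≠ 0 := by positivity
    apply mul_left_cancel₀ h0
    rw [mul_connCoeff_succ, ← ih, evenHermite, evenHermite, show 2 * (n + 1) = 2 * n + 2 by ring, h,
      Nat.factorial_succ]
    push_cast
    field_simp
    ring

/-- Both families obey the same recursion for their derivatives, so a convolution connects them as
soon as it connects their values at `0`. These are `1` for the Laguerre and `c_n` for the even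
Hermite polynomials, so the two claims reduce to `sum_connCoeff_mul` and `sum_connCoeffInv`. -/
lemma laguerrePoly_sq (n : ℕ) (x : ℝ) :
    laguerrePoly n (x ^ 2) = ∑ j ∈ Finset.range (n + 1), connCoeff (n - j) * evenHermite j x ∧
    evenHermite n x = ∑ j ∈ Finset.range (n + 1), connCoeffInv (n - j) * laguerrePoly j (x ^ 2) := by
  have hL : ∀ n x, HasDerivAt (fun x => laguerrePoly n (x ^ 2)) (2 * x * laguerrePoly' n (x ^ 2)) x :=
    fun n x => by
      have := (hasDerivAt_laguerrePoly n (x ^ 2)).comp x (hasDerivAt_pow 2 x)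
      convert! this using 1
      simp; ring
  have hA : ∀ n x, HasDerivAt (evenHermite n) (evenHermite' n x) x :=
    fun n x => (hasDerivAt_hermitePoly' (2 * n) x).const_mul _
  have hA0 : ∀ x, evenHermite' 0 x = 0 := fun x => by simp [evenHermite']
  have hL0 : ∀ x : ℝ, 2 * x * laguerrePoly' 0 (x ^ 2) = 0 := fun x => by simp [laguerrePoly'_zero]
  have hL1 : ∀ n (x : ℝ), 2 * x * laguerrePoly' (n + 1) (x ^ 2) =
      2 * x * laguerrePoly' n (x ^ 2) - 2 * x * laguerrePoly n (x ^ 2) := fun n x => by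
    rw [laguerrePoly'_succ]; ring
  have hz : ∀ n, laguerrePoly n ((0 : ℝ) ^ 2) = 1 := fun n => by
    rw [zero_pow two_ne_zero, laguerrePoly_zero_right]
  constructor
  · refine connection_of_deriv connCoeff hL hA hL0 hA0 hL1 evenHermite'_succ (fun n => ?_) n x
    simp only [hz, evenHermite_zero_right, sum_connCoeff_mul]
  · refine connection_of_deriv (w := fun n x => laguerrePoly n (x ^ 2)) connCoeffInv
      hA hL hA0 hL0 evenHermite'_succ hL1 (fun n => ?_) n x
    simp only [hz, evenHermite_zero_right, mul_one, sum_connCoeffInv]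

/-- The ratio between `evenHermite n` times the Gaussian factor and the Hermite function. -/
noncomputable def evenRatio (n : ℕ) : ℝ := (-1) ^ n / (4 ^ n * n !) / herConst (2 * n)

lemma evenRatio_ne_zero (n : ℕ) : evenRatio n ≠ 0 := by
  have := herConst_pos (2 * n)
  unfold evenRatio
  have h : ((-1 : ℝ)) ^ n ≠ 0 := by simp
  positivity

lemma evenHermite_mul_exp (n : ℕ) (x : ℝ) :
    evenHermite n x * Real.exp (-x ^ 2 / 2) = evenRatio n * her (2 * n) x := by
  have := (herConst_pos (2 * n)).ne'
  rw [evenHermite, evenRatio, her]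
  field_simp

lemma lag_sq (n : ℕ) (x : ℝ) :
    lag n (x ^ 2) =
      ∑ j ∈ Finset.range (n + 1), connCoeff (n - j) * evenRatio j * her (2 * j) x := by
  rw [lag, (laguerrePoly_sq n x).1, Finset.sum_mul]
  refine Finset.sum_congr rfl fun j _ => ?_
  rw [mul_assoc, evenHermite_mul_exp, mul_assoc]

lemma her_eq_sum_lag_sq (n : ℕ) (x : ℝ) :
    her (2 * n) x = (evenRatio n)⁻¹ *
      ∑ j ∈ Finset.range (n + 1), connCoeffInv (n - j) * lag j (x ^ 2) := by
  rw [eq_inv_mul_iff_mul_eq₀ (evenRatio_ne_zero n), ← evenHermite_mul_exp,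
    (laguerrePoly_sq n x).2, Finset.sum_mul]
  refine Finset.sum_congr rfl fun j _ => ?_
  rw [lag, mul_assoc]

lemma evenRatio_eq (n : ℕ) : evenRatio n =
    (-1) ^ n * Real.pi ^ ((1 : ℝ) / 4) * √((2 * n)! : ℝ) / (2 ^ n * n !) := by
  have hp : √(√Real.pi) = Real.pi ^ ((1 : ℝ) / 4) := by
    rw [Real.sqrt_eq_rpow, Real.sqrt_eq_rpow, ← Real.rpow_mul Real.pi_pos.le]; norm_num
  have h2 : √((2 : ℝ) ^ (2 * n)) = 2 ^ n := by
    rw [mul_comm, pow_mul, Real.sqrt_sq (by positivity)]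
  have h4 : (4 : ℝ) ^ n = 2 ^ n * 2 ^ n := by rw [← mul_pow]; norm_num
  rw [evenRatio, herConst, div_inv_eq_mul, Real.sqrt_mul (by positivity),
    Real.sqrt_mul (by positivity), hp, h2, h4]
  field_simp

/-- Reduces the size of the ratio to that of a central binomial coefficient. The crude bounds
`C(2n,n) ≤ 4^n ≤ (2n+1) C(2n,n)` then suffice, since only polynomial growth matters later. -/
lemma evenRatio_sq (n : ℕ) : evenRatio n ^ 2 = √Real.pi * (n.centralBinom / 4 ^ n) := by
  have hp : (Real.pi ^ ((1 : ℝ) / 4)) ^ 2 = √Real.pi := by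
    rw [Real.sqrt_eq_rpow, ← Real.rpow_natCast, ← Real.rpow_mul Real.pi_pos.le]; norm_num
  have h4 : (4 : ℝ) ^ n = (2 ^ n) ^ 2 := by rw [← pow_mul, mul_comm, pow_mul]; norm_num
  have hc : ((2 * n)! : ℝ) = n.centralBinom * (n ! : ℝ) ^ 2 := by
    have := Nat.choose_mul_factorial_mul_factorial (show n ≤ 2 * n by omega)
    rw [show 2 * n - n = n by omega] at this
    rw [← this, Nat.centralBinom]; push_cast; ring
  have hs : ((-1 : ℝ) ^ n) ^ 2 = 1 := by rw [← pow_mul, mul_comm, pow_mul]; simp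
  rw [evenRatio_eq, div_pow, mul_pow, mul_pow, hp, hs, Real.sq_sqrt (by positivity), hc, h4]
  field_simp

lemma abs_evenRatio_le (n : ℕ) : |evenRatio n| ≤ 2 := by
  apply abs_le_of_sq_le_sq _ (by norm_num)
  rw [evenRatio_sq]
  have h1 : (n.centralBinom : ℝ) / 4 ^ n ≤ 1 := by
    rw [div_le_one (by positivity)]
    have := Nat.choose_le_two_pow (2 * n) n
    rw [pow_mul] at this
    exact_mod_cast this
  have h2 : √Real.pi ≤ 2 := by
    rw [Real.sqrt_le_left (by norm_num)]
    linarith [Real.pi_le_four]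
  have h3 : (0 : ℝ) ≤ (n.centralBinom : ℝ) / 4 ^ n := by positivity
  nlinarith [Real.sqrt_nonneg Real.pi]

lemma abs_evenRatio_inv_le (n : ℕ) : |(evenRatio n)⁻¹| ≤ 2 * n + 1 := by
  have h0 : (0 : ℝ) < 2 * n + 1 := by positivity
  apply abs_le_of_sq_le_sq _ h0.le
  rw [inv_pow, evenRatio_sq]
  have hb : (1 : ℝ) ≤ (2 * n + 1) * ((n.centralBinom : ℝ) / 4 ^ n) := by
    rw [← mul_div_assoc, one_le_div (by positivity)]
    exact_mod_cast Nat.four_pow_le_two_mul_add_one_mul_central_binom n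
  have hpi : (1 : ℝ) ≤ √Real.pi := by
    rw [Real.one_le_sqrt]; linarith [Real.pi_gt_three]
  set c := (n.centralBinom : ℝ) / 4 ^ n
  have hc : 0 < c := by
    by_contra h
    push Not at h
    nlinarith
  rw [inv_le_comm₀ (by positivity) (by positivity)]
  have : ((2 * (n : ℝ) + 1) ^ 2)⁻¹ ≤ (2 * (n : ℝ) + 1)⁻¹ := by
    apply inv_anti₀ h0
    nlinarith [(Nat.cast_nonneg n : (0 : ℝ) ≤ n)]
  have h2 : (2 * (n : ℝ) + 1)⁻¹ ≤ c := by
    rw [inv_le_iff_one_le_mul₀ h0]; linarith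
  nlinarith

/-! ### Polynomially bounded families of functions of one variable -/

/-- A family `u n` of functions whose values on `I`, weighted with `(1 + |t|)^k`, are bounded by a
power of `n + 1`. -/
def PolyBdd (I : Set ℝ) (k : ℕ) (u : ℕ → ℝ → ℝ) : Prop :=
  ∃ C : ℝ, 0 ≤ C ∧ ∃ p : ℕ, ∀ n : ℕ, ∀ t ∈ I, (1 + |t|) ^ k * |u n t| ≤ C * ((n : ℝ) + 1) ^ p

namespace PolyBdd

variable {I : Set ℝ} {k : ℕ} {u w : ℕ → ℝ → ℝ}

lemma of_le (hw : PolyBdd I k w) (h : ∀ n, ∀ t ∈ I, |u n t| ≤ |w n t|) : PolyBdd I k u := by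
  obtain ⟨C, hC, p, hp⟩ := hw
  refine ⟨C, hC, p, fun n t ht => le_trans ?_ (hp n t ht)⟩
  exact mul_le_mul_of_nonneg_left (h n t ht) (by positivity)

lemma add (hu : PolyBdd I k u) (hw : PolyBdd I k w) : PolyBdd I k (fun n t => u n t + w n t) := by
  obtain ⟨C, hC, p, hp⟩ := hu
  obtain ⟨D, hD, q, hq⟩ := hw
  refine ⟨C + D, by positivity, p + q, fun n t ht => ?_⟩
  have h1 : (1 : ℝ) ≤ (n : ℝ) + 1 := by linarith [(Nat.cast_nonneg n : (0 : ℝ) ≤ n)]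
  calc (1 + |t|) ^ k * |u n t + w n t| ≤ (1 + |t|) ^ k * (|u n t| + |w n t|) := by
        gcongr; exact abs_add_le _ _
    _ ≤ C * ((n : ℝ) + 1) ^ p + D * ((n : ℝ) + 1) ^ q := by
        rw [mul_add]; exact add_le_add (hp n t ht) (hq n t ht)
    _ ≤ C * ((n : ℝ) + 1) ^ (p + q) + D * ((n : ℝ) + 1) ^ (p + q) := by
        gcongr <;> first | exact h1 | omega
    _ = _ := by ring

lemma neg (hu : PolyBdd I k u) : PolyBdd I k (fun n t => -u n t) :=
  hu.of_le fun n t _ => by rw [abs_neg]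

lemma sub (hu : PolyBdd I k u) (hw : PolyBdd I k w) : PolyBdd I k (fun n t => u n t - w n t) := by
  simpa only [sub_eq_add_neg] using hu.add hw.neg

lemma succ (hu : PolyBdd I k u) : PolyBdd I k (fun n => u (n + 1)) := by
  obtain ⟨C, hC, p, hp⟩ := hu
  refine ⟨C * 2 ^ p, by positivity, p, fun n t ht => (hp (n + 1) t ht).trans ?_⟩
  rw [mul_assoc, ← mul_pow]
  gcongr
  push_cast
  linarith [(Nat.cast_nonneg n : (0 : ℝ) ≤ n)]

lemma pred (hu : PolyBdd I k u) : PolyBdd I k (fun n => u (n - 1)) := by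
  obtain ⟨C, hC, p, hp⟩ := hu
  refine ⟨C, hC, p, fun n t ht => (hp (n - 1) t ht).trans ?_⟩
  gcongr
  omega

lemma coeff_mul (hu : PolyBdd I k u) {c : ℕ → ℝ} {K : ℝ} (hc : ∀ n : ℕ, |c n| ≤ K * ((n : ℝ) + 1)) :
    PolyBdd I k (fun n t => c n * u n t) := by
  obtain ⟨C, hC, p, hp⟩ := hu
  have hK : 0 ≤ K := by simpa using (abs_nonneg _).trans (hc 0)
  refine ⟨C * K, by positivity, p + 1, fun n t ht => ?_⟩
  rw [abs_mul]
  calc (1 + |t|) ^ k * (|c n| * |u n t|) = |c n| * ((1 + |t|) ^ k * |u n t|) := by ring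
    _ ≤ (K * ((n : ℝ) + 1)) * (C * ((n : ℝ) + 1) ^ p) := by
        exact mul_le_mul (hc n) (hp n t ht) (by positivity) (by positivity)
    _ = _ := by ring

lemma sum_range (hu : PolyBdd I k u) : PolyBdd I k (fun n t => ∑ j ∈ Finset.range n, u j t) := by
  obtain ⟨C, hC, p, hp⟩ := hu
  refine ⟨C, hC, p + 1, fun n t ht => ?_⟩
  have h : ∀ j ∈ Finset.range n, (1 + |t|) ^ k * |u j t| ≤ C * ((n : ℝ) + 1) ^ p := fun j hj => by
    refine (hp j t ht).trans ?_
    gcongr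
    exact (Finset.mem_range.1 hj).le
  calc (1 + |t|) ^ k * |∑ j ∈ Finset.range n, u j t|
      ≤ (1 + |t|) ^ k * ∑ j ∈ Finset.range n, |u j t| := by
        gcongr; exact Finset.abs_sum_le_sum_abs _ _
    _ ≤ ∑ j ∈ Finset.range n, C * ((n : ℝ) + 1) ^ p := by
        rw [Finset.mul_sum]; exact Finset.sum_le_sum h
    _ = n * (C * ((n : ℝ) + 1) ^ p) := by simp
    _ ≤ ((n : ℝ) + 1) * (C * ((n : ℝ) + 1) ^ p) := by gcongr; linarith
    _ = _ := by ring

/-- One more power of the weight costs a bound on `t u_n`, which the three-term recursions express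
through neighbouring indices. -/
lemma weight_succ (hu : PolyBdd I k u) (hu' : PolyBdd I k (fun n t => t * u n t)) :
    PolyBdd I (k + 1) u := by
  obtain ⟨C, hC, p, hp⟩ := (hu.of_le (u := fun n t => |u n t|) fun n t _ => by rw [abs_abs]).add
    (hu'.of_le (u := fun n t => |t * u n t|) fun n t _ => by rw [abs_abs])
  refine ⟨C, hC, p, fun n t ht => (le_of_eq ?_).trans (hp n t ht)⟩
  rw [abs_of_nonneg (a := |u n t| + |t * u n t|) (by positivity), abs_mul]
  ring

end PolyBdd

/-! ### Uniform weighted bounds for the Hermite and Laguerre functions and their derivatives. -/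

lemma sqrt_two_mul_half_le (x : ℝ) (hx : 1 ≤ x) : √(2 * x) / 2 ≤ x := by
  have : √(2 * x) ≤ 2 * x := by
    rw [Real.sqrt_le_left (by linarith)]; nlinarith
  linarith

lemma abs_sqrt_coeff_le (n : ℕ) :
    |√(2 * (n : ℝ)) / 2| ≤ 1 * ((n : ℝ) + 1) ∧ |√(2 * ((n : ℝ) + 1)) / 2| ≤ 1 * ((n : ℝ) + 1) := by
  have h := sqrt_two_mul_half_le ((n : ℝ) + 1) (by linarith [(Nat.cast_nonneg n : (0 : ℝ) ≤ n)])
  have h' : √(2 * (n : ℝ)) ≤ √(2 * ((n : ℝ) + 1)) := by gcongr; linarith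
  rw [abs_of_nonneg (by positivity), abs_of_nonneg (by positivity), one_mul]
  exact ⟨by linarith, h⟩

/-- A one-dimensional Sobolev estimate: `h_n(t)² = ∫_{-∞}^t 2 h_n h_n' ≤ ∫ (h_n² + h_n'²)`. The
ladder formula bounds `h_n'²` by `n h_{n-1}² + (n+1) h_{n+1}²`, so the total is at most `1 + n +
(n+1)`. -/
lemma her_sq_le (n : ℕ) (t : ℝ) : her n t ^ 2 ≤ 2 * n + 2 := by
  have I := integrable_her_mul_her
  set F : ℝ → ℝ := fun s => her n s * her n s + (n * (her (n - 1) s * her (n - 1) s) +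
    (n + 1) * (her (n + 1) s * her (n + 1) s)) with hF
  have IF2 : Integrable (fun s => n * (her (n - 1) s * her (n - 1) s) +
    ((n : ℝ) + 1) * (her (n + 1) s * her (n + 1) s)) := ((I _ _).const_mul _).add ((I _ _).const_mul _)
  have IF : Integrable F := (I n n).add IF2
  have hFint : ∫ s, F s = 2 * n + 2 := by
    rw [hF, integral_add (I n n) IF2, integral_add ((I _ _).const_mul _) ((I _ _).const_mul _),
      integral_const_mul, integral_const_mul, integral_her_mul_self, integral_her_mul_self,
      integral_her_mul_self]
    ring
  have hd : ∀ s, HasDerivAt (fun s => her n s * her n s) (2 * (her n s * deriv (her n) s)) s :=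
    fun s => by
      have h := ((contDiff_her n).differentiable (by simp) s).hasDerivAt
      convert! h.mul h using 1
      ring
  have hle : ∀ s, |2 * (her n s * deriv (her n) s)| ≤ F s := fun s => by
    have h1 : (deriv (her n) s) ^ 2 ≤ n * (her (n - 1) s * her (n - 1) s) +
        (n + 1) * (her (n + 1) s * her (n + 1) s) := by
      have e1 : √(2 * (n : ℝ)) ^ 2 = 2 * n := Real.sq_sqrt (by positivity)
      have e2 : √(2 * ((n : ℝ) + 1)) ^ 2 = 2 * (n + 1) := Real.sq_sqrt (by positivity)
      rw [deriv_her]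
      -- The parallelogram identity, giving `(a - b)² ≤ 2a² + 2b²` for the two terms of the ladder
      -- formula.
      have : (n : ℝ) * (her (n - 1) s * her (n - 1) s) +
        (n + 1) * (her (n + 1) s * her (n + 1) s) -
        (√(2 * n) / 2 * her (n - 1) s - √(2 * (n + 1)) / 2 * her (n + 1) s) ^ 2 =
        (√(2 * n) / 2 * her (n - 1) s + √(2 * (n + 1)) / 2 * her (n + 1) s) ^ 2 := by
        linear_combination -(her (n - 1) s) ^ 2 / 2 * e1 - (her (n + 1) s) ^ 2 / 2 * e2
      nlinarith [sq_nonneg (√(2 * n) / 2 * her (n - 1) s + √(2 * (n + 1)) / 2 * her (n + 1) s)]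
    rw [abs_le]
    constructor <;> simp only [hF]
    · nlinarith [sq_nonneg (her n s + deriv (her n) s)]
    · nlinarith [sq_nonneg (her n s - deriv (her n) s)]
  have hcont : Continuous (deriv (her n)) := (contDiff_her n).continuous_deriv (by simp)
  have Id : Integrable (fun s => 2 * (her n s * deriv (her n) s)) :=
    IF.mono' (((continuous_her n).mul hcont).const_mul 2).aestronglyMeasurable (.of_forall hle)
  have key := integral_Iic_of_hasDerivAt_of_tendsto' (a := t) (fun s _ => hd s) Id.integrableOn
    (tendsto_her_mul_her n n).2
  rw [sub_zero] at key
  rw [sq, ← key, ← hFint]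
  calc ∫ s in Set.Iic t, 2 * (her n s * deriv (her n) s) ≤ ∫ s in Set.Iic t, F s :=
        setIntegral_mono Id.integrableOn IF.integrableOn fun s => (le_abs_self _).trans (hle s)
    _ ≤ ∫ s, F s := setIntegral_le_integral IF (.of_forall fun s => (abs_nonneg _).trans (hle s))

lemma polyBdd_her_zero : PolyBdd Set.univ 0 her := by
  refine ⟨2, by norm_num, 1, fun n t _ => ?_⟩
  have h0 : (0 : ℝ) ≤ n := Nat.cast_nonneg n
  rw [pow_zero, one_mul, pow_one]
  apply abs_le_of_sq_le_sq _ (by positivity)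
  nlinarith [her_sq_le n t]

lemma polyBdd_her (k : ℕ) : PolyBdd Set.univ k her := by
  induction k with
  | zero => exact polyBdd_her_zero
  | succ k ih =>
    refine ih.weight_succ ?_
    simp_rw [mul_her]
    exact (ih.succ.coeff_mul fun n => (abs_sqrt_coeff_le n).2).add
      (ih.pred.coeff_mul fun n => (abs_sqrt_coeff_le n).1)

lemma polyBdd_iteratedDeriv_her (k m : ℕ) :
    PolyBdd Set.univ k (fun n => iteratedDeriv m (her n)) := by
  induction m with
  | zero => simpa using polyBdd_her k
  | succ m ih =>
    have hm : ((m : ℕ∞) : ℕ∞ω) ≤ ∞ := by exact_mod_cast le_top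
    have h : (fun n => iteratedDeriv (m + 1) (her n)) = fun (n : ℕ) (t : ℝ) =>
        √(2 * n) / 2 * iteratedDeriv m (her (n - 1)) t -
        √(2 * (n + 1)) / 2 * iteratedDeriv m (her (n + 1)) t := by
      funext n t
      have c := fun n => ((contDiff_her n).contDiffAt (x := t)).of_le hm
      rw [iteratedDeriv_succ', deriv_her,
        iteratedDeriv_fun_sub (contDiffAt_const.mul (c _)) (contDiffAt_const.mul (c _)),
        iteratedDeriv_const_mul_field, iteratedDeriv_const_mul_field]
    rw [h]
    exact (ih.pred.coeff_mul fun n => (abs_sqrt_coeff_le n).1).sub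
      (ih.succ.coeff_mul fun n => (abs_sqrt_coeff_le n).2)

/-- Transferred from the Hermite functions at `√t`: by `lag_sq`, `l_n(t)` is a sum of `n + 1` terms
with bounded coefficients. -/
lemma polyBdd_lag_zero : PolyBdd (Set.Ici 0) 0 lag := by
  obtain ⟨C, hC, p, hp⟩ := polyBdd_her_zero
  refine ⟨2 * C * 2 ^ p, by positivity, p + 1, fun n t ht => ?_⟩
  have ht' : t = √t ^ 2 := (Real.sq_sqrt ht).symm
  rw [pow_zero, one_mul]
  nth_rw 1 [ht']
  rw [lag_sq]
  have hn : (0 : ℝ) ≤ n := Nat.cast_nonneg n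
  refine (Finset.abs_sum_le_sum_abs _ _).trans ?_
  have h : ∀ j ∈ Finset.range (n + 1), |connCoeff (n - j) * evenRatio j * her (2 * j) √t| ≤
      1 * 2 * (C * (2 * ((n : ℝ) + 1)) ^ p) := fun j hj => by
    have hj' : (j : ℝ) ≤ n := by exact_mod_cast Nat.lt_succ_iff.1 (Finset.mem_range.1 hj)
    have h3 := hp (2 * j) (√t) trivial
    rw [pow_zero, one_mul] at h3
    rw [abs_mul, abs_mul]
    have h4 : |her (2 * j) √t| ≤ C * (2 * ((n : ℝ) + 1)) ^ p := by
      refine h3.trans ?_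
      gcongr
      push_cast
      linarith
    gcongr
    · exact abs_connCoeff_le _
    · exact abs_evenRatio_le _
  refine (Finset.sum_le_sum h).trans (le_of_eq ?_)
  rw [Finset.sum_const, Finset.card_range, nsmul_eq_mul, mul_pow]
  push_cast
  ring

lemma polyBdd_lag (k : ℕ) : PolyBdd (Set.Ici 0) k lag := by
  induction k with
  | zero => exact polyBdd_lag_zero
  | succ k ih =>
    have hn : ∀ n : ℕ, (0 : ℝ) ≤ n := fun n => Nat.cast_nonneg n
    refine ih.weight_succ ?_
    simp_rw [mul_lag]
    refine ((ih.coeff_mul (K := 2) fun n => ?_).sub (ih.pred.coeff_mul (K := 1) fun n => ?_)).sub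
      (ih.succ.coeff_mul (K := 1) fun n => ?_)
    all_goals rw [abs_of_nonneg (by positivity)]; linarith [hn n]

lemma polyBdd_iteratedDeriv_lag (k m : ℕ) :
    PolyBdd (Set.Ici 0) k (fun n => iteratedDeriv m (lag n)) := by
  induction m with
  | zero => simpa using polyBdd_lag k
  | succ m ih =>
    have hm : ((m : ℕ∞) : ℕ∞ω) ≤ ∞ := by exact_mod_cast le_top
    have h : (fun n => iteratedDeriv (m + 1) (lag n)) = fun (n : ℕ) (t : ℝ) =>
        -(1 / 2) * iteratedDeriv m (lag n) t -
        ∑ j ∈ Finset.range n, iteratedDeriv m (lag j) t := by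
      funext n t
      have c := fun n => ((contDiff_lag n).contDiffAt (x := t)).of_le hm
      rw [iteratedDeriv_succ', deriv_lag,
        iteratedDeriv_fun_sub (contDiffAt_const.mul (c _)) (ContDiffAt.sum fun j _ => c j),
        iteratedDeriv_const_mul_field, iteratedDeriv_fun_sum fun j _ => c j]
    rw [h]
    refine (ih.coeff_mul (c := fun _ => -(1 / 2)) (K := 1) fun n => ?_).sub ih.sum_range
    rw [abs_neg, abs_of_nonneg (by norm_num)]
    linarith [(Nat.cast_nonneg n : (0 : ℝ) ≤ n)]

/-! ### Tempered families of functions of several variables -/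

variable {d : ℕ}

lemma le_len (n : MultiIndex d) (j : Fin d) : n j ≤ len n :=
  Finset.single_le_sum (fun _ _ => Nat.zero_le _) (Finset.mem_univ j)

lemma one_le_len_add_one (n : MultiIndex d) : (1 : ℝ) ≤ (len n : ℝ) + 1 := by
  linarith [(Nat.cast_nonneg (len n) : (0 : ℝ) ≤ len n)]

/-- A family of smooth functions all of whose derivatives are rapidly decreasing on `U`, with
bounds growing at most polynomially in the index. -/
def TempFam (U : Set (Fin d → ℝ)) (F : MultiIndex d → (Fin d → ℝ) → ℂ) : Prop :=
  (∀ n, ContDiff ℝ ∞ (F n)) ∧ ∀ k m : ℕ, ∃ C : ℝ, 0 ≤ C ∧ ∃ p : ℕ, ∀ n, ∀ x ∈ U,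
    (1 + ‖x‖) ^ k * ‖iteratedFDeriv ℝ m (F n) x‖ ≤ C * ((len n : ℝ) + 1) ^ p

lemma one_add_norm_le_prod (x : Fin d → ℝ) : 1 + ‖x‖ ≤ ∏ j, (1 + |x j|) := by
  have h1 : ∀ s : Finset (Fin d), (1 : ℝ) ≤ ∏ j ∈ s, (1 + |x j|) := fun s =>
    Finset.one_le_prod fun j _ => le_add_of_nonneg_right (abs_nonneg _)
  suffices ‖x‖ ≤ ∏ j, (1 + |x j|) - 1 by linarith
  refine (pi_norm_le_iff_of_nonneg (sub_nonneg.2 (h1 _))).2 fun i => ?_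
  rw [← Finset.mul_prod_erase _ _ (Finset.mem_univ i), Real.norm_eq_abs]
  nlinarith [h1 (Finset.univ.erase i), abs_nonneg (x i)]

/-- The tensor product of functions of one variable. -/
noncomputable def tensor (A : Fin d → ℝ → ℝ) (x : Fin d → ℝ) : ℂ := ((∏ j, A j (x j) : ℝ) : ℂ)

lemma tensor_eq_prod (A : Fin d → ℝ → ℝ) :
    tensor A = fun x => ∏ j, ((A j (x j) : ℝ) : ℂ) := by
  funext x; simp [tensor]

lemma contDiff_tensor_factor {f : ℝ → ℝ} (hf : ContDiff ℝ ∞ f) (j : Fin d) :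
    ContDiff ℝ ∞ (fun x : Fin d → ℝ => ((f (x j) : ℝ) : ℂ)) :=
  Complex.ofRealCLM.contDiff.comp (hf.comp (contDiff_apply ℝ ℝ j))

lemma contDiff_tensor {A : Fin d → ℝ → ℝ} (hA : ∀ j, ContDiff ℝ ∞ (A j)) :
    ContDiff ℝ ∞ (tensor A) := by
  rw [tensor_eq_prod]
  exact contDiff_prod fun j _ => contDiff_tensor_factor (hA j) j

lemma norm_iteratedFDeriv_tensor_factor_le {f : ℝ → ℝ} (hf : ContDiff ℝ ∞ f) (j : Fin d) (m : ℕ)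
    (x : Fin d → ℝ) :
    ‖iteratedFDeriv ℝ m (fun x : Fin d → ℝ => ((f (x j) : ℝ) : ℂ)) x‖ ≤
      |iteratedDeriv m f (x j)| := by
  have hm : ((m : ℕ∞) : ℕ∞ω) ≤ ∞ := by exact_mod_cast le_top
  have h1 := Complex.ofRealLI.norm_iteratedFDeriv_comp_left (n := ∞) (i := m)
    (f := f ∘ ((ContinuousLinearMap.proj j : (Fin d → ℝ) →L[ℝ] ℝ))) (x := x)
    (hf.comp (contDiff_apply ℝ ℝ j)).contDiffAt hm
  have h2 := ((ContinuousLinearMap.proj j : (Fin d → ℝ) →L[ℝ] ℝ)).iteratedFDeriv_comp_right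
    hf x hm
  have h3 : ‖(ContinuousLinearMap.proj j : (Fin d → ℝ) →L[ℝ] ℝ)‖ ≤ 1 :=
    ContinuousLinearMap.opNorm_le_bound _ zero_le_one fun y => by
      simpa using norm_le_pi_norm y j
  rw [h2] at h1
  refine h1.le.trans ((ContinuousMultilinearMap.norm_compContinuousLinearMap_le _ _).trans ?_)
  rw [norm_iteratedFDeriv_eq_norm_iteratedDeriv]
  refine (mul_le_mul_of_nonneg_left (Finset.prod_le_one (fun _ _ => norm_nonneg _)
    fun _ _ => h3) (norm_nonneg _)).trans ?_
  simp

/-- Leibniz' rule distributes the `m` derivatives over the factors. The weight distributes as well,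
by `one_add_norm_le_prod`, so each coordinate is handled by its one-variable bound. -/
lemma tempFam_tensor {I : Set ℝ} {u : ℕ → ℝ → ℝ} (hu : ∀ n, ContDiff ℝ ∞ (u n))
    (hb : ∀ k m, PolyBdd I k (fun n => iteratedDeriv m (u n))) :
    TempFam {x : Fin d → ℝ | ∀ j, x j ∈ I} (fun n => tensor fun j => u (n j)) := by
  refine ⟨fun n => contDiff_tensor fun j => hu (n j), fun k m => ?_⟩
  have hm : ((m : ℕ∞) : ℕ∞ω) ≤ ∞ := by exact_mod_cast le_top
  choose C hC p hp using hb k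
  refine ⟨∑ s ∈ (Finset.univ : Finset (Fin d)).sym m, ((s : Multiset (Fin d)).countPerms : ℝ) *
    ∏ j, C ((s : Multiset (Fin d)).count j), Finset.sum_nonneg fun s _ =>
      mul_nonneg (Nat.cast_nonneg _) (Finset.prod_nonneg fun j _ => hC _),
    -- The sum of all `p i` with `i ≤ m` is a common exponent for one factor, whatever number of
    -- derivatives falls on it; there are `d` factors.
    (∑ i ∈ Finset.range (m + 1), p i) * d, fun n x hx => ?_⟩
  have h1 := norm_iteratedFDeriv_prod_le (𝕜 := ℝ) (u := (Finset.univ : Finset (Fin d)))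
    (f := fun j (x : Fin d → ℝ) => ((u (n j) (x j) : ℝ) : ℂ)) (x := x)
    (fun j _ => contDiff_tensor_factor (hu (n j)) j) hm
  beta_reduce
  rw [tensor_eq_prod]
  refine (mul_le_mul_of_nonneg_left h1 (by positivity)).trans ?_
  rw [Finset.mul_sum, Finset.sum_mul]
  refine Finset.sum_le_sum fun s hs => ?_
  rw [mul_left_comm, mul_assoc]
  refine mul_le_mul_of_nonneg_left ?_ (Nat.cast_nonneg _)
  have hw : (1 + ‖x‖) ^ k ≤ ∏ j, (1 + |x j|) ^ k := by
    rw [Finset.prod_pow]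
    exact pow_le_pow_left₀ (by positivity) (one_add_norm_le_prod x) k
  calc _ ≤ (∏ j, (1 + |x j|) ^ k) *
        ∏ j, |iteratedDeriv ((s : Multiset (Fin d)).count j) (u (n j)) (x j)| := by
        gcongr
        exact norm_iteratedFDeriv_tensor_factor_le (hu _) _ _ _
    _ ≤ ∏ j, C ((s : Multiset (Fin d)).count j) *
        ((len n : ℝ) + 1) ^ (∑ i ∈ Finset.range (m + 1), p i) := by
        rw [← Finset.prod_mul_distrib]
        refine Finset.prod_le_prod (fun j _ => by positivity) fun j _ => ?_
        refine (hp _ (n j) (x j) (hx j)).trans ?_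
        have := hC ((s : Multiset (Fin d)).count j)
        have hc : (s : Multiset (Fin d)).count j < m + 1 := by
          have := Multiset.count_le_card j (s : Multiset (Fin d))
          rw [Sym.card_coe] at this
          omega
        have hpc : p ((s : Multiset (Fin d)).count j) ≤ ∑ i ∈ Finset.range (m + 1), p i :=
          Finset.single_le_sum (f := p) (fun _ _ => Nat.zero_le _) (Finset.mem_range.2 hc)
        have hl : ((n j : ℕ) : ℝ) ≤ len n := by exact_mod_cast le_len n j
        gcongr
        calc ((n j : ℝ) + 1) ^ p ((s : Multiset (Fin d)).count j)
            ≤ ((len n : ℝ) + 1) ^ p ((s : Multiset (Fin d)).count j) := by gcongr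
          _ ≤ _ := pow_le_pow_right₀ (one_le_len_add_one n) hpc
    _ = _ := by
        rw [Finset.prod_mul_distrib, Finset.prod_const, Finset.card_univ, Fintype.card_fin,
          ← pow_mul]

lemma laguerreFun_ofReal (n : MultiIndex d) :
    (fun x => (laguerreFun n x : ℂ)) = tensor fun j => lag (n j) := rfl

lemma hermiteFun_ofReal (n : MultiIndex d) :
    (fun x => (hermiteFun n x : ℂ)) = tensor fun j => her (n j) := rfl

lemma tempFam_laguerre :
    TempFam (closedOrthant d) (fun n x => (laguerreFun n x : ℂ)) :=
  tempFam_tensor contDiff_lag polyBdd_iteratedDeriv_lag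

lemma tempFam_hermite :
    TempFam (Set.univ : Set (Fin d → ℝ)) (fun n x => (hermiteFun n x : ℂ)) := by
  have := tempFam_tensor (d := d) contDiff_her polyBdd_iteratedDeriv_her
  simp only [Set.mem_univ, implies_true, Set.ofPred_true] at this
  exact this


/-! ### Partial derivatives -/

lemma natCast_le_infty (m : ℕ) : (m : ℕ∞ω) ≤ ∞ := by exact_mod_cast (le_top : (m : ℕ∞) ≤ ⊤)

lemma hasDerivAt_comp_update {f : (Fin d → ℝ) → ℂ} {x : Fin d → ℝ} (hf : DifferentiableAt ℝ f x)
    (j : Fin d) : HasDerivAt (fun t => f (Function.update x j t)) (pderiv j f x) (x j) := by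
  have h := hf.hasFDerivAt
  have hx : Function.update x j (x j) = x := Function.update_eq_self j x
  rw [← hx] at h
  have := h.comp_hasDerivAt (x j) (hasDerivAt_update x j (x j))
  rw [hx] at this
  exact this

lemma contDiff_pderiv {f : (Fin d → ℝ) → ℂ} (hf : ContDiff ℝ ∞ f) (j : Fin d) :
    ContDiff ℝ ∞ (pderiv j f) :=
  (hf.fderiv_right (m := ∞) le_rfl).clm_apply contDiff_const

lemma pderiv_const_mul {f : (Fin d → ℝ) → ℂ} (hf : ContDiff ℝ ∞ f) (c : ℂ) (j : Fin d) :
    pderiv j (fun x => c * f x) = fun x => c * pderiv j f x := by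
  funext x
  simp only [pderiv]
  rw [fderiv_const_mul (hf.differentiable (by simp) x)]
  simp

lemma pderiv_congr {V : Set (Fin d → ℝ)} (hV : IsOpen V) {f g : (Fin d → ℝ) → ℂ}
    (h : Set.EqOn f g V) (j : Fin d) : Set.EqOn (pderiv j f) (pderiv j g) V := fun x hx => by
  simp only [pderiv]
  rw [(h.eventuallyEq_of_mem (hV.mem_nhds hx)).fderiv_eq]

lemma laguerreOp_congr {V : Set (Fin d → ℝ)} (hV : IsOpen V) {f g : (Fin d → ℝ) → ℂ}
    (h : Set.EqOn f g V) : Set.EqOn (laguerreOp f) (laguerreOp g) V := fun x hx => by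
  have h1 := fun j => pderiv_congr hV h j
  have h2 := fun j => pderiv_congr hV (h1 j) j
  simp only [laguerreOp, h hx, h1 _ hx, h2 _ hx]

lemma tensor_update_left (A : Fin d → ℝ → ℝ) (B : ℝ → ℝ) (j : Fin d) (x : Fin d → ℝ) :
    tensor (Function.update A j B) x =
      ((B (x j) * ∏ i ∈ Finset.univ.erase j, A i (x i) : ℝ) : ℂ) := by
  rw [tensor, ← Finset.mul_prod_erase _ _ (Finset.mem_univ j), Function.update_self]
  congr 2
  refine Finset.prod_congr rfl fun i hi => ?_
  rw [Function.update_of_ne (Finset.ne_of_mem_erase hi)]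

lemma tensor_update_right (A : Fin d → ℝ → ℝ) (j : Fin d) (x : Fin d → ℝ) (t : ℝ) :
    tensor A (Function.update x j t) =
      ((A j t * ∏ i ∈ Finset.univ.erase j, A i (x i) : ℝ) : ℂ) := by
  rw [tensor, ← Finset.mul_prod_erase _ _ (Finset.mem_univ j), Function.update_self]
  congr 2
  refine Finset.prod_congr rfl fun i hi => ?_
  rw [Function.update_of_ne (Finset.ne_of_mem_erase hi)]

lemma pderiv_tensor {A : Fin d → ℝ → ℝ} (hA : ∀ j, ContDiff ℝ ∞ (A j)) (j : Fin d) :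
    pderiv j (tensor A) = tensor (Function.update A j (deriv (A j))) := by
  funext x
  have h1 := hasDerivAt_comp_update ((contDiff_tensor hA).differentiable (by simp) x) j
  have h2 := (((hA j).differentiable (by simp) (x j)).hasDerivAt.mul_const
    (∏ i ∈ Finset.univ.erase j, A i (x i))).ofReal_comp
  simp_rw [tensor_update_right] at h1
  rw [tensor_update_left]
  exact h1.unique h2

lemma contDiff_deriv_infty {f : ℝ → ℝ} (hf : ContDiff ℝ ∞ f) : ContDiff ℝ ∞ (deriv f) :=
  (contDiff_infty_iff_deriv.1 hf).2

lemma pderiv_pderiv_tensor {A : Fin d → ℝ → ℝ} (hA : ∀ j, ContDiff ℝ ∞ (A j)) (j : Fin d) :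
    pderiv j (pderiv j (tensor A)) = tensor (Function.update A j (deriv (deriv (A j)))) := by
  rw [pderiv_tensor hA, pderiv_tensor, Function.update_self, Function.update_idem]
  intro i
  rcases eq_or_ne i j with rfl | h
  · rw [Function.update_self]; exact contDiff_deriv_infty (hA i)
  · rw [Function.update_of_ne h]; exact hA i

lemma tensor_eq_mul_erase (A : Fin d → ℝ → ℝ) (j : Fin d) (x : Fin d → ℝ) :
    tensor A x = ((A j (x j) * ∏ i ∈ Finset.univ.erase j, A i (x i) : ℝ) : ℂ) := by
  rw [tensor, ← Finset.mul_prod_erase _ _ (Finset.mem_univ j)]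

lemma laguerre_coord (n : MultiIndex d) (j : Fin d) (x : Fin d → ℝ) :
    (x j : ℂ) * pderiv j (pderiv j (tensor fun j => lag (n j))) x +
      pderiv j (tensor fun j => lag (n j)) x
      - (x j : ℂ) / 4 * tensor (fun j => lag (n j)) x + 1 / 2 * tensor (fun j => lag (n j)) x =
      -(n j : ℂ) * tensor (fun j => lag (n j)) x := by
  have h := lag_ode (n j) (x j)
  rw [pderiv_pderiv_tensor (fun j => contDiff_lag _), pderiv_tensor (fun j => contDiff_lag _),
    tensor_update_left, tensor_update_left, tensor_eq_mul_erase _ j]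
  have h' := congrArg (fun r : ℝ =>
    ((r * ∏ i ∈ Finset.univ.erase j, lag (n i) (x i) : ℝ) : ℂ)) h
  push_cast at h' ⊢
  linear_combination h'

lemma laguerreOp_laguerreFun (n : MultiIndex d) :
    laguerreOp (fun x => (laguerreFun n x : ℂ)) = fun x => (len n : ℂ) * laguerreFun n x := by
  funext x
  have e : ((laguerreFun n x : ℝ) : ℂ) = tensor (fun j => lag (n j)) x := rfl
  rw [laguerreFun_ofReal, e, laguerreOp, Finset.sum_congr rfl fun j _ => laguerre_coord n j x,
    ← Finset.sum_mul, Finset.sum_neg_distrib, len]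
  push_cast
  ring

lemma hermiteOp_hermiteFun (n : MultiIndex d) :
    hermiteOp (fun x => (hermiteFun n x : ℂ)) =
      fun x => (2 * (len n : ℂ) + d) * hermiteFun n x := by
  funext x
  have e : ((hermiteFun n x : ℝ) : ℂ) = tensor (fun j => her (n j)) x := rfl
  rw [hermiteFun_ofReal, e, hermiteOp]
  have : ∀ j : Fin d, (x j : ℂ) ^ 2 * tensor (fun j => her (n j)) x -
      pderiv j (pderiv j (tensor fun j => her (n j))) x =
      (2 * (n j : ℂ) + 1) * tensor (fun j => her (n j)) x := fun j => by
    rw [pderiv_pderiv_tensor (fun j => contDiff_her _), tensor_update_left,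
      tensor_eq_mul_erase _ j, (hasDerivAt_deriv_her (n j) (x j)).deriv]
    push_cast
    ring
  rw [Finset.sum_congr rfl fun j _ => this j, ← Finset.sum_mul, Finset.sum_add_distrib,
    ← Finset.mul_sum, len]
  push_cast
  simp

/-! ### Series of smooth functions -/

/-- Smooth functions whose derivatives are, after multiplication with any power of `1 + ‖x‖`,
summable uniformly on `U`. -/
def SmoothSummable {ι : Type*} (U : Set (Fin d → ℝ)) (G : ι → (Fin d → ℝ) → ℂ) : Prop :=
  (∀ n, ContDiff ℝ ∞ (G n)) ∧ ∀ k m : ℕ, ∃ u : ι → ℝ, Summable u ∧ ∀ n, ∀ x ∈ U,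
    (1 + ‖x‖) ^ k * ‖iteratedFDeriv ℝ m (G n) x‖ ≤ u n

namespace SmoothSummable

variable {ι : Type*} {U V : Set (Fin d → ℝ)} {G : ι → (Fin d → ℝ) → ℂ}

lemma bound (hG : SmoothSummable U G) (m : ℕ) : ∃ u : ι → ℝ, Summable u ∧ ∀ n, ∀ x ∈ U,
    ‖iteratedFDeriv ℝ m (G n) x‖ ≤ u n := by
  obtain ⟨u, hu, h⟩ := hG.2 0 m
  exact ⟨u, hu, by simpa using h⟩

lemma summable (hG : SmoothSummable U G) {x : Fin d → ℝ} (hx : x ∈ U) :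
    Summable fun n => G n x := by
  obtain ⟨u, hu, h⟩ := hG.bound 0
  exact .of_norm_bounded hu fun n => by simpa using h n x hx

lemma pderiv (hG : SmoothSummable U G) (j : Fin d) : SmoothSummable U fun n => pderiv j (G n) := by
  refine ⟨fun n => contDiff_pderiv (hG.1 n) j, fun k m => ?_⟩
  obtain ⟨u, hu, h⟩ := hG.2 k (m + 1)
  set L : ((Fin d → ℝ) →L[ℝ] ℂ) →L[ℝ] ℂ :=
    ContinuousLinearMap.apply ℝ ℂ (Pi.single j (1 : ℝ) : Fin d → ℝ)
  refine ⟨fun n => ‖L‖ * u n, hu.mul_left _, fun n x hx => ?_⟩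
  have h1 := L.norm_iteratedFDeriv_comp_left (f := fderiv ℝ (G n)) (x := x) (N := ∞) (n := m)
    ((hG.1 n).fderiv_right (m := ∞) le_rfl).contDiffAt (natCast_le_infty m)
  rw [norm_iteratedFDeriv_fderiv] at h1
  calc _ ≤ (1 + ‖x‖) ^ k * (‖L‖ * ‖iteratedFDeriv ℝ (m + 1) (G n) x‖) :=
        mul_le_mul_of_nonneg_left h1 (by positivity)
    _ = ‖L‖ * ((1 + ‖x‖) ^ k * ‖iteratedFDeriv ℝ (m + 1) (G n) x‖) := by ring
    _ ≤ _ := mul_le_mul_of_nonneg_left (h n x hx) L.opNorm_nonneg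

/-- Continuity holds on all of `U`, not only on its interior. With `U` the closed orthant this
provides the continuous extensions of the derivatives required in `MemSchwartzOrthant`. -/
lemma continuousOn_tsum_iteratedFDeriv (hG : SmoothSummable U G) (m : ℕ) :
    ContinuousOn (fun x => ∑' n, iteratedFDeriv ℝ m (G n) x) U := by
  obtain ⟨u, hu, h⟩ := hG.bound m
  exact continuousOn_tsum
    (fun n => ((hG.1 n).continuous_iteratedFDeriv (natCast_le_infty m)).continuousOn) hu h

lemma continuousOn_tsum (hG : SmoothSummable U G) : ContinuousOn (fun x => ∑' n, G n x) U := by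
  obtain ⟨u, hu, h⟩ := hG.bound 0
  exact _root_.continuousOn_tsum (fun n => (hG.1 n).continuous.continuousOn) hu
    (by simpa using h)

/-- Uniform summability of every derivative allows differentiation term by term on an open
preconnected `V`; treating all orders as one Taylor series identifies the iterated derivatives of
the sum. `U` carries the bounds and may be closed, while derivatives are taken on `V`. -/
lemma hasFTaylorSeriesUpToOn (hG : SmoothSummable U G) (hV : IsOpen V) (hV' : IsPreconnected V)
    (hVU : V ⊆ U) :
    HasFTaylorSeriesUpToOn ∞ (fun x => ∑' n, G n x)
      (fun x m => ∑' n, iteratedFDeriv ℝ m (G n) x) V where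
  zero_eq x hx := by
    obtain ⟨u, hu, h⟩ := hG.bound 0
    have hs : Summable fun n => iteratedFDeriv ℝ 0 (G n) x :=
      .of_norm_bounded hu fun n => h n x (hVU hx)
    have := (continuousMultilinearCurryFin0 ℝ (Fin d → ℝ) ℂ).toContinuousLinearEquiv.map_tsum
      (f := fun n => iteratedFDeriv ℝ 0 (G n) x) (L := SummationFilter.unconditional ι)
    simpa using this
  fderivWithin m _ x hx := by
    obtain ⟨u, hu, h⟩ := hG.bound (m + 1)
    obtain ⟨u', hu', h'⟩ := hG.bound m
    have h1 := hasFDerivAt_tsum_of_isPreconnected (x₀ := x) (x := x) hu hV hV'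
      (f := fun n => iteratedFDeriv ℝ m (G n))
      (f' := fun n y => (iteratedFDeriv ℝ (m + 1) (G n) y).curryLeft)
      (fun n y _ => by
        have := ((hG.1 n).differentiable_iteratedFDeriv (m := m)
          (by exact_mod_cast WithTop.coe_lt_top m) y).hasFDerivAt
        rwa [fderiv_iteratedFDeriv] at this)
      (fun n y hy => by
        rw [ContinuousMultilinearMap.curryLeft_norm]
        exact h n y (hVU hy)) hx (.of_norm_bounded hu' fun n => h' n x (hVU hx)) hx
    have h2 := (continuousMultilinearCurryLeftEquiv ℝ (fun _ : Fin (m + 1) => Fin d → ℝ)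
      ℂ).toContinuousLinearEquiv.map_tsum
      (f := fun n => iteratedFDeriv ℝ (m + 1) (G n) x) (L := SummationFilter.unconditional ι)
    have h3 : (∑' n, iteratedFDeriv ℝ (m + 1) (G n) x).curryLeft =
      ∑' n, (iteratedFDeriv ℝ (m + 1) (G n) x).curryLeft := h2
    rw [← h3] at h1
    exact h1.hasFDerivWithinAt
  cont m _ := (hG.continuousOn_tsum_iteratedFDeriv m).mono hVU

lemma contDiffOn_tsum (hG : SmoothSummable U G) (hV : IsOpen V) (hV' : IsPreconnected V)
    (hVU : V ⊆ U) : ContDiffOn ℝ ∞ (fun x => ∑' n, G n x) V :=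
  (hG.hasFTaylorSeriesUpToOn hV hV' hVU).contDiffOn (n := ⊤)

lemma iteratedFDeriv_tsum (hG : SmoothSummable U G) (hV : IsOpen V) (hV' : IsPreconnected V)
    (hVU : V ⊆ U) (m : ℕ) {x : Fin d → ℝ} (hx : x ∈ V) :
    iteratedFDeriv ℝ m (fun x => ∑' n, G n x) x = ∑' n, iteratedFDeriv ℝ m (G n) x := by
  have := (hG.hasFTaylorSeriesUpToOn hV hV' hVU).eq_iteratedFDerivWithin_of_uniqueDiffOn
    (m := m) (natCast_le_infty m) hV.uniqueDiffOn hx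
  rw [← iteratedFDerivWithin_of_isOpen m hV hx, ← this]

lemma exists_bound (hG : SmoothSummable U G) (k m : ℕ) : ∃ C : ℝ, ∀ x ∈ U,
    (1 + ‖x‖) ^ k * ‖∑' n, iteratedFDeriv ℝ m (G n) x‖ ≤ C := by
  obtain ⟨u, hu, h⟩ := hG.2 k m
  refine ⟨∑' n, u n, fun x hx => ?_⟩
  have e : (1 + ‖x‖) ^ k * ‖∑' n, iteratedFDeriv ℝ m (G n) x‖ =
      ‖∑' n, ((1 + ‖x‖) ^ k : ℝ) • iteratedFDeriv ℝ m (G n) x‖ := by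
    rw [tsum_const_smul'', norm_smul, Real.norm_of_nonneg (by positivity)]
  rw [e]
  refine tsum_of_norm_bounded hu.hasSum fun n => ?_
  rw [norm_smul, Real.norm_of_nonneg (by positivity)]
  exact h n x hx

lemma pderiv_tsum (hG : SmoothSummable U G) (hV : IsOpen V) (hV' : IsPreconnected V)
    (hVU : V ⊆ U) (j : Fin d) {x : Fin d → ℝ} (hx : x ∈ V) :
    PilipovicOrthant.pderiv j (fun x => ∑' n, G n x) x =
      ∑' n, PilipovicOrthant.pderiv j (G n) x := by
  obtain ⟨u, hu, h⟩ := hG.bound 1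
  simp only [norm_iteratedFDeriv_one] at h
  have h1 := hasFDerivAt_tsum_of_isPreconnected (x₀ := x) (x := x) hu hV hV'
    (fun n y _ => ((hG.1 n).differentiable (by simp) y).hasFDerivAt)
    (fun n y hy => h n y (hVU hy)) hx (hG.summable (hVU hx)) hx
  have hs : Summable fun n => fderiv ℝ (G n) x := .of_norm_bounded hu fun n => h n x (hVU hx)
  simp only [PilipovicOrthant.pderiv]
  rw [h1.fderiv]
  exact (ContinuousLinearMap.apply ℝ ℂ (Pi.single j (1 : ℝ) : Fin d → ℝ)).map_tsum hs

lemma pderiv_pderiv_tsum (hG : SmoothSummable U G) (hV : IsOpen V) (hV' : IsPreconnected V)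
    (hVU : V ⊆ U) (j : Fin d) {x : Fin d → ℝ} (hx : x ∈ V) :
    PilipovicOrthant.pderiv j (PilipovicOrthant.pderiv j (fun x => ∑' n, G n x)) x =
      ∑' n, PilipovicOrthant.pderiv j (PilipovicOrthant.pderiv j (G n)) x := by
  rw [pderiv_congr hV (fun y hy => hG.pderiv_tsum hV hV' hVU j hy) j hx,
    (hG.pderiv j).pderiv_tsum hV hV' hVU j hx]

lemma laguerreOp_tsum (hG : SmoothSummable U G) (hV : IsOpen V) (hV' : IsPreconnected V)
    (hVU : V ⊆ U) {x : Fin d → ℝ} (hx : x ∈ V) :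
    laguerreOp (fun x => ∑' n, G n x) x = ∑' n, laguerreOp (G n) x := by
  have h0 := (hG.summable (hVU hx)).hasSum
  have h1 := fun j => ((hG.pderiv j).summable (hVU hx)).hasSum
  have h2 := fun j => (((hG.pderiv j).pderiv j).summable (hVU hx)).hasSum
  simp only [← hG.pderiv_tsum hV hV' hVU _ hx, ← hG.pderiv_pderiv_tsum hV hV' hVU _ hx] at h1 h2
  exact (HasSum.neg (hasSum_sum fun j _ => ((((h2 j).mul_left (x j : ℂ)).add (h1 j)).sub
    (h0.mul_left ((x j : ℂ) / 4))).add (h0.mul_left (1 / 2)))).tsum_eq.symm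

lemma hermiteOp_tsum (hG : SmoothSummable U G) (hV : IsOpen V) (hV' : IsPreconnected V)
    (hVU : V ⊆ U) {x : Fin d → ℝ} (hx : x ∈ V) :
    hermiteOp (fun x => ∑' n, G n x) x = ∑' n, hermiteOp (G n) x := by
  have h0 := (hG.summable (hVU hx)).hasSum
  have h2 := fun j => (((hG.pderiv j).pderiv j).summable (hVU hx)).hasSum
  simp only [← hG.pderiv_pderiv_tsum hV hV' hVU _ hx] at h2
  exact (hasSum_sum fun j _ => ((h0.mul_left ((x j : ℂ) ^ 2)).sub (h2 j))).tsum_eq.symm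

end SmoothSummable

/-! ### Eigenfunction series with rapidly decreasing coefficients. -/

/-- Sequences that decrease faster than any power of the length of the index. -/
def Rapid (b : MultiIndex d → ℂ) : Prop :=
  ∀ p : ℕ, Summable fun n => ‖b n‖ * ((len n : ℝ) + 1) ^ p

lemma Rapid.mul_of_le {b : MultiIndex d → ℂ} (hb : Rapid b) {c : MultiIndex d → ℂ} {K : ℝ} {q : ℕ}
    (hc : ∀ n, ‖c n‖ ≤ K * ((len n : ℝ) + 1) ^ q) : Rapid fun n => c n * b n := fun p => by
  refine Summable.of_nonneg_of_le (fun n => by positivity) (fun n => ?_) ((hb (q + p)).mul_left K)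
  rw [norm_mul, pow_add]
  calc _ ≤ (K * ((len n : ℝ) + 1) ^ q) * ‖b n‖ * ((len n : ℝ) + 1) ^ p := by
        gcongr; exact hc n
    _ = _ := by ring

lemma TempFam.smoothSummable {U : Set (Fin d → ℝ)} {F : MultiIndex d → (Fin d → ℝ) → ℂ}
    (hF : TempFam U F) {b : MultiIndex d → ℂ} (hb : Rapid b) :
    SmoothSummable U fun n x => b n * F n x := by
  refine ⟨fun n => contDiff_const.mul (hF.1 n), fun k m => ?_⟩
  obtain ⟨C, hC, p, h⟩ := hF.2 k m
  refine ⟨fun n => C * (‖b n‖ * ((len n : ℝ) + 1) ^ p), (hb p).mul_left C, fun n x hx => ?_⟩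
  have e : iteratedFDeriv ℝ m (fun x => b n * F n x) x = b n • iteratedFDeriv ℝ m (F n) x :=
    iteratedFDeriv_const_smul_apply (f := F n) (a := b n) (((hF.1 n).of_le (natCast_le_infty m)).contDiffAt)
  rw [e, norm_smul]
  calc _ = ‖b n‖ * ((1 + ‖x‖) ^ k * ‖iteratedFDeriv ℝ m (F n) x‖) := by ring
    _ ≤ ‖b n‖ * (C * ((len n : ℝ) + 1) ^ p) := mul_le_mul_of_nonneg_left (h n x hx) (norm_nonneg _)
    _ = _ := by ring

lemma laguerreOp_const_mul {f : (Fin d → ℝ) → ℂ} (hf : ContDiff ℝ ∞ f) (c : ℂ) (x : Fin d → ℝ) :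
    laguerreOp (fun x => c * f x) x = c * laguerreOp f x := by
  simp only [laguerreOp, pderiv_const_mul hf, pderiv_const_mul (contDiff_pderiv hf _)]
  rw [mul_neg, Finset.mul_sum]
  congr 1
  exact Finset.sum_congr rfl fun j _ => by ring

lemma hermiteOp_const_mul {f : (Fin d → ℝ) → ℂ} (hf : ContDiff ℝ ∞ f) (c : ℂ) (x : Fin d → ℝ) :
    hermiteOp (fun x => c * f x) x = c * hermiteOp f x := by
  simp only [hermiteOp, pderiv_const_mul hf, pderiv_const_mul (contDiff_pderiv hf _)]
  rw [Finset.mul_sum]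
  exact Finset.sum_congr rfl fun j _ => by ring

lemma isOpen_orthant : IsOpen (orthant d) := by
  have : orthant d = ⋂ j, {x : Fin d → ℝ | 0 < x j} := by ext; simp [orthant]
  rw [this]
  exact isOpen_iInter_of_finite fun j => isOpen_lt continuous_const (continuous_apply j)

lemma isPreconnected_orthant : IsPreconnected (orthant d) := by
  have h : Convex ℝ (orthant d) := by
    have : orthant d = Set.pi Set.univ fun _ => Set.Ioi 0 := by ext; simp [orthant]
    rw [this]
    exact convex_pi fun _ _ => convex_Ioi 0
  exact h.isPreconnected

lemma orthant_subset_closedOrthant : orthant d ⊆ closedOrthant d := fun _ hx j => (hx j).le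

lemma norm_len_pow_le (n : MultiIndex d) (N : ℕ) :
    ‖((len n : ℂ)) ^ N‖ ≤ 1 * ((len n : ℝ) + 1) ^ N := by
  rw [norm_pow, Complex.norm_natCast, one_mul]
  gcongr
  linarith

lemma norm_eigen_pow_le (n : MultiIndex d) (N : ℕ) :
    ‖(2 * (len n : ℂ) + d) ^ N‖ ≤ (d + 2) ^ N * ((len n : ℝ) + 1) ^ N := by
  have h : (2 * (len n : ℂ) + d) = ((2 * len n + d : ℕ) : ℂ) := by push_cast; ring
  have h0 : (0 : ℝ) ≤ len n := Nat.cast_nonneg _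
  have h1 : (0 : ℝ) ≤ d := Nat.cast_nonneg _
  rw [norm_pow, h, Complex.norm_natCast, ← mul_pow]
  gcongr
  push_cast
  nlinarith

/-- Equality is confined to the open orthant: the bounds on the terms hold only on the closed
orthant, and derivatives depend on a neighbourhood of the point. -/
lemma laguerreOp_iterate_tsum {b : MultiIndex d → ℂ} (hb : Rapid b) (N : ℕ) :
    Set.EqOn (laguerreOp^[N] fun x => ∑' n, b n * (laguerreFun n x : ℂ))
      (fun x => ∑' n, ((len n : ℂ) ^ N * b n) * (laguerreFun n x : ℂ)) (orthant d) := by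
  induction N with
  | zero => intro x _; simp
  | succ N ih =>
    rw [Function.iterate_succ_apply']
    intro x hx
    have hs := tempFam_laguerre.smoothSummable
      (hb.mul_of_le fun n => norm_len_pow_le n N)
    rw [laguerreOp_congr isOpen_orthant ih hx, hs.laguerreOp_tsum isOpen_orthant
      isPreconnected_orthant orthant_subset_closedOrthant hx]
    refine tsum_congr fun n => ?_
    rw [laguerreOp_const_mul (tempFam_laguerre.1 n), laguerreOp_laguerreFun]
    ring

lemma hermiteOp_iterate_tsum {b : MultiIndex d → ℂ} (hb : Rapid b) (N : ℕ) :
    (hermiteOp^[N] fun x => ∑' n, b n * (hermiteFun n x : ℂ)) =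
      fun x => ∑' n, ((2 * (len n : ℂ) + d) ^ N * b n) * (hermiteFun n x : ℂ) := by
  induction N with
  | zero => funext x; simp
  | succ N ih =>
    rw [Function.iterate_succ_apply', ih]
    funext x
    have hs := tempFam_hermite.smoothSummable
      (hb.mul_of_le fun n => norm_eigen_pow_le n N)
    rw [hs.hermiteOp_tsum isOpen_univ isPreconnected_univ le_rfl (Set.mem_univ x)]
    refine tsum_congr fun n => ?_
    rw [hermiteOp_const_mul (tempFam_hermite.1 n), hermiteOp_hermiteFun]
    ring

/-- Sums of rapidly convergent Laguerre series belong to `𝒮(ℝ^d_+)`. -/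
lemma memSchwartzOrthant_of_eqOn {b : MultiIndex d → ℂ} (hb : Rapid b) {f : (Fin d → ℝ) → ℂ}
    (hf : Set.EqOn f (fun x => ∑' n, b n * (laguerreFun n x : ℂ)) (closedOrthant d)) :
    MemSchwartzOrthant f := by
  have hs := tempFam_laguerre.smoothSummable hb
  have hfo := hf.mono orthant_subset_closedOrthant
  have hD : ∀ m, Set.EqOn (iteratedFDeriv ℝ m f)
      (fun x => ∑' n, iteratedFDeriv ℝ m (fun x => b n * (laguerreFun n x : ℂ)) x) (orthant d) :=
    fun m x hx => by
      rw [((hfo.eventuallyEq_of_mem (isOpen_orthant.mem_nhds hx)).iteratedFDeriv ℝ m).eq_of_nhds]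
      exact hs.iteratedFDeriv_tsum isOpen_orthant isPreconnected_orthant
        orthant_subset_closedOrthant m hx
  refine ⟨?_, ?_, fun m => ⟨_, hs.continuousOn_tsum_iteratedFDeriv m, (hD m).symm⟩, fun k m => ?_⟩
  · exact (hs.contDiffOn_tsum isOpen_orthant isPreconnected_orthant
      orthant_subset_closedOrthant).congr hfo
  · exact hs.continuousOn_tsum.congr hf
  · obtain ⟨C, hC⟩ := hs.exists_bound k m
    refine ⟨C, fun x hx => ?_⟩
    rw [hD m hx]
    refine le_trans ?_ (hC x (orthant_subset_closedOrthant hx))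
    gcongr
    linarith


/-! ### The sequence spaces `ℓ_β` -/

/-- Every finite set of multi-indices lies in a cube, over which the sum of products factors into a
product of sums. -/
lemma summable_prod_multiIndex {g : ℕ → ℝ} (hg0 : ∀ n, 0 ≤ g n) (hg : Summable g) :
    Summable fun n : MultiIndex d => ∏ j, g (n j) := by
  refine summable_of_sum_le (c := (∑' n, g n) ^ d)
    (fun n => Finset.prod_nonneg fun j _ => hg0 _) fun s => ?_
  set K := s.sup (fun n => len n) + 1
  have hs : s ⊆ Fintype.piFinset fun _ : Fin d => Finset.range K := fun n hn => by
    rw [Fintype.mem_piFinset]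
    intro j
    rw [Finset.mem_range]
    exact Nat.lt_succ_of_le ((le_len n j).trans (Finset.le_sup (f := fun n => len n) hn))
  calc ∑ n ∈ s, ∏ j, g (n j)
      ≤ ∑ n ∈ Fintype.piFinset fun _ : Fin d => Finset.range K, ∏ j, g (n j) :=
        Finset.sum_le_sum_of_subset_of_nonneg hs fun n _ _ => Finset.prod_nonneg fun j _ => hg0 _
    _ = ∏ _j : Fin d, ∑ i ∈ Finset.range K, g i :=
        (Finset.prod_univ_sum (fun _ : Fin d => Finset.range K) (fun _ i => g i)).symm
    _ ≤ ∏ _j : Fin d, ∑' i, g i := by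
        refine Finset.prod_le_prod (fun j _ => Finset.sum_nonneg fun i _ => hg0 _) fun j _ => ?_
        exact hg.sum_le_tsum _ fun i _ => hg0 i
    _ = _ := by simp

lemma summable_len_rpow :
    Summable fun n : MultiIndex d => ((((len n : ℝ) + 1) ^ 2) ^ d)⁻¹ := by
  have h1 : Summable fun n : ℕ => (((n : ℝ) + 1) ^ 2)⁻¹ := by
    have := (summable_nat_add_iff 1).2 (Real.summable_nat_pow_inv.2 (one_lt_two))
    simpa using this
  refine Summable.of_nonneg_of_le (fun n => by positivity) (fun n => ?_)
    (summable_prod_multiIndex (d := d) (fun n => by positivity) h1)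
  rw [Finset.prod_inv_distrib]
  refine inv_anti₀ (Finset.prod_pos fun j _ => by positivity) ?_
  calc ∏ j, ((n j : ℝ) + 1) ^ 2 ≤ ∏ _j : Fin d, ((len n : ℝ) + 1) ^ 2 := by
        refine Finset.prod_le_prod (fun j _ => by positivity) fun j _ => ?_
        have hl : ((n j : ℕ) : ℝ) ≤ len n := by exact_mod_cast le_len n j
        gcongr
    _ = _ := by simp

lemma pow_rpow_le_factorial_rpow {α t : ℝ} (hα : 0 < α) (ht : 0 ≤ t) (N : ℕ) :
    (t ^ N) ^ α ≤ (N ! : ℝ) ^ α * Real.exp (α * t) := by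
  have h := Real.pow_div_factorial_le_exp t ht N
  rw [div_le_iff₀ (by positivity)] at h
  calc (t ^ N) ^ α ≤ (Real.exp t * (N ! : ℝ)) ^ α :=
        Real.rpow_le_rpow (by positivity) h hα.le
    _ = _ := by
        rw [Real.mul_rpow (Real.exp_pos t).le (by positivity), ← Real.exp_mul]
        ring_nf

/-- Exponentially weighted powers are controlled by factorials. -/
lemma pow_le_factorial_mul_exp {α h : ℝ} (hα : 0 < α) (hh : 0 < h) :
    ∃ H : ℝ, 0 < H ∧ ∀ (N : ℕ) (s : ℝ), 0 ≤ s →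
      s ^ N ≤ H ^ N * (N ! : ℝ) ^ α * Real.exp (h * s ^ (1 / α)) := by
  -- Raise `t^N ≤ N! e^t` to the power `α` with `t = (h/α) s^{1/α}`: the exponential becomes `exp(h
  -- s^{1/α})` and the left side `(h/α)^{αN} s^N`.
  refine ⟨((h / α) ^ α)⁻¹, by positivity, fun N s hs => ?_⟩
  have h1 := pow_rpow_le_factorial_rpow hα (t := h / α * s ^ (1 / α)) (by positivity) N
  have h2 : ((h / α * s ^ (1 / α)) ^ N) ^ α = ((h / α) ^ α) ^ N * s ^ N := by
    rw [mul_pow, Real.mul_rpow (by positivity) (by positivity), ← Real.rpow_natCast_mul (by positivity),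
      ← Real.rpow_natCast_mul (by positivity), mul_comm (N : ℝ) α, Real.rpow_mul_natCast (by positivity),
      Real.rpow_mul_natCast (by positivity), ← Real.rpow_mul hs, one_div_mul_cancel hα.ne',
      Real.rpow_one]
  have h3 : α * (h / α * s ^ (1 / α)) = h * s ^ (1 / α) := by field_simp
  rw [h2, h3] at h1
  rw [inv_pow, mul_assoc, inv_mul_eq_div, le_div_iff₀ (by positivity)]
  linarith

/-- `a ∈ ℓ_{α/2}`, expressed with the weight `|n| + 1`. -/
def ExpDecay (α : ℝ) (a : MultiIndex d → ℂ) : Prop :=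
  ∃ h : ℝ, 0 < h ∧ ∃ C : ℝ, 0 ≤ C ∧ ∀ n,
    ‖a n‖ ≤ C * Real.exp (-(h * ((len n : ℝ) + 1) ^ (1 / α)))

lemma ExpDecay.memEll {α : ℝ} (hα : 0 < α) {a : MultiIndex d → ℂ} (ha : ExpDecay α a) :
    MemEll (α / 2) a := by
  obtain ⟨h, hh, C, hC, hle⟩ := ha
  refine ⟨h, hh, C, fun n => ?_⟩
  have e : 2 * (α / 2) = α := by ring
  rw [e]
  calc _ ≤ C * Real.exp (-(h * ((len n : ℝ) + 1) ^ (1 / α))) *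
        Real.exp (h * ((len n : ℝ) + 1) ^ (1 / α)) := by
        gcongr
        · exact hle n
        · linarith
    _ = C := by rw [mul_assoc, ← Real.exp_add]; simp

/-- The bounds obtained from the iterates of the operators force exponential decay. -/
lemma expDecay_of_pow_bound {α : ℝ} (hα : 0 < α) {a : MultiIndex d → ℂ} {C h : ℝ} {q : ℕ}
    (hC : 0 ≤ C) (hh : 0 < h)
    (ha : ∀ N n, (len n : ℝ) ^ N * ‖a n‖ ≤
      C * ((len n : ℝ) + 1) ^ q * h ^ N * (N ! : ℝ) ^ α) : ExpDecay α a := by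
  -- Chosen so that `s h^{1/α} = 1/2`. After taking `1/α`-th powers of the hypothesis, the terms of
  -- the exponential series at `s |n|^{1/α}` are dominated by a geometric series.
  set s : ℝ := (2 * h ^ (1 / α))⁻¹ with hs
  have hs0 : 0 < s := by positivity
  -- decay in terms of `len n`
  have key : ∀ n, ‖a n‖ * Real.exp (α * s * (len n : ℝ) ^ (1 / α)) ≤
      2 ^ α * (C * ((len n : ℝ) + 1) ^ q) := fun n => by
    set L : ℝ := (len n : ℝ)
    set D := C * (L + 1) ^ q with hD
    have hL : 0 ≤ L := Nat.cast_nonneg _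
    have hD0 : 0 ≤ D := by positivity
    set x := s * L ^ (1 / α) with hx
    have hx0 : 0 ≤ x := by positivity
    have hterm : ∀ N : ℕ, ‖a n‖ ^ (1 / α) * (x ^ N / N !) ≤ D ^ (1 / α) * (1 / 2) ^ N := fun N => by
      have h1 := Real.rpow_le_rpow (by positivity) (ha N n) (one_div_nonneg.2 hα.le)
      rw [Real.mul_rpow (by positivity) (by positivity), Real.mul_rpow (by positivity)
        (by positivity), Real.mul_rpow (by positivity) (by positivity),
        ← Real.rpow_mul (by positivity), mul_one_div_cancel hα.ne', Real.rpow_one,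
        ← Real.rpow_natCast_mul (by positivity), ← Real.rpow_natCast_mul (by positivity),
        mul_comm (N : ℝ), Real.rpow_mul_natCast (by positivity),
        Real.rpow_mul_natCast (by positivity)] at h1
      have h2 : s ^ N * (h ^ (1 / α)) ^ N = (1 / 2) ^ N := by
        rw [← mul_pow, hs]
        congr 1
        field_simp
      rw [← mul_div_assoc, div_le_iff₀ (by positivity), hx, mul_pow, ← h2]
      have := mul_le_mul_of_nonneg_left h1 (pow_nonneg hs0.le N)
      nlinarith
    have hsum : ‖a n‖ ^ (1 / α) * Real.exp x ≤ D ^ (1 / α) * 2 := by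
      have e1 : HasSum (fun N : ℕ => ‖a n‖ ^ (1 / α) * (x ^ N / N !))
          (‖a n‖ ^ (1 / α) * Real.exp x) := by
        have := NormedSpace.expSeries_div_hasSum_exp (𝔸 := ℝ) x
        rw [← Real.exp_eq_exp_ℝ] at this
        exact this.mul_left _
      exact hasSum_le hterm e1 (hasSum_geometric_two.mul_left _)
    have h3 := Real.rpow_le_rpow (by positivity) hsum hα.le
    rw [Real.mul_rpow (by positivity) (by positivity), Real.mul_rpow (by positivity)
      (by positivity), ← Real.rpow_mul (by positivity), ← Real.rpow_mul (by positivity),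
      one_div_mul_cancel hα.ne', Real.rpow_one, Real.rpow_one, ← Real.exp_mul] at h3
    calc _ = ‖a n‖ * Real.exp (x * α) := by rw [hx]; ring_nf
      _ ≤ _ := by linarith
  -- absorb the polynomial factor and the shift of the weight
  set k : ℝ := α * s / 2 ^ (1 / α) with hk
  have hk0 : 0 < k := by positivity
  -- Half of the rate `k` pays for the factor `(|n| + 1)^q`; the other half is the rate that
  -- remains.
  obtain ⟨H, hH, hpow⟩ := pow_le_factorial_mul_exp hα (half_pos hk0)
  refine ⟨k / 2, half_pos hk0, 2 ^ α * C * (H ^ q * (q ! : ℝ) ^ α) * Real.exp k,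
    by positivity, fun n => ?_⟩
  set L : ℝ := (len n : ℝ)
  have hL : 0 ≤ L := Nat.cast_nonneg _
  -- For `L ≥ 1` one has `L + 1 ≤ 2L`, which explains the factor `2^{1/α}` in `k`. The additive `k`
  -- covers the index `0`.
  have h1 : k * (L + 1) ^ (1 / α) ≤ α * s * L ^ (1 / α) + k := by
    rcases Nat.eq_zero_or_pos (len n) with h0 | h0
    · have : L = 0 := by simp [L, h0]
      rw [this, zero_add, Real.one_rpow, mul_one]
      have : 0 ≤ α * s * (0 : ℝ) ^ (1 / α) := by positivity
      linarith
    · have hL1 : (1 : ℝ) ≤ L := Nat.one_le_cast.2 h0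
      have : (L + 1) ^ (1 / α) ≤ 2 ^ (1 / α) * L ^ (1 / α) := by
        rw [← Real.mul_rpow (by norm_num) hL]
        exact Real.rpow_le_rpow (by positivity) (by linarith) (by positivity)
      calc k * (L + 1) ^ (1 / α) ≤ k * (2 ^ (1 / α) * L ^ (1 / α)) := by gcongr
        _ = α * s * L ^ (1 / α) := by rw [hk]; field_simp
        _ ≤ _ := by linarith
  have h2 := key n
  have h3 := hpow q (L + 1) (by positivity)
  set E := (L + 1) ^ (1 / α)
  calc ‖a n‖ = ‖a n‖ * Real.exp (α * s * L ^ (1 / α)) * Real.exp (-(α * s * L ^ (1 / α))) := by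
        rw [mul_assoc, ← Real.exp_add]; simp
    _ ≤ (2 ^ α * (C * (H ^ q * (q ! : ℝ) ^ α * Real.exp (k / 2 * E)))) *
        Real.exp (k - k * E) := by
        refine mul_le_mul (h2.trans (by gcongr)) (Real.exp_le_exp.2 (by linarith))
          (by positivity) (by positivity)
    _ = 2 ^ α * C * (H ^ q * (q ! : ℝ) ^ α) * Real.exp k *
        (Real.exp (k / 2 * E) * Real.exp (-(k * E))) := by
        rw [sub_eq_add_neg, Real.exp_add]; ring
    _ = _ := by
        rw [← Real.exp_add]
        congr 2
        ring

lemma summable_exp_decay {α h : ℝ} (hα : 0 < α) (hh : 0 < h) (p : ℕ) :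
    Summable fun n : MultiIndex d =>
      Real.exp (-(h * ((len n : ℝ) + 1) ^ (1 / α))) * ((len n : ℝ) + 1) ^ p := by
  obtain ⟨H, hH, hpow⟩ := pow_le_factorial_mul_exp hα hh
  refine Summable.of_nonneg_of_le (fun n => by positivity) (fun n => ?_)
    (summable_len_rpow.mul_left (H ^ (2 * d + p) * ((2 * d + p)! : ℝ) ^ α))
  -- Of the exponent, `p` matches the weight and `2d` produces the summable factor of
  -- `summable_len_rpow`.
  have h1 := hpow (2 * d + p) ((len n : ℝ) + 1) (by positivity)
  rw [← pow_mul, ← div_eq_mul_inv, le_div_iff₀ (by positivity), mul_assoc, ← pow_add, add_comm p]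
  calc _ ≤ Real.exp (-(h * ((len n : ℝ) + 1) ^ (1 / α))) *
        (H ^ (2 * d + p) * ((2 * d + p)! : ℝ) ^ α * Real.exp (h * ((len n : ℝ) + 1) ^ (1 / α))) := by
        gcongr
    _ = H ^ (2 * d + p) * ((2 * d + p)! : ℝ) ^ α *
        (Real.exp (-(h * ((len n : ℝ) + 1) ^ (1 / α))) *
          Real.exp (h * ((len n : ℝ) + 1) ^ (1 / α))) := by ring
    _ = _ := by rw [← Real.exp_add]; simp

lemma ExpDecay.rapid {α : ℝ} (hα : 0 < α) {a : MultiIndex d → ℂ} (ha : ExpDecay α a) : Rapid a := by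
  obtain ⟨h, hh, C, hC, hle⟩ := ha
  intro p
  refine Summable.of_nonneg_of_le (fun n => by positivity) (fun n => ?_)
    ((summable_exp_decay hα hh p).mul_left C)
  rw [← mul_assoc]
  gcongr
  exact hle n

/-- A quantitative bound for series with coefficients of exponential decay, multiplied with powers
of a linear weight. -/
lemma ExpDecay.tsum_bound {α : ℝ} (hα : 0 < α) {a : MultiIndex d → ℂ} (ha : ExpDecay α a) (p : ℕ)
    {c : ℕ → MultiIndex d → ℂ} {K : ℝ} (hK : 0 < K)
    (hc : ∀ N n, ‖c N n‖ ≤ K ^ N * ((len n : ℝ) + 1) ^ N) :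
    ∃ h : ℝ, 0 < h ∧ ∃ C : ℝ, 0 < C ∧ ∀ N : ℕ,
      Summable (fun n => ‖c N n * a n‖ * ((len n : ℝ) + 1) ^ p) ∧
      ∑' n, ‖c N n * a n‖ * ((len n : ℝ) + 1) ^ p ≤ C * h ^ N * (N ! : ℝ) ^ α := by
  obtain ⟨h, hh, C, hC, hle⟩ := ha
  -- Half of the decay converts the `N`-th power of the weight into `H^N N!^α`; the other half keeps
  -- the series summable.
  obtain ⟨H, hH, hpow⟩ := pow_le_factorial_mul_exp hα (half_pos hh)
  have hs := summable_exp_decay (d := d) hα (half_pos hh) p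
  set S := ∑' n : MultiIndex d,
    Real.exp (-(h / 2 * ((len n : ℝ) + 1) ^ (1 / α))) * ((len n : ℝ) + 1) ^ p
  have hS : 0 ≤ S := tsum_nonneg fun n => by positivity
  have hb : ∀ N n, ‖c N n * a n‖ * ((len n : ℝ) + 1) ^ p ≤ (C * (K * H) ^ N * (N ! : ℝ) ^ α) *
      (Real.exp (-(h / 2 * ((len n : ℝ) + 1) ^ (1 / α))) * ((len n : ℝ) + 1) ^ p) := fun N n => by
    have h1 := hpow N ((len n : ℝ) + 1) (by positivity)
    set E := ((len n : ℝ) + 1) ^ (1 / α)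
    rw [norm_mul, ← mul_assoc (C * (K * H) ^ N * (N ! : ℝ) ^ α)]
    refine mul_le_mul_of_nonneg_right ?_ (by positivity)
    calc ‖c N n‖ * ‖a n‖ ≤ (K ^ N * (H ^ N * (N ! : ℝ) ^ α * Real.exp (h / 2 * E))) *
          (C * Real.exp (-(h * E))) := by
          gcongr
          · exact (hc N n).trans (by gcongr)
          · exact hle n
      _ = C * (K * H) ^ N * (N ! : ℝ) ^ α * (Real.exp (h / 2 * E) * Real.exp (-(h * E))) := by
          rw [mul_pow]; ring
      _ = _ := by
          rw [← Real.exp_add]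
          congr 2
          ring
  refine ⟨K * H, by positivity, C * S + 1, by positivity, fun N => ⟨?_, ?_⟩⟩
  · exact Summable.of_nonneg_of_le (fun n => by positivity) (hb N) (hs.mul_left _)
  · refine (Summable.tsum_le_tsum (hb N) (Summable.of_nonneg_of_le (fun n => by positivity) (hb N)
      (hs.mul_left _)) (hs.mul_left _)).trans ?_
    rw [tsum_mul_left]
    have : 0 ≤ (K * H) ^ N * (N ! : ℝ) ^ α := by positivity
    nlinarith

lemma len_add (k n : MultiIndex d) : len (k + n) = len k + len n := by
  simp [len, Finset.sum_add_distrib]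

/-- Exponential decay is stable under convolution-like transforms with coefficients of polynomial
growth. -/
lemma ExpDecay.conv {α : ℝ} (hα : 0 < α) {a : MultiIndex d → ℂ} (ha : ExpDecay α a)
    {c : MultiIndex d → MultiIndex d → ℂ} {K : ℝ} {p : ℕ}
    (hc : ∀ n k, ‖c n k‖ ≤ K * ((len (k + n) : ℝ) + 1) ^ p) :
    (∀ n, Summable fun k => c n k * a (k + n)) ∧
      ExpDecay α fun n => ∑' k, c n k * a (k + n) := by
  obtain ⟨h, hh, C, hC, hle⟩ := ha
  have hK : 0 ≤ K := by
    have := (norm_nonneg _).trans (hc 0 0)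
    simpa [len] using this
  -- The decay at `k + n` is divided: `h/2` for the polynomial factor, `h/4` for the decay in `n`,
  -- and `h/4` for summability in `k`. This works because `|k + n|` is at least `|k|` and at least
  -- `|n|`.
  have h4 : 0 < h / 4 := by positivity
  obtain ⟨H, hH, hpow⟩ := pow_le_factorial_mul_exp hα (half_pos hh)
  have hs := summable_exp_decay (d := d) hα h4 0
  simp only [pow_zero, mul_one] at hs
  have hb : ∀ n k, ‖c n k * a (k + n)‖ ≤
      (K * (H ^ p * (p ! : ℝ) ^ α) * C * Real.exp (-(h / 4 * ((len n : ℝ) + 1) ^ (1 / α)))) *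
        Real.exp (-(h / 4 * ((len k : ℝ) + 1) ^ (1 / α))) := fun n k => by
    have h1 := hpow p ((len (k + n) : ℝ) + 1) (by positivity)
    have hE1 : ((len k : ℝ) + 1) ^ (1 / α) ≤ ((len (k + n) : ℝ) + 1) ^ (1 / α) := by
      apply Real.rpow_le_rpow (by positivity) _ (by positivity)
      rw [len_add]; push_cast; linarith [(Nat.cast_nonneg (len n) : (0 : ℝ) ≤ len n)]
    have hE2 : ((len n : ℝ) + 1) ^ (1 / α) ≤ ((len (k + n) : ℝ) + 1) ^ (1 / α) := by
      apply Real.rpow_le_rpow (by positivity) _ (by positivity)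
      rw [len_add]; push_cast; linarith [(Nat.cast_nonneg (len k) : (0 : ℝ) ≤ len k)]
    set E := ((len (k + n) : ℝ) + 1) ^ (1 / α)
    rw [norm_mul]
    calc ‖c n k‖ * ‖a (k + n)‖ ≤ (K * (H ^ p * (p ! : ℝ) ^ α * Real.exp (h / 2 * E))) *
          (C * Real.exp (-(h * E))) := by
          gcongr
          · exact (hc n k).trans (by gcongr)
          · exact hle _
      _ = K * (H ^ p * (p ! : ℝ) ^ α) * C * (Real.exp (h / 2 * E) * Real.exp (-(h * E))) := by ring
      _ ≤ K * (H ^ p * (p ! : ℝ) ^ α) * C *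
          (Real.exp (-(h / 4 * ((len n : ℝ) + 1) ^ (1 / α))) *
          Real.exp (-(h / 4 * ((len k : ℝ) + 1) ^ (1 / α)))) := by
          rw [← Real.exp_add, ← Real.exp_add]
          refine mul_le_mul_of_nonneg_left (Real.exp_le_exp.2 ?_) (by positivity)
          nlinarith
      _ = _ := by ring
  refine ⟨fun n => .of_norm_bounded (hs.mul_left _) (hb n), h / 4, h4,
    K * (H ^ p * (p ! : ℝ) ^ α) * C *
      ∑' k : MultiIndex d, Real.exp (-(h / 4 * ((len k : ℝ) + 1) ^ (1 / α))), ?_, fun n => ?_⟩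
  · have : 0 ≤ ∑' k : MultiIndex d, Real.exp (-(h / 4 * ((len k : ℝ) + 1) ^ (1 / α))) :=
      tsum_nonneg fun k => (Real.exp_pos _).le
    positivity
  · refine (tsum_of_norm_bounded (hs.mul_left _).hasSum (hb n)).trans (le_of_eq ?_)
    rw [tsum_mul_left]
    ring

/-! ### The function spaces -/

/-- Sums of Hermite series with exponentially decaying coefficients belong to `𝓗_{α/2}`. -/
lemma memH_of_expDecay {α : ℝ} (hα : 0 < α) {b : MultiIndex d → ℂ} (hb : ExpDecay α b)
    {f : (Fin d → ℝ) → ℂ} (hf : ∀ x, f x = ∑' n, b n * (hermiteFun n x : ℂ)) :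
    MemH (α / 2) f := by
  obtain rfl : f = fun x => ∑' n, b n * (hermiteFun n x : ℂ) := funext hf
  have hr := hb.rapid hα
  refine ⟨?_, ?_⟩
  · rw [← contDiffOn_univ]
    exact (tempFam_hermite.smoothSummable hr).contDiffOn_tsum isOpen_univ isPreconnected_univ le_rfl
  · obtain ⟨C, hC, p, hbd⟩ := tempFam_hermite (d := d) |>.2 0 0
    simp only [pow_zero, one_mul, norm_iteratedFDeriv_zero] at hbd
    obtain ⟨h, hh, D, hD, hN⟩ := hb.tsum_bound hα p (K := (d : ℝ) + 2) (by positivity)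
      (fun N n => norm_eigen_pow_le n N)
    refine ⟨h, hh, (C + 1) * D, by positivity, fun N x => ?_⟩
    have e : 2 * (α / 2) = α := by ring
    rw [hermiteOp_iterate_tsum hr, e]
    refine (tsum_of_norm_bounded ((hN N).1.mul_left C).hasSum fun n => ?_).trans ?_
    · rw [norm_mul, mul_left_comm]
      exact mul_le_mul_of_nonneg_left (hbd n x trivial) (norm_nonneg _)
    · rw [tsum_mul_left]
      have h1 := (hN N).2
      have h2 : 0 ≤ D * h ^ N * (N ! : ℝ) ^ α := by positivity
      nlinarith

lemma memLp_two_weight :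
    MemLp (fun x : Fin d → ℝ => (((1 + ‖x‖) ^ (d + 1))⁻¹ : ℝ)) 2 volume := by
  have hm : AEStronglyMeasurable (fun x : Fin d → ℝ => (((1 + ‖x‖) ^ (d + 1))⁻¹ : ℝ)) volume := by
    apply Continuous.aestronglyMeasurable
    exact Continuous.inv₀ (by fun_prop) fun x => by positivity
  rw [memLp_two_iff_integrable_sq hm]
  have h := integrable_one_add_norm (E := Fin d → ℝ) (μ := volume) (r := (d : ℝ) + 1) (by simp)
  refine h.mono' (hm.pow 2) (.of_forall fun x => ?_)
  have h1 : (1 : ℝ) ≤ 1 + ‖x‖ := by linarith [norm_nonneg x]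
  rw [Real.rpow_neg (by positivity), show (d : ℝ) + 1 = ((d + 1 : ℕ) : ℝ) by push_cast; rfl,
    Real.rpow_natCast, Real.norm_of_nonneg (by positivity), ← inv_pow, ← pow_mul]
  exact pow_le_pow_of_le_one (by positivity) (inv_le_one_of_one_le₀ h1) (by omega)

/-- Sums of Laguerre series with exponentially decaying coefficients belong to `𝐆^α_α`. -/
lemma memG_of_expDecay {α : ℝ} (hα : 0 < α) {b : MultiIndex d → ℂ} (hb : ExpDecay α b)
    {f : (Fin d → ℝ) → ℂ}
    (hf : Set.EqOn f (fun x => ∑' n, b n * (laguerreFun n x : ℂ)) (closedOrthant d)) :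
    MemG α f := by
  have hr := hb.rapid hα
  refine ⟨memSchwartzOrthant_of_eqOn hr hf, ?_⟩
  have hiter : ∀ N, Set.EqOn (laguerreOp^[N] f)
      (fun x => ∑' n, ((len n : ℂ) ^ N * b n) * (laguerreFun n x : ℂ)) (orthant d) := fun N => by
    refine Set.EqOn.trans ?_ (laguerreOp_iterate_tsum hr N)
    induction N with
    | zero => exact hf.mono orthant_subset_closedOrthant
    | succ N ih =>
      rw [Function.iterate_succ_apply', Function.iterate_succ_apply']
      exact laguerreOp_congr isOpen_orthant ih
  -- The weight exponent `d + 1` makes the pointwise majorant square integrable, which converts a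
  -- uniform estimate into the `L²` estimate.
  obtain ⟨C, hC, p, hbd⟩ := tempFam_laguerre (d := d) |>.2 (d + 1) 0
  simp only [norm_iteratedFDeriv_zero] at hbd
  obtain ⟨h, hh, D, hD, hN⟩ := hb.tsum_bound hα p (K := 1) one_pos
    (c := fun N n => (len n : ℂ) ^ N) (fun N n => by simpa using norm_len_pow_le n N)
  have hw := memLp_two_weight (d := d)
  set w : (Fin d → ℝ) → ℝ := fun x => ((1 + ‖x‖) ^ (d + 1))⁻¹
  set W := (eLpNorm w 2 (volume.restrict (orthant d))).toReal
  have hW : eLpNorm w 2 (volume.restrict (orthant d)) = ENNReal.ofReal W :=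
    (ENNReal.ofReal_toReal (hw.restrict _).eLpNorm_lt_top.ne).symm
  refine ⟨h, hh, C * D * W, fun N => ?_⟩
  have hle : ∀ᵐ x ∂(volume.restrict (orthant d)),
      ‖(laguerreOp^[N] f) x‖ ≤ (C * D * h ^ N * (N ! : ℝ) ^ α) * ‖w x‖ := by
    filter_upwards [ae_restrict_mem isOpen_orthant.measurableSet] with x hx
    rw [hiter N hx, Real.norm_of_nonneg (by positivity)]
    have hb' : ∀ n, ‖(len n : ℂ) ^ N * b n * (laguerreFun n x : ℂ)‖ ≤
        C * w x * (‖(len n : ℂ) ^ N * b n‖ * ((len n : ℝ) + 1) ^ p) := fun n => by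
      have h1 := hbd n x (orthant_subset_closedOrthant hx)
      rw [← le_div_iff₀' (by positivity), div_eq_mul_inv] at h1
      rw [norm_mul]
      calc _ ≤ ‖(len n : ℂ) ^ N * b n‖ *
            (C * ((len n : ℝ) + 1) ^ p * ((1 + ‖x‖) ^ (d + 1))⁻¹) :=
            mul_le_mul_of_nonneg_left h1 (norm_nonneg _)
        _ = _ := by ring
    refine (tsum_of_norm_bounded ((hN N).1.mul_left _).hasSum hb').trans ?_
    rw [tsum_mul_left]
    calc C * w x * _ ≤ C * w x * (D * h ^ N * (N ! : ℝ) ^ α) := by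
          gcongr
          exact (hN N).2
      _ = _ := by ring
  refine (eLpNorm_le_mul_eLpNorm_of_ae_le_mul hle 2).trans ?_
  rw [hW, ← ENNReal.ofReal_mul (by positivity)]
  apply ENNReal.ofReal_le_ofReal (le_of_eq _)
  ring


/-! ### Determination of exponentially decaying functions by their moments -/

/-- The monomial `x^k`. -/
noncomputable def monom (k : MultiIndex d) (x : Fin d → ℝ) : ℝ := ∏ i, x i ^ k i

lemma monom_add_single (k : MultiIndex d) (j : Fin d) (N : ℕ) (x : Fin d → ℝ) :
    monom (k + Pi.single j N) x = monom k x * x j ^ N := by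
  simp only [monom, Pi.add_apply, pow_add, Finset.prod_mul_distrib]
  congr 1
  rw [Finset.prod_eq_single j (fun i _ hi => by simp [hi]) (by simp), Pi.single_eq_same]

lemma continuous_monom (k : MultiIndex d) : Continuous (monom k) :=
  continuous_finsetProd _ fun i _ => (continuous_apply i).pow _

/-- The phase `e^{i t·x}`. -/
noncomputable def phase (t x : Fin d → ℝ) : ℂ := Complex.exp (Complex.I * (∑ i, t i * x i : ℝ))

lemma norm_phase (t x : Fin d → ℝ) : ‖phase t x‖ = 1 := by
  rw [phase, mul_comm]; exact Complex.norm_exp_ofReal_mul_I _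

lemma continuous_phase (t : Fin d → ℝ) : Continuous (phase t) := by
  unfold phase; fun_prop

lemma phase_update (t x : Fin d → ℝ) (j : Fin d) (s : ℝ) :
    phase (Function.update t j (t j + s)) x = phase t x * Complex.exp (Complex.I * (s * x j : ℝ)) := by
  have : ∑ i, Function.update t j (t j + s) i * x i = ∑ i, t i * x i + s * x j := by
    rw [← Finset.add_sum_erase _ _ (Finset.mem_univ j), ← Finset.add_sum_erase _ (fun i => t i * x i)
      (Finset.mem_univ j), Function.update_self, Finset.sum_congr rfl fun i hi => by
        rw [Function.update_of_ne (Finset.ne_of_mem_erase hi)]]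
    ring
  rw [phase, phase, this, ← Complex.exp_add]
  push_cast
  ring_nf

lemma integrable_prod_exp {c : ℝ} (hc : 0 < c) :
    Integrable fun x : Fin d → ℝ => ∏ j, Real.exp (-c * |x j|) :=
  Integrable.fintype_prod fun _ => integrable_exp_neg_abs_mul hc

lemma abs_monom_le {c : ℝ} (hc : 0 < c) (k : MultiIndex d) :
    ∃ K : ℝ, 0 ≤ K ∧ ∀ x : Fin d → ℝ, |monom k x| ≤ K * ∏ j, Real.exp (c * |x j|) := by
  choose K hK h using fun j => abs_eval_le_exp (Polynomial.X ^ (k j)) hc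
  refine ⟨∏ j, K j, Finset.prod_nonneg fun j _ => hK j, fun x => ?_⟩
  rw [monom, Finset.abs_prod, ← Finset.prod_mul_distrib]
  refine Finset.prod_le_prod (fun j _ => abs_nonneg _) fun j _ => ?_
  simpa using h j (x j)

lemma exp_le_prod_exp {c : ℝ} (hc : 0 ≤ c) (x : Fin d → ℝ) (j : Fin d) :
    Real.exp (c * |x j|) ≤ ∏ i, Real.exp (c * |x i|) := by
  rw [← Real.exp_sum]
  exact Real.exp_le_exp.2 (Finset.single_le_sum (f := fun i => c * |x i|)
    (fun i _ => by positivity) (Finset.mem_univ j))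

section Moments

variable {G : (Fin d → ℝ) → ℂ} {C c : ℝ}

/-- Expand `e^{i s x_j}` in its power series: each term is again a moment against the old phase.
Dominated convergence applies for `|s| ≤ c/2`, since the monomial costs a rate `c/4` and the
exponential a rate `c/2`, which leaves decay of rate `c/4`. -/
lemma moment_step (hc : 0 < c) (hm : AEStronglyMeasurable G)
    (hG : ∀ x, ‖G x‖ ≤ C * ∏ j, Real.exp (-c * |x j|)) {t : Fin d → ℝ}
    (h0 : ∀ k, ∫ x, (monom k x : ℂ) * phase t x * G x = 0) (j : Fin d) {s : ℝ} (hs : |s| ≤ c / 2)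
    (k : MultiIndex d) :
    ∫ x, (monom k x : ℂ) * phase (Function.update t j (t j + s)) x * G x = 0 := by
  have hc4 : 0 < c / 4 := by positivity
  obtain ⟨K, hK, hmon⟩ := abs_monom_le hc4 k
  have hsum : ∀ x : Fin d → ℝ, HasSum (fun N : ℕ => |monom k x| * (|s * x j| ^ N / N !) * ‖G x‖)
      (|monom k x| * Real.exp |s * x j| * ‖G x‖) := fun x => by
    have := NormedSpace.expSeries_div_hasSum_exp (𝔸 := ℝ) |s * x j|
    rw [← Real.exp_eq_exp_ℝ] at this
    exact (this.mul_left _).mul_right _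
  have key := hasSum_integral_of_dominated_convergence (μ := volume)
    (F := fun (N : ℕ) x => (monom k x : ℂ) * phase t x *
      ((Complex.I * (s * x j : ℝ)) ^ N / (N ! : ℂ)) * G x)
    (f := fun x => (monom k x : ℂ) * phase (Function.update t j (t j + s)) x * G x)
    (fun N x => |monom k x| * (|s * x j| ^ N / N !) * ‖G x‖) ?_ ?_ ?_ ?_ ?_
  · refine key.unique ?_
    have : ∀ N : ℕ, ∫ x, (monom k x : ℂ) * phase t x *
      ((Complex.I * (s * x j : ℝ)) ^ N / (N ! : ℂ)) * G x = 0 := fun N => by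
      have e : ∀ x : Fin d → ℝ, (monom k x : ℂ) * phase t x *
          ((Complex.I * (s * x j : ℝ)) ^ N / (N ! : ℂ)) * G x =
          ((Complex.I * s) ^ N / (N ! : ℂ)) *
            ((monom (k + Pi.single j N) x : ℂ) * phase t x * G x) := fun x => by
        rw [monom_add_single]
        push_cast
        rw [← mul_assoc Complex.I, mul_pow]
        ring
      simp_rw [e]
      rw [integral_const_mul, h0, mul_zero]
    simp_rw [this]
    exact hasSum_zero
  · intro N
    refine AEStronglyMeasurable.mul (Continuous.aestronglyMeasurable ?_) hm
    have := continuous_monom k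
    have := continuous_phase t
    fun_prop
  · refine fun N => .of_forall fun x => le_of_eq ?_
    simp only [norm_mul, norm_div, norm_pow, norm_phase, Complex.norm_I, Complex.norm_real,
      Complex.norm_natCast, Real.norm_eq_abs, mul_one, one_mul, abs_mul]
  · exact .of_forall fun x => (hsum x).summable
  · simp_rw [fun x => (hsum x).tsum_eq]
    refine ((integrable_prod_exp (d := d) hc4).const_mul (K * C)).mono' ?_ (.of_forall fun x => ?_)
    · refine AEStronglyMeasurable.mul (Continuous.aestronglyMeasurable ?_) hm.norm
      have := continuous_monom k
      fun_prop
    · rw [Real.norm_of_nonneg (by positivity)]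
      have h1 : Real.exp |s * x j| ≤ ∏ i, Real.exp (c / 2 * |x i|) := by
        refine le_trans (Real.exp_le_exp.2 ?_) (exp_le_prod_exp (by positivity) x j)
        rw [abs_mul]
        gcongr
      calc |monom k x| * Real.exp |s * x j| * ‖G x‖
          ≤ (K * ∏ j, Real.exp (c / 4 * |x j|)) * (∏ i, Real.exp (c / 2 * |x i|)) *
            (C * ∏ j, Real.exp (-c * |x j|)) := by
            have : 0 ≤ ∏ j, Real.exp (c / 4 * |x j|) := Finset.prod_nonneg fun j _ => by positivity
            have : 0 ≤ ∏ j, Real.exp (c / 2 * |x j|) := Finset.prod_nonneg fun j _ => by positivity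
            exact mul_le_mul (mul_le_mul (hmon x) h1 (by positivity) (by positivity)) (hG x)
              (norm_nonneg _) (by positivity)
        _ = K * C * ∏ j, (Real.exp (c / 4 * |x j|) * Real.exp (c / 2 * |x j|) *
              Real.exp (-c * |x j|)) := by
            simp only [Finset.prod_mul_distrib]; ring
        _ = _ := by
            congr 1
            refine Finset.prod_congr rfl fun i _ => ?_
            rw [← Real.exp_add, ← Real.exp_add]
            ring_nf
  · refine .of_forall fun x => ?_
    rw [phase_update]
    have := NormedSpace.expSeries_div_hasSum_exp (𝔸 := ℂ) (Complex.I * (s * x j : ℝ))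
    rw [← Complex.exp_eq_exp_ℂ] at this
    convert! (this.mul_left ((monom k x : ℂ) * phase t x)).mul_right (G x) using 1
    ring

/-- The admissible displacement `c/2` does not depend on the current frequency. Finitely many steps
in each coordinate therefore reach any `t` from `0`, where the hypothesis is the vanishing of the
moments. -/
lemma moment_phase (hc : 0 < c) (hm : AEStronglyMeasurable G)
    (hG : ∀ x, ‖G x‖ ≤ C * ∏ j, Real.exp (-c * |x j|))
    (h0 : ∀ k, ∫ x, (monom k x : ℂ) * G x = 0) (t : Fin d → ℝ) :
    ∫ x, phase t x * G x = 0 := by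
  have hstep : ∀ t : Fin d → ℝ, (∀ k, ∫ x, (monom k x : ℂ) * phase t x * G x = 0) →
      ∀ (j : Fin d) (r : ℝ) k,
        ∫ x, (monom k x : ℂ) * phase (Function.update t j (t j + r)) x * G x = 0 := by
    intro t ht j r
    obtain ⟨M, hM⟩ := exists_nat_gt (|r| / (c / 2))
    have hM0 : (0 : ℝ) < M := lt_of_le_of_lt (by positivity) hM
    have hs : |r / M| ≤ c / 2 := by
      rw [abs_div, abs_of_pos hM0, div_le_iff₀ hM0]
      rw [div_lt_iff₀ (by positivity)] at hM
      linarith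
    have hind : ∀ m : ℕ, ∀ k,
        ∫ x, (monom k x : ℂ) * phase (Function.update t j (t j + m * (r / M))) x * G x = 0 := by
      intro m
      induction m with
      | zero => simpa using ht
      | succ m ih =>
        intro k
        have := moment_step hc hm hG ih j hs k
        rw [Function.update_self, Function.update_idem] at this
        rw [show t j + (m + 1 : ℕ) * (r / M) = t j + m * (r / M) + r / M by push_cast; ring]
        exact this
    have := hind M
    rwa [mul_div_cancel₀ r hM0.ne'] at this
  have hall : ∀ S : Finset (Fin d), ∀ k,
      ∫ x, (monom k x : ℂ) * phase (fun i => if i ∈ S then t i else 0) x * G x = 0 := by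
    intro S
    induction S using Finset.induction_on with
    | empty => simpa [phase] using h0
    | insert j S hj ih =>
      have := hstep _ ih j (t j)
      have e : (fun i => if i ∈ insert j S then t i else 0) =
          Function.update (fun i => if i ∈ S then t i else 0) j
            ((if j ∈ S then t j else 0) + t j) := by
        funext i
        by_cases hi : i = j
        · subst hi; simp [hj]
        · simp [hi]
      rw [e]
      exact this
  have := hall Finset.univ 0
  simpa [monom] using this

/-- An exponentially decaying function with vanishing moments vanishes where it is continuous. -/
lemma eq_zero_of_moments (hc : 0 < c) (hm : AEStronglyMeasurable G)
    (hG : ∀ x, ‖G x‖ ≤ C * ∏ j, Real.exp (-c * |x j|))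
    (h0 : ∀ k, ∫ x, (monom k x : ℂ) * G x = 0) {x : Fin d → ℝ} (hx : ContinuousAt G x) :
    G x = 0 := by
  have hInt : Integrable G := ((integrable_prod_exp hc).const_mul C).mono' hm (.of_forall hG)
  -- Fourier inversion takes place on Euclidean space; the identification with the sup-normed
  -- product preserves volume.
  have hmp := PiLp.volume_preserving_ofLp (Fin d)
  have hme : MeasurableEmbedding (@WithLp.ofLp 2 (Fin d → ℝ)) :=
    (MeasurableEquiv.toLp 2 (Fin d → ℝ)).symm.measurableEmbedding
  set G' : EuclideanSpace ℝ (Fin d) → ℂ := fun v => G v.ofLp with hG'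
  have hInt' : Integrable G' := (hmp.integrable_comp_emb hme).2 hInt
  have hF : FourierTransform.fourier G' = 0 := by
    funext w
    rw [Real.fourier_eq', Pi.zero_apply,
      ← moment_phase hc hm hG h0 (fun i => -2 * Real.pi * w i), ← hmp.integral_comp hme]
    refine integral_congr_ae (.of_forall fun v => ?_)
    simp only [hG', phase, smul_eq_mul]
    congr 2
    rw [mul_comm]
    congr 2
    rw [PiLp.inner_apply, Finset.mul_sum]
    refine Finset.sum_congr rfl fun i _ => ?_
    simp
    ring
  have hcont : ContinuousAt G' (WithLp.toLp 2 x) :=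
    ContinuousAt.comp (f := fun v : EuclideanSpace ℝ (Fin d) => v.ofLp) (g := G) hx
      (PiLp.continuous_ofLp 2 _).continuousAt
  have := hInt'.fourierInv_fourier_eq (by rw [hF]; exact integrable_zero _ _ _) hcont
  rw [hF] at this
  have hz : FourierTransformInv.fourierInv (0 : EuclideanSpace ℝ (Fin d) → ℂ)
      (WithLp.toLp 2 x) = 0 := by
    rw [Real.fourierInv_eq']; simp
  rw [hz] at this
  exact this.symm

end Moments

/-! ### Completeness of the Hermite and Laguerre functions -/

lemma integral_mul_tensor_eq_zero_of_mem_span {μ : Measure (Fin d → ℝ)} {u : (Fin d → ℝ) → ℂ}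
    {e : ℕ → ℝ → ℝ} (hi : ∀ n : MultiIndex d, Integrable (fun x => u x * tensor (fun j => e (n j)) x) μ)
    (h0 : ∀ n : MultiIndex d, ∫ x, u x * tensor (fun j => e (n j)) x ∂μ = 0) {g : Fin d → ℝ → ℝ}
    (hg : ∀ j, g j ∈ Submodule.span ℝ (Set.range e)) : ∫ x, u x * tensor g x ∂μ = 0 := by
  have hg' : ∀ j, ∃ c : ℕ →₀ ℝ, (c.sum fun i a => a • e i) = g j := fun j =>
    Finsupp.mem_span_range_iff_exists_finsupp.1 (hg j)
  choose c hc using hg'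
  have hexp : ∀ x, u x * tensor g x = ∑ n ∈ Fintype.piFinset fun j => (c j).support,
      ((∏ j, c j (n j) : ℝ) : ℂ) * (u x * tensor (fun j => e (n j)) x) := fun x => by
    have : tensor g x = ((∏ j, ∑ i ∈ (c j).support, c j i * e i (x j) : ℝ) : ℂ) := by
      rw [tensor]
      congr 2
      funext j
      rw [← hc j, Finsupp.sum, Finset.sum_apply]
      rfl
    rw [this, Finset.prod_univ_sum, Complex.ofReal_sum, Finset.mul_sum]
    refine Finset.sum_congr rfl fun n _ => ?_
    rw [Finset.prod_mul_distrib, tensor]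
    push_cast
    ring
  simp_rw [hexp]
  rw [integral_finsetSum _ fun n _ => (hi n).const_mul _]
  exact Finset.sum_eq_zero fun n _ => by rw [integral_const_mul, h0, mul_zero]

/-- The three-term recursion makes the span stable under multiplication by `t`. Hence it contains
every `t^k e_0`, so vanishing coefficients of `u` imply vanishing moments of `u` times the ground
state. -/
lemma pow_mul_mem_span {e : ℕ → ℝ → ℝ}
    (he : ∀ n, (fun t => t * e n t) ∈ Submodule.span ℝ (Set.range e)) (k : ℕ) :
    (fun t => t ^ k * e 0 t) ∈ Submodule.span ℝ (Set.range e) := by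
  have hstep : ∀ f ∈ Submodule.span ℝ (Set.range e),
      (fun t => t * f t) ∈ Submodule.span ℝ (Set.range e) := fun f hf => by
    induction hf using Submodule.span_induction with
    | mem f hf => obtain ⟨n, rfl⟩ := hf; exact he n
    | zero =>
      simp only [Pi.zero_apply, mul_zero]
      exact Submodule.zero_mem (Submodule.span ℝ (Set.range e))
    | add f g _ _ hf hg =>
      convert Submodule.add_mem _ hf hg using 1
      funext t; simp; ring
    | smul a f _ hf =>
      convert Submodule.smul_mem _ a hf using 1
      funext t; simp; ring
  induction k with
  | zero =>
    simp only [pow_zero, one_mul]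
    exact Submodule.subset_span (Set.mem_range_self 0)
  | succ k ih =>
    convert hstep _ ih using 1
    funext t; ring

lemma mul_her_mem_span (n : ℕ) : (fun t => t * her n t) ∈ Submodule.span ℝ (Set.range her) := by
  have h : (fun t => t * her n t) =
      (√(2 * (n + 1)) / 2) • her (n + 1) + (√(2 * n) / 2) • her (n - 1) := by
    funext t; simp [mul_her]
  rw [h]
  exact Submodule.add_mem _ (Submodule.smul_mem _ _ (Submodule.subset_span (Set.mem_range_self _)))
    (Submodule.smul_mem _ _ (Submodule.subset_span (Set.mem_range_self _)))

lemma mul_lag_mem_span (n : ℕ) : (fun t => t * lag n t) ∈ Submodule.span ℝ (Set.range lag) := by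
  have h : (fun t => t * lag n t) =
      (2 * n + 1 : ℝ) • lag n - (n : ℝ) • lag (n - 1) - (n + 1 : ℝ) • lag (n + 1) := by
    funext t; simp [mul_lag]
  rw [h]
  have hs := fun (c : ℝ) m => Submodule.smul_mem (Submodule.span ℝ (Set.range lag)) c
    (Submodule.subset_span (Set.mem_range_self m))
  exact Submodule.sub_mem _ (Submodule.sub_mem _ (hs _ _) (hs _ _)) (hs _ _)

lemma monom_mul_tensor (k : MultiIndex d) (f : ℝ → ℝ) (x : Fin d → ℝ) :
    (monom k x : ℂ) * tensor (fun _ => f) x = tensor (fun j t => t ^ k j * f t) x := by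
  simp only [monom, tensor, Finset.prod_mul_distrib]
  push_cast
  ring

lemma norm_tensor_le {A : Fin d → ℝ → ℝ} {C c : ℝ} {x : Fin d → ℝ}
    (h : ∀ j, |A j (x j)| ≤ C * Real.exp (-c * |x j|)) :
    ‖tensor A x‖ ≤ C ^ d * ∏ j, Real.exp (-c * |x j|) := by
  rw [tensor, Complex.norm_real, Real.norm_eq_abs, Finset.abs_prod]
  refine (Finset.prod_le_prod (fun j _ => abs_nonneg _) fun j _ => h j).trans (le_of_eq ?_)
  rw [Finset.prod_mul_distrib]
  simp

lemma measurableSet_orthant : MeasurableSet (orthant d) := isOpen_orthant.measurableSet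

lemma integrable_hermiteFun (n : MultiIndex d) :
    Integrable fun x : Fin d → ℝ => (hermiteFun n x : ℂ) := by
  choose C hC h using fun j => her_exp_decay (n j)
  refine ((integrable_prod_exp (d := d) (c := 1 / 2) (by norm_num)).const_mul
    ((∑ j, C j) ^ d)).mono' (tempFam_hermite.1 n).continuous.aestronglyMeasurable
    (.of_forall fun x => norm_tensor_le fun j => (h j (x j)).trans ?_)
  have h1 : C j ≤ ∑ j, C j := Finset.single_le_sum (fun i _ => hC i) (Finset.mem_univ j)
  rw [show -|x j| / 2 = -(1 / 2) * |x j| by ring]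
  gcongr

lemma norm_laguerreFun_le (n : MultiIndex d) : ∃ C : ℝ, 0 ≤ C ∧ ∀ x ∈ closedOrthant d,
    ‖(laguerreFun n x : ℂ)‖ ≤ C * ∏ j, Real.exp (-(1 / 4) * |x j|) := by
  choose C hC h using fun j => lag_exp_decay (n j)
  refine ⟨(∑ j, C j) ^ d, pow_nonneg (Finset.sum_nonneg fun j _ => hC j) _,
    fun x hx => norm_tensor_le fun j => (h j (x j) (hx j)).trans ?_⟩
  have h1 : C j ≤ ∑ j, C j := Finset.single_le_sum (fun i _ => hC i) (Finset.mem_univ j)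
  rw [abs_of_nonneg (hx j), show -x j / 4 = -(1 / 4) * x j by ring]
  gcongr

lemma integrableOn_laguerreFun (n : MultiIndex d) :
    IntegrableOn (fun x : Fin d → ℝ => (laguerreFun n x : ℂ)) (orthant d) := by
  obtain ⟨C, hC, h⟩ := norm_laguerreFun_le n
  refine ((integrable_prod_exp (d := d) (c := 1 / 4) (by norm_num)).const_mul C).integrableOn.mono'
    (tempFam_laguerre.1 n).continuous.aestronglyMeasurable ?_
  filter_upwards [ae_restrict_mem measurableSet_orthant] with x hx
  exact h x (orthant_subset_closedOrthant hx)

/-- A bounded continuous function with vanishing Hermite coefficients vanishes. -/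
lemma eq_zero_of_hermiteCoeff {u : (Fin d → ℝ) → ℂ} (hu : Continuous u) {C : ℝ}
    (hC : ∀ x, ‖u x‖ ≤ C) (h0 : ∀ n, hermiteCoeff u n = 0) (x : Fin d → ℝ) : u x = 0 := by
  obtain ⟨D, hD, h⟩ := her_exp_decay 0
  have hcont : Continuous (tensor fun _ : Fin d => her 0) :=
    (contDiff_tensor fun _ => contDiff_her 0).continuous
  have hC0 : 0 ≤ C := (norm_nonneg _).trans (hC 0)
  -- Since `u` is merely bounded, the moment criterion is applied to its product with the ground
  -- state, which decays exponentially and has no zeros.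
  have key := eq_zero_of_moments (G := fun x => u x * tensor (fun _ => her 0) x)
    (c := 1 / 2) (C := C * D ^ d) (by norm_num) (hu.mul hcont).aestronglyMeasurable
    (fun x => ?_) (fun k => ?_) (hu.mul hcont).continuousAt (x := x)
  · rcases mul_eq_zero.1 key with h | h
    · exact h
    · exfalso
      rw [tensor, Complex.ofReal_eq_zero, Finset.prod_eq_zero_iff] at h
      obtain ⟨j, _, hj⟩ := h
      rw [her, hermitePoly_zero, mul_one] at hj
      exact (mul_pos (herConst_pos 0) (Real.exp_pos _)).ne' hj
  · rw [norm_mul, mul_assoc]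
    refine mul_le_mul (hC x) (norm_tensor_le fun j => ?_) (norm_nonneg _) hC0
    rw [show -(1 / 2) * |x j| = -|x j| / 2 by ring]
    exact h (x j)
  · simp_rw [mul_left_comm (monom k _ : ℂ), monom_mul_tensor]
    refine integral_mul_tensor_eq_zero_of_mem_span (e := her) (fun n => ?_) h0
      fun j => pow_mul_mem_span mul_her_mem_span _
    exact (integrable_hermiteFun n).bdd_mul hu.aestronglyMeasurable (.of_forall hC)

/-- A bounded continuous function on the orthant with vanishing Laguerre coefficients vanishes. -/
lemma eq_zero_of_laguerreCoeff {u : (Fin d → ℝ) → ℂ} (hu : ContinuousOn u (orthant d)) {C : ℝ}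
    (hC : ∀ x ∈ orthant d, ‖u x‖ ≤ C) (h0 : ∀ n, laguerreCoeff u n = 0) {x : Fin d → ℝ}
    (hx : x ∈ orthant d) : u x = 0 := by
  obtain ⟨D, hD, h⟩ := lag_exp_decay 0
  have hcont : Continuous (tensor fun _ : Fin d => lag 0) :=
    (contDiff_tensor fun _ => contDiff_lag 0).continuous
  have hC0 : 0 ≤ C := (norm_nonneg _).trans (hC x hx)
  have hm : AEStronglyMeasurable u (volume.restrict (orthant d)) :=
    hu.aestronglyMeasurable measurableSet_orthant
  -- The product with the ground state is extended by zero outside the orthant. It may jump at the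
  -- boundary, but continuity is needed only at the interior point `x`.
  have key := eq_zero_of_moments
    (G := (orthant d).indicator fun x => u x * tensor (fun _ => lag 0) x)
    (c := 1 / 4) (C := C * D ^ d) (by norm_num)
    ((aestronglyMeasurable_indicator_iff measurableSet_orthant).2
      (hm.mul hcont.aestronglyMeasurable)) (fun x => ?_) (fun k => ?_) (x := x) ?_
  · rw [Set.indicator_of_mem hx] at key
    rcases mul_eq_zero.1 key with h | h
    · exact h
    · exfalso
      rw [tensor, Complex.ofReal_eq_zero, Finset.prod_eq_zero_iff] at h
      obtain ⟨j, _, hj⟩ := h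
      rw [lag, laguerrePoly_zero, one_mul] at hj
      exact (Real.exp_pos _).ne' hj
  · by_cases hx : x ∈ orthant d
    · rw [Set.indicator_of_mem hx, norm_mul, mul_assoc]
      refine mul_le_mul (hC x hx) (norm_tensor_le fun j => ?_) (norm_nonneg _) hC0
      rw [abs_of_pos (hx j), show -(1 / 4) * x j = -x j / 4 by ring]
      exact h (x j) (hx j).le
    · rw [Set.indicator_of_notMem hx, norm_zero]
      have : 0 ≤ ∏ j, Real.exp (-(1 / 4) * |x j|) := Finset.prod_nonneg fun j _ => by positivity
      positivity
  · have e : ∀ x, (monom k x : ℂ) * (orthant d).indicator (fun x => u x * tensor (fun _ => lag 0) x) x =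
        (orthant d).indicator (fun x => u x * tensor (fun j t => t ^ k j * lag 0 t) x) x := fun x => by
      by_cases hx : x ∈ orthant d
      · rw [Set.indicator_of_mem hx, Set.indicator_of_mem hx, ← monom_mul_tensor]; ring
      · rw [Set.indicator_of_notMem hx, Set.indicator_of_notMem hx, mul_zero]
    simp_rw [e]
    rw [integral_indicator measurableSet_orthant]
    refine integral_mul_tensor_eq_zero_of_mem_span (e := lag) (fun n => ?_) h0
      fun j => pow_mul_mem_span mul_lag_mem_span _
    refine (integrableOn_laguerreFun n).bdd_mul hm (c := C) ?_
    filter_upwards [ae_restrict_mem measurableSet_orthant] with x hx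
    exact hC x hx
  · refine ContinuousAt.congr ((hu.continuousAt (isOpen_orthant.mem_nhds hx)).mul
      hcont.continuousAt) ?_
    filter_upwards [isOpen_orthant.mem_nhds hx] with y hy
    rw [Set.indicator_of_mem hy]
    rfl


/-! ### Integrals of tensor products and orthonormality -/

lemma integral_tensor (A : Fin d → ℝ → ℝ) :
    ∫ x, tensor A x = ((∏ j, ∫ t, A j t : ℝ) : ℂ) := by
  simp only [tensor]
  rw [integral_complex_ofReal, integral_fintype_prod_volume_eq_prod]

lemma orthant_eq_pi : orthant d = Set.univ.pi fun _ => Set.Ioi 0 := by ext; simp [orthant]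

lemma restrict_orthant :
    (volume : Measure (Fin d → ℝ)).restrict (orthant d) =
      Measure.pi fun _ => volume.restrict (Set.Ioi 0) := by
  rw [orthant_eq_pi, volume_pi, Measure.restrict_pi_pi]

lemma integral_orthant_tensor (A : Fin d → ℝ → ℝ) :
    ∫ x in orthant d, tensor A x = ((∏ j, ∫ t in Set.Ioi 0, A j t : ℝ) : ℂ) := by
  simp only [tensor]
  rw [integral_complex_ofReal, restrict_orthant, integral_fintype_prod_eq_prod]

lemma tensor_mul (A B : Fin d → ℝ → ℝ) (x : Fin d → ℝ) :
    tensor A x * tensor B x = tensor (fun j t => A j t * B j t) x := by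
  simp only [tensor, Finset.prod_mul_distrib]
  push_cast
  rfl

lemma prod_ite_eq_multiIndex (n m : MultiIndex d) :
    (∏ j, if n j = m j then (1 : ℝ) else 0) = if n = m then 1 else 0 := by
  rw [Finset.prod_ite_zero]
  simp [funext_iff]

lemma integral_hermiteFun_mul (n m : MultiIndex d) :
    ∫ x, (hermiteFun n x : ℂ) * (hermiteFun m x : ℂ) = if n = m then 1 else 0 := by
  have h : ∀ x : Fin d → ℝ, (hermiteFun n x : ℂ) * (hermiteFun m x : ℂ) =
      tensor (fun j t => her (n j) t * her (m j) t) x := fun x =>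
    tensor_mul (fun j => her (n j)) (fun j => her (m j)) x
  simp_rw [h, integral_tensor, integral_her_mul_her, prod_ite_eq_multiIndex]
  split_ifs <;> simp

lemma integral_laguerreFun_mul (n m : MultiIndex d) :
    ∫ x in orthant d, (laguerreFun n x : ℂ) * (laguerreFun m x : ℂ) = if n = m then 1 else 0 := by
  have h : ∀ x : Fin d → ℝ, (laguerreFun n x : ℂ) * (laguerreFun m x : ℂ) =
      tensor (fun j t => lag (n j) t * lag (m j) t) x := fun x =>
    tensor_mul (fun j => lag (n j)) (fun j => lag (m j)) x
  simp_rw [h, integral_orthant_tensor, integral_lag_mul_lag, prod_ite_eq_multiIndex]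
  split_ifs <;> simp

/-! ### Termwise integration -/

/-- The family `F` need not be a basis: it is also used for Laguerre functions composed with `vMap`
and for Hermite functions composed with `wMap`, which obey the same uniform bounds. -/
lemma hasSum_integral_mul {μ : Measure (Fin d → ℝ)} {U : Set (Fin d → ℝ)}
    (hU : ∀ᵐ x ∂μ, x ∈ U) {F : MultiIndex d → (Fin d → ℝ) → ℂ} (hFc : ∀ n, Continuous (F n))
    {C : ℝ} {p : ℕ} (hF : ∀ n, ∀ x ∈ U, ‖F n x‖ ≤ C * ((len n : ℝ) + 1) ^ p)
    {ψ : (Fin d → ℝ) → ℂ} (hψ : Integrable ψ μ) {b : MultiIndex d → ℂ} (hb : Rapid b) :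
    HasSum (fun n => b n * ∫ x, F n x * ψ x ∂μ) (∫ x, (∑' n, b n * F n x) * ψ x ∂μ) := by
  have hs : Summable fun n => ‖b n‖ * (C * ((len n : ℝ) + 1) ^ p) := by
    refine ((hb p).mul_left C).congr fun n => by ring
  have hbd : ∀ n, ∀ x ∈ U, ‖b n * F n x‖ ≤ ‖b n‖ * (C * ((len n : ℝ) + 1) ^ p) := fun n x hx => by
    rw [norm_mul]; exact mul_le_mul_of_nonneg_left (hF n x hx) (norm_nonneg _)
  simp_rw [← integral_const_mul, ← mul_assoc]
  refine hasSum_integral_of_dominated_convergence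
    (fun n x => ‖b n‖ * (C * ((len n : ℝ) + 1) ^ p) * ‖ψ x‖) (fun n => ?_) (fun n => ?_) ?_ ?_ ?_
  · exact (continuous_const.mul (hFc n)).aestronglyMeasurable.mul hψ.aestronglyMeasurable
  · filter_upwards [hU] with x hx
    rw [norm_mul]
    exact mul_le_mul_of_nonneg_right (hbd n x hx) (norm_nonneg _)
  · exact .of_forall fun x => hs.mul_right _
  · simp_rw [tsum_mul_right]
    exact hψ.norm.const_mul _
  · filter_upwards [hU] with x hx
    exact (Summable.of_norm_bounded hs fun n => hbd n x hx).hasSum.mul_right _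

lemma ae_mem_closedOrthant :
    ∀ᵐ x ∂(volume : Measure (Fin d → ℝ)).restrict (orthant d), x ∈ closedOrthant d := by
  filter_upwards [ae_restrict_mem measurableSet_orthant] with x hx
  exact orthant_subset_closedOrthant hx

lemma TempFam.exists_norm_le {U : Set (Fin d → ℝ)} {F : MultiIndex d → (Fin d → ℝ) → ℂ}
    (hF : TempFam U F) : ∃ C : ℝ, 0 ≤ C ∧ ∃ p : ℕ, ∀ n, ∀ x ∈ U,
      ‖F n x‖ ≤ C * ((len n : ℝ) + 1) ^ p := by
  obtain ⟨C, hC, p, h⟩ := hF.2 0 0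
  exact ⟨C, hC, p, by simpa using h⟩

lemma hermiteCoeff_tsum {b : MultiIndex d → ℂ} (hb : Rapid b) (n : MultiIndex d) :
    hermiteCoeff (fun x => ∑' m, b m * (hermiteFun m x : ℂ)) n = b n := by
  obtain ⟨C, hC, p, h⟩ := tempFam_hermite (d := d).exists_norm_le
  have := hasSum_integral_mul (μ := volume) (.of_forall fun x => Set.mem_univ x)
    (fun n => (tempFam_hermite.1 n).continuous) h (integrable_hermiteFun n) hb
  refine this.unique ?_
  simp_rw [integral_hermiteFun_mul]
  convert hasSum_ite_eq n (b n) using 2 with m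
  split_ifs <;> simp_all

lemma laguerreCoeff_tsum {b : MultiIndex d → ℂ} (hb : Rapid b) (n : MultiIndex d) :
    laguerreCoeff (fun x => ∑' m, b m * (laguerreFun m x : ℂ)) n = b n := by
  obtain ⟨C, hC, p, h⟩ := tempFam_laguerre (d := d).exists_norm_le
  have := hasSum_integral_mul ae_mem_closedOrthant
    (fun n => (tempFam_laguerre.1 n).continuous) h (integrableOn_laguerreFun n) hb
  refine this.unique ?_
  simp_rw [integral_laguerreFun_mul]
  convert hasSum_ite_eq n (b n) using 2 with m
  split_ifs <;> simp_all

/-! ### Expansions -/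

/-- A bounded continuous function is the sum of its Hermite series if its coefficients decrease
rapidly. -/
lemma hasSum_hermite {f : (Fin d → ℝ) → ℂ} (hf : Continuous f) {C : ℝ} (hC : ∀ x, ‖f x‖ ≤ C)
    (hr : Rapid (hermiteCoeff f)) (x : Fin d → ℝ) :
    HasSum (fun n => hermiteCoeff f n * (hermiteFun n x : ℂ)) (f x) := by
  have hs := tempFam_hermite.smoothSummable hr
  have hcont : Continuous fun x => ∑' n, hermiteCoeff f n * (hermiteFun n x : ℂ) :=
    continuousOn_univ.1 hs.continuousOn_tsum
  obtain ⟨u, hu, hbd⟩ := hs.bound 0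
  simp only [norm_iteratedFDeriv_zero] at hbd
  have hle : ∀ x, ‖∑' n, hermiteCoeff f n * (hermiteFun n x : ℂ)‖ ≤ ∑' n, u n := fun x =>
    tsum_of_norm_bounded hu.hasSum fun n => hbd n x trivial
  have key := eq_zero_of_hermiteCoeff
    (u := fun x => f x - ∑' n, hermiteCoeff f n * (hermiteFun n x : ℂ))
    (hf.sub hcont) (C := C + ∑' n, u n) (fun x => (norm_sub_le _ _).trans (add_le_add (hC x) (hle x)))
    (fun n => ?_) x
  · rw [sub_eq_zero] at key
    rw [key]
    exact (hs.summable trivial).hasSum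
  · refine Eq.trans ?_ (sub_eq_zero.2 (hermiteCoeff_tsum hr n).symm)
    refine Eq.trans ?_ (integral_sub
      ((integrable_hermiteFun n).bdd_mul hf.aestronglyMeasurable (.of_forall hC))
      ((integrable_hermiteFun n).bdd_mul hcont.aestronglyMeasurable (.of_forall hle)))
    exact integral_congr_ae (.of_forall fun x => sub_mul _ _ _)

lemma closedOrthant_subset_closure : closedOrthant d ⊆ closure (orthant d) := by
  rw [orthant_eq_pi, closure_pi_set]
  intro x hx j _
  rw [closure_Ioi]
  exact hx j

/-- A bounded continuous function on the orthant is the sum of its Laguerre series if its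
coefficients decrease rapidly. -/
lemma hasSum_laguerre {f : (Fin d → ℝ) → ℂ} (hf : ContinuousOn f (closedOrthant d)) {C : ℝ}
    (hC : ∀ x ∈ orthant d, ‖f x‖ ≤ C) (hr : Rapid (laguerreCoeff f)) {x : Fin d → ℝ}
    (hx : x ∈ closedOrthant d) :
    HasSum (fun n => laguerreCoeff f n * (laguerreFun n x : ℂ)) (f x) := by
  have hs := tempFam_laguerre.smoothSummable hr
  have hcont := hs.continuousOn_tsum
  obtain ⟨u, hu, hbd⟩ := hs.bound 0
  simp only [norm_iteratedFDeriv_zero] at hbd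
  have hle : ∀ x ∈ orthant d, ‖∑' n, laguerreCoeff f n * (laguerreFun n x : ℂ)‖ ≤ ∑' n, u n :=
    fun x hx => tsum_of_norm_bounded hu.hasSum fun n => hbd n x (orthant_subset_closedOrthant hx)
  have key : Set.EqOn f (fun x => ∑' n, laguerreCoeff f n * (laguerreFun n x : ℂ)) (orthant d) := by
    intro y hy
    refine sub_eq_zero.1 (eq_zero_of_laguerreCoeff
      (u := fun x => f x - ∑' n, laguerreCoeff f n * (laguerreFun n x : ℂ))
      ((hf.sub hcont).mono orthant_subset_closedOrthant) (C := C + ∑' n, u n)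
      (fun x hx => (norm_sub_le _ _).trans (add_le_add (hC x hx) (hle x hx))) (fun n => ?_) hy)
    refine Eq.trans ?_ (sub_eq_zero.2 (laguerreCoeff_tsum hr n).symm)
    refine Eq.trans (integral_congr_ae (.of_forall fun x => sub_mul _ _ _)) (integral_sub ?_ ?_)
    · refine (integrableOn_laguerreFun n).bdd_mul ((hf.mono
        orthant_subset_closedOrthant).aestronglyMeasurable measurableSet_orthant) (c := C) ?_
      filter_upwards [ae_restrict_mem measurableSet_orthant] with x hx using hC x hx
    · refine (integrableOn_laguerreFun n).bdd_mul ((hcont.mono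
        orthant_subset_closedOrthant).aestronglyMeasurable measurableSet_orthant)
        (c := ∑' n, u n) ?_
      filter_upwards [ae_restrict_mem measurableSet_orthant] with x hx using hle x hx
  -- Coefficients see only the open orthant; continuity carries the equality to the boundary.
  have h2 := key.of_subset_closure hf hcont orthant_subset_closedOrthant
    closedOrthant_subset_closure hx
  rw [h2]
  exact (hs.summable hx).hasSum

/-! ### Connection of the coefficients -/

lemma integral_lag_sq_mul_her (m k : ℕ) : ∫ t, lag m (t ^ 2) * her k t =
    ∑ j ∈ Finset.range (m + 1), if 2 * j = k then connCoeff (m - j) * evenRatio j else 0 := by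
  simp_rw [lag_sq, Finset.sum_mul, mul_assoc (_ * _) (her _ _) (her _ _)]
  rw [integral_finsetSum _ fun j _ => (integrable_her_mul_her _ _).const_mul _]
  refine Finset.sum_congr rfl fun j _ => ?_
  rw [integral_const_mul, integral_her_mul_her]
  split_ifs <;> simp

lemma integral_lag_sq_mul_her_even (m n : ℕ) : ∫ t, lag m (t ^ 2) * her (2 * n) t =
    if n ≤ m then connCoeff (m - n) * evenRatio n else 0 := by
  rw [integral_lag_sq_mul_her]
  simp only [mul_right_inj' (two_ne_zero (α := ℕ)), Finset.sum_ite_eq', Finset.mem_range,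
    Nat.lt_succ_iff]

lemma integral_lag_sq_mul_her_odd (m : ℕ) {k : ℕ} (hk : ¬ Even k) :
    ∫ t, lag m (t ^ 2) * her k t = 0 := by
  rw [integral_lag_sq_mul_her]
  refine Finset.sum_eq_zero fun j _ => if_neg fun h => hk ?_
  rw [← h]; exact even_two_mul j

lemma integral_her_sqrt_mul_lag (m n : ℕ) : ∫ t in Set.Ioi 0, her (2 * m) (√t) * lag n t =
    if n ≤ m then (evenRatio m)⁻¹ * connCoeffInv (m - n) else 0 := by
  have h : Set.EqOn (fun t => her (2 * m) (√t) * lag n t) (fun t => ∑ j ∈ Finset.range (m + 1),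
      (evenRatio m)⁻¹ * connCoeffInv (m - j) * (lag j t * lag n t)) (Set.Ioi 0) := fun t ht => by
    simp only
    rw [her_eq_sum_lag_sq, Real.sq_sqrt (le_of_lt ht), mul_assoc, Finset.sum_mul, Finset.mul_sum]
    exact Finset.sum_congr rfl fun j _ => by ring
  rw [setIntegral_congr_fun measurableSet_Ioi h,
    integral_finsetSum _ fun j _ => (integrableOn_lag_mul_lag _ _).const_mul _]
  simp_rw [integral_const_mul, integral_lag_mul_lag, mul_ite, mul_one, mul_zero]
  rw [Finset.sum_ite_eq' (Finset.range (m + 1)) n]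
  simp

/-- Triangularity of the connection matrix leaves only the indices `m ≥ n`; the substitution `m = k
+ n` gives the shifted series of the theorem. -/
lemma hasSum_shift {g : MultiIndex d → ℂ} {S : ℂ} (n : MultiIndex d) (hg : HasSum g S)
    (h0 : ∀ m, ¬ n ≤ m → g m = 0) : HasSum (fun k => g (k + n)) S := by
  refine ((add_left_injective n).hasSum_iff fun m hm => h0 m fun hle => hm ?_).2 hg
  exact ⟨m - n, tsub_add_cancel_of_le hle⟩

lemma vMap_mem_closedOrthant (x : Fin d → ℝ) : vMap x ∈ closedOrthant d := fun j => sq_nonneg (x j)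

lemma continuous_vMap : Continuous (vMap : (Fin d → ℝ) → Fin d → ℝ) := by
  unfold vMap; fun_prop

lemma continuous_wMap : Continuous (wMap : (Fin d → ℝ) → Fin d → ℝ) := by
  unfold wMap; fun_prop

lemma prod_ite_le_multiIndex (n m : MultiIndex d) (g : Fin d → ℝ) :
    (∏ j, if n j ≤ m j then g j else 0) = if ∀ j, n j ≤ m j then ∏ j, g j else 0 := by
  rw [Finset.prod_ite_zero]
  simp

lemma hasSum_hermiteCoeff_comp_vMap {a : MultiIndex d → ℂ} (ha : Rapid a)
    {f : (Fin d → ℝ) → ℂ}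
    (hf : Set.EqOn f (fun x => ∑' n, a n * (laguerreFun n x : ℂ)) (closedOrthant d))
    (k : MultiIndex d) :
    HasSum (fun m => a m * ((∏ j, ∫ t, lag (m j) (t ^ 2) * her (k j) t : ℝ) : ℂ))
      (hermiteCoeff (f ∘ vMap) k) := by
  obtain ⟨C, hC, p, h⟩ := tempFam_laguerre (d := d).exists_norm_le
  have := hasSum_integral_mul (μ := volume) (U := Set.univ) (.of_forall fun x => Set.mem_univ x)
    (F := fun n x => (laguerreFun n (vMap x) : ℂ))
    (fun n => (tempFam_laguerre.1 n).continuous.comp continuous_vMap)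
    (fun n x _ => h n _ (vMap_mem_closedOrthant x)) (integrable_hermiteFun k) ha
  convert this using 1
  · funext m
    rw [← integral_tensor]
    congr 2
    funext x
    exact (tensor_mul (fun j t => lag (m j) (t ^ 2)) (fun j => her (k j)) x).symm
  · rw [hermiteCoeff]
    congr 1
    funext x
    rw [Function.comp_apply, hf (vMap_mem_closedOrthant x)]

lemma hermiteCoeff_comp_vMap_of_odd {a : MultiIndex d → ℂ} (ha : Rapid a)
    {f : (Fin d → ℝ) → ℂ}
    (hf : Set.EqOn f (fun x => ∑' n, a n * (laguerreFun n x : ℂ)) (closedOrthant d))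
    {k : MultiIndex d} (hk : ¬ ∀ j, Even (k j)) : hermiteCoeff (f ∘ vMap) k = 0 := by
  refine (hasSum_hermiteCoeff_comp_vMap ha hf k).unique ?_
  push Not at hk
  obtain ⟨j, hj⟩ := hk
  convert hasSum_zero using 2 with m
  rw [Finset.prod_eq_zero (Finset.mem_univ j)
    (integral_lag_sq_mul_her_odd (m j) (by simpa using hj))]
  simp

lemma hasSum_hermiteCoeff_comp_vMap_even {a : MultiIndex d → ℂ} (ha : Rapid a)
    {f : (Fin d → ℝ) → ℂ}
    (hf : Set.EqOn f (fun x => ∑' n, a n * (laguerreFun n x : ℂ)) (closedOrthant d))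
    (n : MultiIndex d) :
    HasSum (fun k => a (k + n) * (((∏ j, connCoeff (k j)) * ∏ j, evenRatio (n j) : ℝ) : ℂ))
      (hermiteCoeff (f ∘ vMap) (2 • n)) := by
  have h1 := hasSum_hermiteCoeff_comp_vMap ha hf (2 • n)
  simp only [Pi.smul_apply, smul_eq_mul, integral_lag_sq_mul_her_even, prod_ite_le_multiIndex] at h1
  have h2 := hasSum_shift n h1 fun m hm => by
    rw [if_neg (show ¬ ∀ j, n j ≤ m j from hm)]; simp
  convert h2 using 2 with k
  rw [if_pos (show ∀ j, n j ≤ (k + n) j from fun j => Nat.le_add_left _ _)]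
  simp [Finset.prod_mul_distrib]

lemma hasSum_laguerreCoeff_comp_wMap {a : MultiIndex d → ℂ} (ha : Rapid a)
    (hodd : ∀ k : MultiIndex d, (¬ ∀ j, Even (k j)) → a k = 0)
    {f : (Fin d → ℝ) → ℂ} (hf : ∀ x, f x = ∑' n, a n * (hermiteFun n x : ℂ))
    (n : MultiIndex d) :
    HasSum (fun k => a (2 • (k + n)) *
        ((∏ j, (evenRatio (k j + n j))⁻¹ * connCoeffInv (k j) : ℝ) : ℂ))
      (laguerreCoeff (f ∘ wMap) n) := by
  obtain ⟨C, hC, p, h⟩ := tempFam_hermite (d := d).exists_norm_le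
  have h0 := hasSum_integral_mul (μ := volume.restrict (orthant d)) (U := Set.univ)
    (.of_forall fun x => Set.mem_univ x)
    (F := fun n x => (hermiteFun n (wMap x) : ℂ))
    (fun n => (tempFam_hermite.1 n).continuous.comp continuous_wMap)
    (fun n x _ => h n _ trivial) (integrableOn_laguerreFun n) ha
  have h1 : HasSum (fun m => a m * ((∏ j, ∫ t in Set.Ioi 0, her (m j) (√t) * lag (n j) t : ℝ) : ℂ))
      (laguerreCoeff (f ∘ wMap) n) := by
    convert h0 using 1
    · funext m
      rw [← integral_orthant_tensor]
      congr 2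
      funext x
      exact (tensor_mul (fun j t => her (m j) (√t)) (fun j => lag (n j)) x).symm
    · rw [laguerreCoeff]
      congr 1
      funext x
      rw [Function.comp_apply, hf]
  have hinj : Function.Injective fun m : MultiIndex d => 2 • m := fun m m' hm => by
    funext j
    have := congrFun hm j
    simpa using this
  have h2 := (hinj.hasSum_iff fun k hk => by
    rw [hodd k fun hk' => hk ?_, zero_mul]
    refine ⟨fun j => k j / 2, ?_⟩
    funext j
    simpa using Nat.two_mul_div_two_of_even (hk' j)).2 h1
  simp only [Function.comp_def, Pi.smul_apply, smul_eq_mul, integral_her_sqrt_mul_lag,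
    prod_ite_le_multiIndex] at h2
  have h3 := hasSum_shift n h2 fun m hm => by
    rw [if_neg (show ¬ ∀ j, n j ≤ m j from hm)]; simp
  change HasSum _ (laguerreCoeff (fun x => f (wMap x)) n)
  convert h3 using 2 with k
  rw [if_pos (show ∀ j, n j ≤ (k + n) j from fun j => Nat.le_add_left _ _)]
  simp

/-! ### Closed forms of the constants -/

/-- Reversing the order of the factors, `i ↦ k_j - 1 - i`, turns `k_j - 1/2 - i` into `i + 1/2`. -/
lemma mbinom_sub_half (k : MultiIndex d) :
    mbinom (fun j => (k j : ℝ) - 1 / 2) k = ∏ j, connCoeff (k j) := by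
  refine Finset.prod_congr rfl fun j _ => ?_
  rw [connCoeff, Finset.prod_div_distrib, ← Finset.prod_range_reflect]
  congr 1
  · refine Finset.prod_congr rfl fun i hi => ?_
    have : i + 1 ≤ k j := Finset.mem_range.1 hi
    rw [Nat.sub_sub, Nat.cast_sub (by omega)]
    push_cast
    ring
  · rw [← Finset.prod_range_add_one_eq_factorial]; push_cast; rfl

lemma mbinom_sub_three_halves (k : MultiIndex d) :
    mbinom (fun j => (k j : ℝ) - 3 / 2) k = ∏ j, connCoeffInv (k j) := by
  refine Finset.prod_congr rfl fun j _ => ?_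
  rw [connCoeffInv, Finset.prod_div_distrib, ← Finset.prod_range_reflect]
  congr 1
  · refine Finset.prod_congr rfl fun i hi => ?_
    have : i + 1 ≤ k j := Finset.mem_range.1 hi
    rw [Nat.sub_sub, Nat.cast_sub (by omega)]
    push_cast
    ring
  · rw [← Finset.prod_range_add_one_eq_factorial]; push_cast; rfl

lemma prod_evenRatio (n : MultiIndex d) : ∏ j, evenRatio (n j) =
    (-1) ^ len n * Real.pi ^ ((d : ℝ) / 4) * √(mfact (2 • n) : ℝ) /
      (2 ^ len n * (mfact n : ℝ)) := by
  have hpi : (Real.pi ^ ((1 : ℝ) / 4)) ^ d = Real.pi ^ ((d : ℝ) / 4) := by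
    rw [← Real.rpow_mul_natCast Real.pi_pos.le]
    ring_nf
  have hs : ∀ s : Finset (Fin d), √(∏ j ∈ s, ((2 * n j)! : ℝ)) = ∏ j ∈ s, √((2 * n j)! : ℝ) :=
    fun s => by
      induction s using Finset.induction_on with
      | empty => simp
      | insert j s hj ih =>
        rw [Finset.prod_insert hj, Finset.prod_insert hj, Real.sqrt_mul (by positivity), ih]
  simp only [evenRatio_eq, Finset.prod_div_distrib, Finset.prod_mul_distrib, Finset.prod_pow_eq_pow_sum,
    Finset.prod_const, Finset.card_univ, Fintype.card_fin, hpi, mfact, Nat.cast_prod, Pi.smul_apply,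
    smul_eq_mul, hs, len]


/-! ### Symmetry of the Hermite operator -/

/-- Dilates `ρ(t/(m+1))` of one bump function. Differentiation only produces factors `(m+1)^{-1} ≤
1`, so the bounds are uniform. Near any fixed point the cutoff is eventually constant, so its
derivatives drop out exactly there. -/
lemma exists_cutoff : ∃ θ : ℕ → ℝ → ℝ, (∀ m, ContDiff ℝ ∞ (θ m)) ∧ (∀ m, HasCompactSupport (θ m)) ∧
    (∀ t, ∀ᶠ m in Filter.atTop, θ m =ᶠ[nhds t] 1) ∧
    ∃ K : ℝ, 0 ≤ K ∧ ∀ m t, |θ m t| ≤ K ∧ |deriv (θ m) t| ≤ K ∧ |deriv (deriv (θ m)) t| ≤ K := by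
  let b : ContDiffBump (0 : ℝ) := ⟨1, 2, one_pos, one_lt_two⟩
  set ρ : ℝ → ℝ := fun t => b t with hρd
  have hρ : ContDiff ℝ ∞ ρ := b.contDiff
  have hρc : HasCompactSupport ρ := b.hasCompactSupport
  have hρ1 := contDiff_deriv_infty hρ
  have hρ2 := contDiff_deriv_infty hρ1
  obtain ⟨K0, h0⟩ := hρc.exists_bound_of_continuous hρ.continuous
  obtain ⟨K1, h1⟩ := hρc.deriv.exists_bound_of_continuous hρ1.continuous
  obtain ⟨K2, h2⟩ := hρc.deriv.deriv.exists_bound_of_continuous hρ2.continuous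
  have hK0 : 0 ≤ K0 := (norm_nonneg _).trans (h0 0)
  have hK1 : 0 ≤ K1 := (norm_nonneg _).trans (h1 0)
  have hK2 : 0 ≤ K2 := (norm_nonneg _).trans (h2 0)
  have hc : ∀ m : ℕ, ((m : ℝ) + 1)⁻¹ ≠ 0 := fun m => by positivity
  have hle : ∀ m : ℕ, ((m : ℝ) + 1)⁻¹ ≤ 1 := fun m => inv_le_one_of_one_le₀ (by
    linarith [(Nat.cast_nonneg m : (0 : ℝ) ≤ m)])
  have d1 : ∀ m : ℕ, deriv (fun t => ρ (((m : ℝ) + 1)⁻¹ * t)) =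
      fun t => ((m : ℝ) + 1)⁻¹ * deriv ρ (((m : ℝ) + 1)⁻¹ * t) := fun m => by
    funext t
    rw [deriv_comp_mul_left, smul_eq_mul]
  have d2 : ∀ m : ℕ, deriv (deriv (fun t => ρ (((m : ℝ) + 1)⁻¹ * t))) =
      fun t => ((m : ℝ) + 1)⁻¹ * (((m : ℝ) + 1)⁻¹ * deriv (deriv ρ) (((m : ℝ) + 1)⁻¹ * t)) :=
    fun m => by
    funext t
    rw [d1, deriv_const_mul_field, deriv_comp_mul_left (f := deriv ρ), smul_eq_mul]
  refine ⟨fun m t => ρ (((m : ℝ) + 1)⁻¹ * t), fun m => hρ.comp (contDiff_const.mul contDiff_id),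
    fun m => ?_, fun t => ?_, K0 + K1 + K2, by positivity, fun m t => ⟨?_, ?_, ?_⟩⟩
  · exact hρc.comp_homeomorph (Homeomorph.mulLeft₀ _ (hc m))
  · filter_upwards [Filter.eventually_gt_atTop ⌈|t|⌉₊] with m hm
    have hm' : |t| < (m : ℝ) + 1 := by
      have := Nat.le_ceil |t|
      have : ((⌈|t|⌉₊ : ℕ) : ℝ) < m := by exact_mod_cast hm
      linarith
    have : ∀ᶠ s in nhds t, |s| < (m : ℝ) + 1 :=
      (continuous_abs.tendsto t).eventually (gt_mem_nhds hm')
    filter_upwards [this] with s hs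
    refine b.one_of_mem_closedBall ?_
    rw [mem_closedBall_zero_iff, norm_mul, norm_inv, Real.norm_eq_abs, Real.norm_eq_abs,
      abs_of_nonneg (by positivity : (0 : ℝ) ≤ m + 1), inv_mul_le_iff₀ (by positivity), mul_one]
    exact hs.le
  · have := h0 (((m : ℝ) + 1)⁻¹ * t)
    rw [Real.norm_eq_abs] at this
    linarith
  · have := h1 (((m : ℝ) + 1)⁻¹ * t)
    rw [Real.norm_eq_abs] at this
    rw [d1, abs_mul, abs_of_nonneg (by positivity)]
    nlinarith [hle m, abs_nonneg (deriv ρ (((m : ℝ) + 1)⁻¹ * t)),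
      (by positivity : 0 ≤ ((m : ℝ) + 1)⁻¹)]
  · have := h2 (((m : ℝ) + 1)⁻¹ * t)
    rw [Real.norm_eq_abs] at this
    have hi : 0 ≤ ((m : ℝ) + 1)⁻¹ := by positivity
    rw [d2, abs_mul, abs_mul, abs_of_nonneg hi]
    have h3 : ((m : ℝ) + 1)⁻¹ * |deriv (deriv ρ) (((m : ℝ) + 1)⁻¹ * t)| ≤
        |deriv (deriv ρ) (((m : ℝ) + 1)⁻¹ * t)| := mul_le_of_le_one_left (abs_nonneg _) (hle m)
    have h4 := mul_le_of_le_one_left (mul_nonneg hi (abs_nonneg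
      (deriv (deriv ρ) (((m : ℝ) + 1)⁻¹ * t)))) (hle m)
    linarith

/-- Dominated convergence for tensor products. -/
lemma tendsto_integral_mul_tensor {F : (Fin d → ℝ) → ℂ} (hF : Continuous F) {C : ℝ}
    (hC : ∀ x, ‖F x‖ ≤ C) {B : ℕ → Fin d → ℝ → ℝ} (hB : ∀ m j, Continuous (B m j))
    {A : Fin d → ℝ → ℝ} {D : Fin d → ℝ → ℝ} (hD : ∀ j, Integrable (D j))
    (hBD : ∀ m j t, |B m j t| ≤ D j t) (hlim : ∀ j t, ∀ᶠ m in Filter.atTop, B m j t = A j t) :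
    Filter.Tendsto (fun m => ∫ x, F x * tensor (B m) x) Filter.atTop
      (nhds (∫ x, F x * tensor A x)) := by
  refine tendsto_integral_of_dominated_convergence (fun x => C * ∏ j, D j (x j)) (fun m => ?_)
    ((Integrable.fintype_prod hD).const_mul C) (fun m => .of_forall fun x => ?_)
    (.of_forall fun x => ?_)
  · refine (hF.mul ?_).aestronglyMeasurable
    have := hB m
    unfold tensor
    fun_prop
  · rw [norm_mul, tensor, Complex.norm_real, norm_prod]
    exact mul_le_mul (hC x) (Finset.prod_le_prod (fun _ _ => norm_nonneg _)
      fun j _ => hBD m j (x j)) (Finset.prod_nonneg fun _ _ => norm_nonneg _)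
      ((norm_nonneg _).trans (hC x))
  · refine tendsto_const_nhds.congr' ?_
    have : ∀ᶠ m in Filter.atTop, ∀ j, B m j (x j) = A j (x j) :=
      Filter.eventually_all.2 fun j => hlim j (x j)
    filter_upwards [this] with m hm
    simp only [tensor, hm]

lemma hasCompactSupport_tensor {A : Fin d → ℝ → ℝ} (hA : ∀ j, HasCompactSupport (A j)) :
    HasCompactSupport (tensor A) := by
  refine HasCompactSupport.of_support_subset_isCompact
    (isCompact_univ_pi fun j => (hA j).isCompact) fun x hx j _ => ?_
  refine subset_tsupport _ fun h => hx ?_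
  rw [tensor, Finset.prod_eq_zero (Finset.mem_univ j) h, Complex.ofReal_zero]

lemma integral_pderiv_mul {f g : (Fin d → ℝ) → ℂ} (hf : ContDiff ℝ ∞ f) (hg : ContDiff ℝ ∞ g)
    (hgc : HasCompactSupport g) (j : Fin d) :
    ∫ x, pderiv j f x * g x = -∫ x, f x * pderiv j g x := by
  have hgc' : HasCompactSupport (pderiv j g) := hgc.fderiv_apply ℝ _
  rw [eq_neg_iff_add_eq_zero, add_comm, ← eq_neg_iff_add_eq_zero]
  exact integral_mul_fderiv_eq_neg_fderiv_mul_of_integrable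
    (((contDiff_pderiv hf j).continuous.mul hg.continuous).integrable_of_hasCompactSupport
      hgc.mul_left)
    ((hf.continuous.mul (contDiff_pderiv hg j).continuous).integrable_of_hasCompactSupport
      hgc'.mul_left)
    ((hf.continuous.mul hg.continuous).integrable_of_hasCompactSupport hgc.mul_left)
    (fun x _ => hf.differentiable (by simp) x) (fun x _ => hg.differentiable (by simp) x)

lemma integral_hermiteOp_mul {f g : (Fin d → ℝ) → ℂ} (hf : ContDiff ℝ ∞ f)
    (hg : ContDiff ℝ ∞ g) (hgc : HasCompactSupport g) :
    ∫ x, hermiteOp f x * g x =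
      ∑ j, ∫ x, f x * ((x j : ℂ) ^ 2 * g x - pderiv j (pderiv j g) x) := by
  have hx : ∀ j : Fin d, Continuous fun x : Fin d → ℝ => (x j : ℂ) ^ 2 := fun j => by fun_prop
  have hf2 := fun j => contDiff_pderiv (contDiff_pderiv hf j) j
  have hg2 := fun j => contDiff_pderiv (contDiff_pderiv hg j) j
  have hgc1 : ∀ j, HasCompactSupport (pderiv j g) := fun j => hgc.fderiv_apply ℝ _
  have hgc2 : ∀ j, HasCompactSupport (pderiv j (pderiv j g)) := fun j =>
    (hgc1 j).fderiv_apply ℝ _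
  simp only [hermiteOp, Finset.sum_mul]
  have i1 : ∀ j : Fin d, Integrable fun x : Fin d → ℝ => (x j : ℂ) ^ 2 * f x * g x := fun j =>
    (((hx j).mul hf.continuous).mul hg.continuous).integrable_of_hasCompactSupport hgc.mul_left
  have i2 : ∀ j : Fin d, Integrable fun x : Fin d → ℝ => pderiv j (pderiv j f) x * g x :=
    fun j => ((hf2 j).continuous.mul hg.continuous).integrable_of_hasCompactSupport hgc.mul_left
  have i3 : ∀ j : Fin d, Integrable fun x : Fin d → ℝ => f x * pderiv j (pderiv j g) x :=
    fun j => (hf.continuous.mul (hg2 j).continuous).integrable_of_hasCompactSupport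
      (hgc2 j).mul_left
  rw [integral_finsetSum _ fun j _ => ((i1 j).sub (i2 j)).congr (.of_forall fun x => (sub_mul _ _ _).symm)]
  refine Finset.sum_congr rfl fun j _ => ?_
  have e : ∀ x : Fin d → ℝ, f x * ((x j : ℂ) ^ 2 * g x - pderiv j (pderiv j g) x) =
      (x j : ℂ) ^ 2 * f x * g x - f x * pderiv j (pderiv j g) x := fun x => by ring
  simp_rw [e, sub_mul]
  rw [integral_sub (i1 j) (i2 j), integral_sub (i1 j) (i3 j),
    integral_pderiv_mul (contDiff_pderiv hf j) hg hgc,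
    integral_pderiv_mul hf (contDiff_pderiv hg j) (hgc1 j), neg_neg]

/-- Two of the four powers absorb the potential `t²`, and two provide the integrable majorant `1/(1
+ t²)`. -/
lemma her_decay (n m : ℕ) : ∃ C : ℝ, 0 ≤ C ∧ ∀ t,
    (1 + |t|) ^ 4 * |iteratedDeriv m (her n) t| ≤ C := by
  obtain ⟨C, hC, p, h⟩ := polyBdd_iteratedDeriv_her 4 m
  exact ⟨C * ((n : ℝ) + 1) ^ p, by positivity, fun t => h n t trivial⟩

lemma deriv_deriv_mul {u v : ℝ → ℝ} (hu : ContDiff ℝ ∞ u) (hv : ContDiff ℝ ∞ v) (t : ℝ) :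
    deriv (deriv fun s => u s * v s) t =
      deriv (deriv u) t * v t + 2 * (deriv u t * deriv v t) + u t * deriv (deriv v) t := by
  have hu1 := contDiff_deriv_infty hu
  have hv1 := contDiff_deriv_infty hv
  have e : (deriv fun s => u s * v s) = fun s => deriv u s * v s + u s * deriv v s := by
    funext s
    exact deriv_fun_mul (hu.differentiable (by simp) s) (hv.differentiable (by simp) s)
  have h1 := ((hu1.differentiable (by simp) t).hasDerivAt.mul
    (hv.differentiable (by simp) t).hasDerivAt).add
    ((hu.differentiable (by simp) t).hasDerivAt.mul
    (hv1.differentiable (by simp) t).hasDerivAt)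
  rw [e]
  refine h1.deriv.trans ?_
  ring

/-- Only `f` and `H f` are known to be bounded, while the individual derivatives of `f` are not
controlled. The cutoff is therefore placed on the Hermite function, both derivatives are moved onto
it, and the cutoff is removed by dominated convergence. -/
lemma integral_hermiteOp_mul_hermiteFun {f : (Fin d → ℝ) → ℂ} (hf : ContDiff ℝ ∞ f) {C : ℝ}
    (hC : ∀ x, ‖f x‖ ≤ C) (hC' : ∀ x, ‖hermiteOp f x‖ ≤ C) (n : MultiIndex d) :
    hermiteCoeff (hermiteOp f) n = (2 * (len n : ℂ) + d) * hermiteCoeff f n := by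
  obtain ⟨θ, hθ, hθc, hθ1, K, hK, hθK⟩ := exists_cutoff
  set A : ℕ → Fin d → ℝ → ℝ := fun m j t => θ m t * her (n j) t with hA
  have hAs : ∀ m j, ContDiff ℝ ∞ (A m j) := fun m j => (hθ m).mul (contDiff_her _)
  have hAc : ∀ m j, HasCompactSupport (A m j) := fun m j => (hθc m).mul_right
  choose C0 hC0 h0 using fun j => her_decay (n j) 0
  choose C1 hC1 h1 using fun j => her_decay (n j) 1
  choose C2 hC2 h2 using fun j => her_decay (n j) 2
  simp only [iteratedDeriv_zero, iteratedDeriv_one] at h0 h1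
  simp only [iteratedDeriv_succ, iteratedDeriv_zero] at h2
  -- With `h = h_{n_j}`, the product rule for `θ h` contributes `C0` for `t² θ h`, `C0` for `θ'' h`,
  -- `2 C1` for `2 θ' h'` and `C2` for `θ h''`, each times the bound `K` of the cutoffs.
  set D : Fin d → ℝ → ℝ := fun j t => (K * (2 * C0 j + 2 * C1 j + C2 j)) * (1 + t ^ 2)⁻¹ with hD
  have hDi : ∀ j, Integrable (D j) := fun j => integrable_inv_one_add_sq.const_mul _
  have hu : ∀ j t, (1 + t ^ 2) * (t ^ 2 * |her (n j) t|) ≤ C0 j ∧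
      (1 + t ^ 2) * |her (n j) t| ≤ C0 j ∧ (1 + t ^ 2) * |deriv (her (n j)) t| ≤ C1 j ∧
      (1 + t ^ 2) * |deriv (deriv (her (n j))) t| ≤ C2 j := fun j t => by
    have a0 : 0 ≤ |t| := abs_nonneg t
    have e1 : 1 + t ^ 2 ≤ (1 + |t|) ^ 4 := by
      rw [← sq_abs t]; nlinarith [pow_nonneg a0 3, pow_nonneg a0 4, pow_nonneg a0 2]
    have e2 : (1 + t ^ 2) * t ^ 2 ≤ (1 + |t|) ^ 4 := by
      rw [← sq_abs t]; nlinarith [pow_nonneg a0 3, pow_nonneg a0 4, pow_nonneg a0 2]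
    refine ⟨?_, ?_, ?_, ?_⟩
    · rw [← mul_assoc]
      exact (mul_le_mul_of_nonneg_right e2 (abs_nonneg _)).trans (h0 j t)
    · exact (mul_le_mul_of_nonneg_right e1 (abs_nonneg _)).trans (h0 j t)
    · exact (mul_le_mul_of_nonneg_right e1 (abs_nonneg _)).trans (h1 j t)
    · exact (mul_le_mul_of_nonneg_right e1 (abs_nonneg _)).trans (h2 j t)
  have hAD : ∀ m j t, |A m j t| ≤ D j t := fun m j t => by
    rw [hD]
    simp only
    rw [← div_eq_mul_inv, le_div_iff₀ (by positivity), hA]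
    simp only
    rw [abs_mul]
    have := mul_le_mul (hθK m t).1 (hu j t).2.1 (by positivity) hK
    nlinarith [mul_nonneg hK (hC0 j), mul_nonneg hK (hC1 j), mul_nonneg hK (hC2 j)]
  have hAD' : ∀ m j t, |t ^ 2 * A m j t - deriv (deriv (A m j)) t| ≤ D j t := fun m j t => by
    rw [hD]
    simp only
    rw [← div_eq_mul_inv, le_div_iff₀ (by positivity), hA]
    simp only
    rw [deriv_deriv_mul (hθ m) (contDiff_her _)]
    obtain ⟨k0, k1, k2⟩ := hθK m t
    obtain ⟨u0, u1, u2, u3⟩ := hu j t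
    have w : (0 : ℝ) ≤ 1 + t ^ 2 := by positivity
    have b0 := mul_le_mul k0 u0 (by positivity) hK
    have b1 := mul_le_mul k2 u1 (by positivity) hK
    have b2 := mul_le_mul k1 u2 (by positivity) hK
    have b3 := mul_le_mul k0 u3 (by positivity) hK
    have t1 : |t ^ 2 * (θ m t * her (n j) t) - (deriv (deriv (θ m)) t * her (n j) t +
        2 * (deriv (θ m) t * deriv (her (n j)) t) + θ m t * deriv (deriv (her (n j))) t)| ≤
        |θ m t| * (t ^ 2 * |her (n j) t|) + (|deriv (deriv (θ m)) t| * |her (n j) t| +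
        2 * (|deriv (θ m) t| * |deriv (her (n j)) t|) +
        |θ m t| * |deriv (deriv (her (n j))) t|) := by
      refine (abs_sub _ _).trans (add_le_add (le_of_eq ?_) ((abs_add_le _ _).trans
        (add_le_add ((abs_add_le _ _).trans (add_le_add ?_ ?_)) ?_)))
      · rw [abs_mul, abs_mul, abs_of_nonneg (sq_nonneg t)]; ring
      · rw [abs_mul]
      · rw [abs_mul, abs_mul, abs_two]
      · rw [abs_mul]
    have t2 := mul_le_mul_of_nonneg_right t1 w
    nlinarith
  have hlim : ∀ j t, ∀ᶠ m in Filter.atTop, A m j t = her (n j) t := fun j t => by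
    filter_upwards [hθ1 t] with m hm
    simp [hA, hm.eq_of_nhds]
  have hlim' : ∀ j t, ∀ᶠ m in Filter.atTop, t ^ 2 * A m j t - deriv (deriv (A m j)) t =
      (2 * n j + 1) * her (n j) t := fun j t => by
    filter_upwards [hθ1 t] with m hm
    have e : A m j =ᶠ[nhds t] her (n j) := by
      filter_upwards [hm] with s hs
      simp [hA, hs]
    rw [e.deriv.deriv_eq, e.eq_of_nhds, (hasDerivAt_deriv_her (n j) t).deriv]
    ring
  have hHf : Continuous (hermiteOp f) := by
    refine continuous_finsetSum _ fun j _ => .sub (.mul (by fun_prop) hf.continuous) ?_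
    exact (contDiff_pderiv (contDiff_pderiv hf j) j).continuous
  have L1 := tendsto_integral_mul_tensor hHf hC' (fun m j => (hAs m j).continuous) hDi hAD hlim
  have L2 : ∀ j : Fin d, Filter.Tendsto (fun m => ∫ x, f x * tensor (Function.update (A m) j
      fun t => t ^ 2 * A m j t - deriv (deriv (A m j)) t) x) Filter.atTop
      (nhds (∫ x, f x * tensor (Function.update (fun i => her (n i)) j
        fun t => (2 * n j + 1) * her (n j) t) x)) := fun j => by
    refine tendsto_integral_mul_tensor hf.continuous hC (fun m i => ?_) hDi (fun m i t => ?_)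
      fun i t => ?_
    · rcases eq_or_ne i j with rfl | hij
      · rw [Function.update_self]
        exact ((continuous_id.pow 2).mul (hAs m i).continuous).sub
          (contDiff_deriv_infty (contDiff_deriv_infty (hAs m i))).continuous
      · rw [Function.update_of_ne hij]; exact (hAs m i).continuous
    · rcases eq_or_ne i j with rfl | hij
      · rw [Function.update_self]; exact hAD' m i t
      · rw [Function.update_of_ne hij]; exact hAD m i t
    · rcases eq_or_ne i j with rfl | hij
      · simp only [Function.update_self]; exact hlim' i t
      · simp only [Function.update_of_ne hij]; exact hlim i t
  have L3 := tendsto_finsetSum Finset.univ fun j _ => L2 j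
  have e : ∀ m, ∫ x, hermiteOp f x * tensor (A m) x = ∑ j, ∫ x, f x * tensor (Function.update (A m) j
      fun t => t ^ 2 * A m j t - deriv (deriv (A m j)) t) x := fun m => by
    rw [integral_hermiteOp_mul hf (contDiff_tensor (hAs m)) (hasCompactSupport_tensor (hAc m))]
    refine Finset.sum_congr rfl fun j _ => ?_
    congr 1
    funext x
    rw [pderiv_pderiv_tensor (hAs m), tensor_update_left, tensor_update_left,
      tensor_eq_mul_erase _ j]
    push_cast
    ring
  have key := tendsto_nhds_unique (L1.congr e) L3
  refine key.trans ?_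
  have e2 : ∀ j : Fin d, ∫ x, f x * tensor (Function.update (fun i => her (n i)) j
        fun t => (2 * n j + 1) * her (n j) t) x = (2 * (n j : ℂ) + 1) * hermiteCoeff f n :=
    fun j => by
    rw [hermiteCoeff, ← integral_const_mul]
    congr 1
    funext x
    have : (hermiteFun n x : ℂ) = tensor (fun i => her (n i)) x := rfl
    rw [this, tensor_update_left, tensor_eq_mul_erase _ j]
    push_cast
    ring
  rw [Finset.sum_congr rfl fun j _ => e2 j, ← Finset.sum_mul, Finset.sum_add_distrib,
    ← Finset.mul_sum, len]
  simp


/-! ### Decay of the Hermite coefficients -/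

lemma contDiff_hermiteOp {f : (Fin d → ℝ) → ℂ} (hf : ContDiff ℝ ∞ f) :
    ContDiff ℝ ∞ (hermiteOp f) := by
  refine ContDiff.sum fun j _ => .sub (.mul ?_ hf) (contDiff_pderiv (contDiff_pderiv hf j) j)
  exact (Complex.ofRealCLM.contDiff.comp (contDiff_apply ℝ ℝ j)).pow 2

lemma hermiteCoeff_iterate_hermiteOp {f : (Fin d → ℝ) → ℂ} (hf : ContDiff ℝ ∞ f)
    (hC : ∀ N, ∃ C, ∀ x, ‖hermiteOp^[N] f x‖ ≤ C) (N : ℕ) (n : MultiIndex d) :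
    ContDiff ℝ ∞ (hermiteOp^[N] f) ∧
      hermiteCoeff (hermiteOp^[N] f) n = (2 * (len n : ℂ) + d) ^ N * hermiteCoeff f n := by
  induction N with
  | zero => simpa using hf
  | succ N ih =>
    obtain ⟨C, h⟩ := hC N
    obtain ⟨C', h'⟩ := hC (N + 1)
    rw [Function.iterate_succ_apply'] at h' ⊢
    refine ⟨contDiff_hermiteOp ih.1, ?_⟩
    rw [integral_hermiteOp_mul_hermiteFun ih.1 (C := max C C')
      (fun x => (h x).trans (le_max_left _ _)) (fun x => (h' x).trans (le_max_right _ _)), ih.2]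
    ring

lemma integrable_one_add_norm_pow_inv :
    Integrable fun x : Fin d → ℝ => ((1 + ‖x‖) ^ (d + 1))⁻¹ := by
  have := integrable_one_add_norm (μ := (volume : Measure (Fin d → ℝ))) (r := ((d + 1 : ℕ) : ℝ))
    (by simp)
  refine this.congr (.of_forall fun x => ?_)
  simp only
  rw [Real.rpow_neg (by positivity), Real.rpow_natCast]

lemma exists_integral_norm_hermiteFun_le : ∃ C : ℝ, 0 ≤ C ∧ ∃ p : ℕ, ∀ n : MultiIndex d,
    ∫ x, ‖(hermiteFun n x : ℂ)‖ ≤ C * ((len n : ℝ) + 1) ^ p := by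
  obtain ⟨C, hC, p, h⟩ := (tempFam_hermite (d := d)).2 (d + 1) 0
  refine ⟨C * ∫ x : Fin d → ℝ, ((1 + ‖x‖) ^ (d + 1))⁻¹,
    mul_nonneg hC (integral_nonneg fun x => by positivity), p, fun n => ?_⟩
  rw [mul_right_comm, ← integral_const_mul]
  refine integral_mono (integrable_hermiteFun n).norm
    (integrable_one_add_norm_pow_inv.const_mul _) fun x => ?_
  have := h n x trivial
  rw [norm_iteratedFDeriv_zero, mul_comm] at this
  simp only
  rw [← div_eq_mul_inv, le_div_iff₀ (by positivity)]
  exact this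

/-- By symmetry the coefficients of `H^N f` are `(2|n| + d)^N a_n`. They are bounded by the sup norm
of `H^N f` times the `L¹` norm of `h_n`, which grows only polynomially in `|n|`. -/
lemma MemH.expDecay_hermiteCoeff {α : ℝ} (hα : 0 < α) {f : (Fin d → ℝ) → ℂ}
    (hf : MemH (α / 2) f) : ExpDecay α (hermiteCoeff f) := by
  obtain ⟨hf, h, hh, C, hC, hle⟩ := hf
  rw [mul_div_cancel₀ α two_ne_zero] at hle
  obtain ⟨K, hK, q, hq⟩ := exists_integral_norm_hermiteFun_le (d := d)
  refine expDecay_of_pow_bound hα (C := C * K) (q := q) (by positivity) hh fun N n => ?_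
  have e := (hermiteCoeff_iterate_hermiteOp hf (fun N => ⟨_, hle N⟩) N n).2
  calc (len n : ℝ) ^ N * ‖hermiteCoeff f n‖
      ≤ ‖(2 * (len n : ℂ) + d) ^ N * hermiteCoeff f n‖ := by
        rw [norm_mul, norm_pow]
        have e1 : (2 * (len n : ℂ) + d) = ((2 * len n + d : ℕ) : ℂ) := by push_cast; rfl
        rw [e1, Complex.norm_natCast]
        gcongr
        omega
    _ ≤ ∫ x, C * h ^ N * (N ! : ℝ) ^ α * ‖(hermiteFun n x : ℂ)‖ := by
        rw [← e, hermiteCoeff]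
        refine norm_integral_le_of_norm_le ((integrable_hermiteFun n).norm.const_mul _)
          (.of_forall fun x => ?_)
        rw [norm_mul]
        exact mul_le_mul_of_nonneg_right (hle N x) (norm_nonneg _)
    _ ≤ C * h ^ N * (N ! : ℝ) ^ α * (K * ((len n : ℝ) + 1) ^ q) := by
        rw [integral_const_mul]
        exact mul_le_mul_of_nonneg_left (hq n) (by positivity)
    _ = _ := by ring

/-! ### Parity -/

lemma hermitePoly_neg (n : ℕ) (t : ℝ) : hermitePoly n (-t) = (-1) ^ n * hermitePoly n t := by
  induction n using Nat.twoStepInduction with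
  | zero => simp [hermitePoly_zero]
  | one => simp [hermitePoly_one]
  | more n h0 h1 => rw [hermitePoly_succ_succ, hermitePoly_succ_succ, h0, h1]; ring

lemma her_neg (n : ℕ) (t : ℝ) : her n (-t) = (-1) ^ n * her n t := by
  rw [her, her, hermitePoly_neg, neg_sq]; ring

/-- Reflection in a coordinate with odd index preserves `f` and the measure, and reverses the sign
of the Hermite function. -/
lemma hermiteCoeff_eq_zero_of_even {f : (Fin d → ℝ) → ℂ}
    (hf : ∀ (j : Fin d) (x : Fin d → ℝ), f (Function.update x j (-(x j))) = f x)
    {k : MultiIndex d} (hk : ¬ ∀ j, Even (k j)) : hermiteCoeff f k = 0 := by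
  push Not at hk
  obtain ⟨j, hj⟩ := hk
  set s : Fin d → ℝ → ℝ := fun i t => if i = j then -t else t with hs
  have hmp : MeasurePreserving fun (x : Fin d → ℝ) i => s i (x i) := by
    refine volume_preserving_pi fun i => ?_
    rcases eq_or_ne i j with rfl | hij
    · simpa [hs] using Measure.measurePreserving_neg (volume : Measure ℝ)
    · simpa [hs, hij, Function.id_def] using MeasurePreserving.id (volume : Measure ℝ)
  have hup : ∀ x : Fin d → ℝ, (fun i => s i (x i)) = Function.update x j (-(x j)) := fun x => by
    funext i
    rcases eq_or_ne i j with rfl | hij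
    · simp [hs]
    · simp [hs, hij]
  have hemb : MeasurableEmbedding fun (x : Fin d → ℝ) i => s i (x i) := by
    have hi : Function.Involutive fun (x : Fin d → ℝ) i => s i (x i) := fun x => by
      funext i
      rcases eq_or_ne i j with rfl | hij
      · simp [hs]
      · simp [hs, hij]
    exact MeasurableEquiv.measurableEmbedding ⟨hi.toPerm, hmp.measurable, hmp.measurable⟩
  have h := hmp.integral_comp hemb fun x => f x * (hermiteFun k x : ℂ)
  have h2 : ∀ x : Fin d → ℝ, (hermiteFun k (Function.update x j (-(x j))) : ℂ) =
      -(hermiteFun k x : ℂ) := fun x => by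
    have e : ∀ y : Fin d → ℝ, (hermiteFun k y : ℂ) = tensor (fun i => her (k i)) y := fun _ => rfl
    rw [e, e, tensor_update_right, tensor_eq_mul_erase _ j, her_neg,
      (Nat.not_even_iff_odd.1 hj).neg_one_pow]
    push_cast
    ring
  simp_rw [hup, hf, h2, mul_neg, integral_neg] at h
  change -hermiteCoeff f k = hermiteCoeff f k at h
  exact self_eq_neg.1 h.symm

/-! ### Exponential decay along the even multi-indices -/

lemma len_two_nsmul (n : MultiIndex d) : len (2 • n) = 2 * len n := by
  simp [len, Finset.mul_sum]

lemma ExpDecay.comp_two_nsmul {α : ℝ} (hα : 0 < α) {a : MultiIndex d → ℂ} (ha : ExpDecay α a) :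
    ExpDecay α fun n => a (2 • n) := by
  obtain ⟨h, hh, C, hC, hle⟩ := ha
  refine ⟨h, hh, C, hC, fun n => (hle _).trans ?_⟩
  gcongr
  rw [len_two_nsmul]
  omega

lemma ExpDecay.of_two_nsmul {α : ℝ} (hα : 0 < α) {b : MultiIndex d → ℂ}
    (h0 : ∀ k : MultiIndex d, (¬ ∀ j, Even (k j)) → b k = 0)
    (hb : ExpDecay α fun n => b (2 • n)) : ExpDecay α b := by
  obtain ⟨h, hh, C, hC, hle⟩ := hb
  -- The loss `2^{1/α}` comes from `|2n| + 1 ≤ 2(|n| + 1)`.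
  refine ⟨h / 2 ^ (1 / α), by positivity, C, hC, fun k => ?_⟩
  by_cases hk : ∀ j, Even (k j)
  · obtain ⟨n, rfl⟩ : ∃ n : MultiIndex d, k = 2 • n := ⟨fun j => k j / 2, by
      funext j
      simpa using (Nat.two_mul_div_two_of_even (hk j)).symm⟩
    refine (hle n).trans ?_
    refine mul_le_mul_of_nonneg_left (Real.exp_le_exp.2 (neg_le_neg ?_)) hC
    rw [div_mul_eq_mul_div, mul_div_assoc, ← Real.div_rpow (by positivity) (by norm_num)]
    gcongr
    rw [len_two_nsmul]
    push_cast
    linarith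
  · rw [h0 k hk, norm_zero]
    positivity


/-! ### Rapidly decreasing smooth functions on the orthant -/

/-- Smooth functions on the open orthant all of whose derivatives grow at most polynomially. -/
def TemperateOrthant (f : (Fin d → ℝ) → ℂ) : Prop :=
  ContDiffOn ℝ ∞ f (orthant d) ∧ ∀ m : ℕ, ∃ k : ℕ, ∃ C : ℝ, 0 ≤ C ∧ ∀ x ∈ orthant d,
    ‖iteratedFDeriv ℝ m f x‖ ≤ C * (1 + ‖x‖) ^ k

/-- Smooth functions on the open orthant all of whose derivatives decrease rapidly. -/
def RapidOrthant (f : (Fin d → ℝ) → ℂ) : Prop :=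
  ContDiffOn ℝ ∞ f (orthant d) ∧ ∀ k m : ℕ, ∃ C : ℝ, 0 ≤ C ∧ ∀ x ∈ orthant d,
    (1 + ‖x‖) ^ k * ‖iteratedFDeriv ℝ m f x‖ ≤ C

lemma MemSchwartzOrthant.rapidOrthant {f : (Fin d → ℝ) → ℂ} (hf : MemSchwartzOrthant f) :
    RapidOrthant f := by
  refine ⟨hf.smooth, fun k m => ?_⟩
  obtain ⟨C0, h0⟩ := hf.decay 0 m
  obtain ⟨C, h⟩ := hf.decay k m
  refine ⟨max 0 (2 ^ (k - 1) * (C0 + C)), le_max_left _ _, fun x hx => le_max_of_le_right ?_⟩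
  have h1 := h0 x hx
  have h2 := h x hx
  rw [pow_zero, one_mul] at h1
  calc _ ≤ 2 ^ (k - 1) * (1 ^ k + ‖x‖ ^ k) * ‖iteratedFDeriv ℝ m f x‖ := by
        gcongr
        exact add_pow_le zero_le_one (norm_nonneg x) k
    _ = 2 ^ (k - 1) * (‖iteratedFDeriv ℝ m f x‖ + ‖x‖ ^ k * ‖iteratedFDeriv ℝ m f x‖) := by ring
    _ ≤ _ := by gcongr

lemma TempFam.rapidOrthant {F : MultiIndex d → (Fin d → ℝ) → ℂ}
    (hF : TempFam (closedOrthant d) F) (n : MultiIndex d) : RapidOrthant (F n) := by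
  refine ⟨(hF.1 n).contDiffOn, fun k m => ?_⟩
  obtain ⟨C, hC, p, h⟩ := hF.2 k m
  exact ⟨C * ((len n : ℝ) + 1) ^ p, by positivity,
    fun x hx => h n x (orthant_subset_closedOrthant hx)⟩

lemma _root_.Function.HasTemperateGrowth.temperateOrthant {f : (Fin d → ℝ) → ℂ}
    (hf : f.HasTemperateGrowth) : TemperateOrthant f := by
  refine ⟨hf.1.contDiffOn, fun m => ?_⟩
  obtain ⟨k, C, hC, h⟩ := hf.norm_iteratedFDeriv_le_uniform m
  exact ⟨k, C, hC, fun x _ => h m le_rfl x⟩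

namespace RapidOrthant

variable {f g : (Fin d → ℝ) → ℂ}

lemma temperate (hf : RapidOrthant f) : TemperateOrthant f := by
  refine ⟨hf.1, fun m => ?_⟩
  obtain ⟨C, hC, h⟩ := hf.2 0 m
  exact ⟨0, C, hC, by simpa using h⟩

lemma contDiffAt (hf : RapidOrthant f) {x : Fin d → ℝ} (hx : x ∈ orthant d) :
    ContDiffAt ℝ ∞ f x := hf.1.contDiffAt (isOpen_orthant.mem_nhds hx)

lemma exists_norm_le (hf : RapidOrthant f) (k : ℕ) : ∃ C : ℝ, 0 ≤ C ∧ ∀ x ∈ orthant d,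
    (1 + ‖x‖) ^ k * ‖f x‖ ≤ C := by
  simpa using hf.2 k 0

lemma pderiv (hf : RapidOrthant f) (j : Fin d) : RapidOrthant (pderiv j f) := by
  set L : ((Fin d → ℝ) →L[ℝ] ℂ) →L[ℝ] ℂ :=
    ContinuousLinearMap.apply ℝ ℂ (Pi.single j (1 : ℝ) : Fin d → ℝ)
  have hd : ContDiffOn ℝ ∞ (fderiv ℝ f) (orthant d) :=
    hf.1.fderiv_of_isOpen isOpen_orthant le_rfl
  refine ⟨L.contDiff.comp_contDiffOn hd, fun k m => ?_⟩
  obtain ⟨C, hC, h⟩ := hf.2 k (m + 1)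
  refine ⟨‖L‖ * C, by positivity, fun x hx => ?_⟩
  have h1 := L.norm_iteratedFDeriv_comp_left (f := fderiv ℝ f) (x := x) (N := ∞) (n := m)
    (hd.contDiffAt (isOpen_orthant.mem_nhds hx)) (natCast_le_infty m)
  rw [norm_iteratedFDeriv_fderiv] at h1
  calc _ ≤ (1 + ‖x‖) ^ k * (‖L‖ * ‖iteratedFDeriv ℝ (m + 1) f x‖) := by gcongr; exact h1
    _ = ‖L‖ * ((1 + ‖x‖) ^ k * ‖iteratedFDeriv ℝ (m + 1) f x‖) := by ring
    _ ≤ _ := by gcongr; exact h x hx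

lemma temperate_mul (hf : RapidOrthant f) (hg : TemperateOrthant g) :
    RapidOrthant fun x => g x * f x := by
  refine ⟨hg.1.mul hf.1, fun k m => ?_⟩
  choose p K hK hp using hg.2
  choose C hC h using fun i => hf.2 (p i + k) (m - i)
  refine ⟨∑ i ∈ Finset.range (m + 1), (m.choose i : ℝ) * (K i * C i),
    Finset.sum_nonneg fun i _ => by have := hK i; have := hC i; positivity, fun x hx => ?_⟩
  have h1 := norm_iteratedFDerivWithin_mul_le hg.1 hf.1 isOpen_orthant.uniqueDiffOn hx
    (natCast_le_infty m)
  simp only [iteratedFDerivWithin_of_isOpen _ isOpen_orthant hx] at h1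
  refine (mul_le_mul_of_nonneg_left h1 (by positivity)).trans ?_
  rw [Finset.mul_sum]
  refine Finset.sum_le_sum fun i _ => ?_
  calc _ ≤ (1 + ‖x‖) ^ k * (m.choose i * (K i * (1 + ‖x‖) ^ p i) *
        ‖iteratedFDeriv ℝ (m - i) f x‖) := by gcongr; exact hp i x hx
    _ = m.choose i * (K i * ((1 + ‖x‖) ^ (p i + k) * ‖iteratedFDeriv ℝ (m - i) f x‖)) := by ring
    _ ≤ _ := by have := hK i; gcongr; exact h i x hx

lemma add (hf : RapidOrthant f) (hg : RapidOrthant g) : RapidOrthant fun x => f x + g x := by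
  refine ⟨hf.1.add hg.1, fun k m => ?_⟩
  obtain ⟨C, hC, h⟩ := hf.2 k m
  obtain ⟨D, hD, h'⟩ := hg.2 k m
  refine ⟨C + D, by positivity, fun x hx => ?_⟩
  rw [show (fun x => f x + g x) = f + g from rfl, iteratedFDeriv_add_apply ((hf.contDiffAt hx).of_le (natCast_le_infty m))
    ((hg.contDiffAt hx).of_le (natCast_le_infty m))]
  calc _ ≤ (1 + ‖x‖) ^ k * (‖iteratedFDeriv ℝ m f x‖ + ‖iteratedFDeriv ℝ m g x‖) := by
        gcongr; exact norm_add_le _ _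
    _ ≤ _ := by rw [mul_add]; exact add_le_add (h x hx) (h' x hx)

lemma const_mul (hf : RapidOrthant f) (c : ℂ) : RapidOrthant fun x => c * f x :=
  hf.temperate_mul (Function.HasTemperateGrowth.const c).temperateOrthant

lemma coord_mul (hf : RapidOrthant f) (j : Fin d) : RapidOrthant fun x => (x j : ℂ) * f x :=
  hf.temperate_mul (Function.HasTemperateGrowth.temperateOrthant
    (f := fun x : Fin d → ℝ => (x j : ℂ)) (Complex.ofRealCLM.comp
      (ContinuousLinearMap.proj j : (Fin d → ℝ) →L[ℝ] ℝ)).hasTemperateGrowth)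

lemma sum {F : Fin d → (Fin d → ℝ) → ℂ} (hF : ∀ j, RapidOrthant (F j)) (s : Finset (Fin d)) :
    RapidOrthant fun x => ∑ j ∈ s, F j x := by
  induction s using Finset.induction_on with
  | empty =>
    simp only [Finset.sum_empty]
    refine ⟨contDiffOn_const, fun k m => ⟨0, le_rfl, fun x _ => ?_⟩⟩
    have : iteratedFDeriv ℝ m (fun _ : Fin d → ℝ => (0 : ℂ)) x = 0 :=
      congrFun iteratedFDeriv_fun_zero x
    simp [this]
  | insert j s hj ih => simpa only [Finset.sum_insert hj] using (hF j).add ih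

lemma integrableOn (hf : RapidOrthant f) : IntegrableOn f (orthant d) := by
  obtain ⟨C, hC, h⟩ := hf.exists_norm_le (d + 1)
  refine (integrable_one_add_norm_pow_inv.const_mul C).integrableOn.mono'
    (hf.1.continuousOn.aestronglyMeasurable measurableSet_orthant) ?_
  filter_upwards [ae_restrict_mem measurableSet_orthant] with x hx
  rw [← div_eq_mul_inv, le_div_iff₀ (by positivity), mul_comm]
  exact h x hx

lemma laguerreOp (hf : RapidOrthant f) : RapidOrthant (laguerreOp f) := by
  have := (RapidOrthant.sum (fun j => (((hf.pderiv j).pderiv j).coord_mul j).add ((hf.pderiv j).add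
    (((hf.coord_mul j).const_mul (-1 / 4)).add (hf.const_mul (1 / 2))))) Finset.univ).const_mul (-1)
  convert this using 2 with x
  rw [PilipovicOrthant.laguerreOp, neg_one_mul]
  congr 1
  exact Finset.sum_congr rfl fun j _ => by ring

lemma laguerreOp_iterate (hf : RapidOrthant f) (N : ℕ) :
    RapidOrthant (PilipovicOrthant.laguerreOp^[N] f) := by
  induction N with
  | zero => exact hf
  | succ N ih => rw [Function.iterate_succ_apply']; exact ih.laguerreOp

end RapidOrthant

/-! ### Symmetry of the Laguerre operator -/

lemma hasDerivAt_coord (j : Fin d) (x : Fin d → ℝ) :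
    HasDerivAt (fun t : ℝ => ((Function.update x j t j : ℝ) : ℂ)) 1 (x j) := by
  simpa using (hasDerivAt_id (x j)).ofReal_comp

lemma pderiv_mul {f g : (Fin d → ℝ) → ℂ} {x : Fin d → ℝ} (hf : DifferentiableAt ℝ f x)
    (hg : DifferentiableAt ℝ g x) (j : Fin d) :
    pderiv j (fun x => f x * g x) x = pderiv j f x * g x + f x * pderiv j g x := by
  simp only [pderiv]
  rw [fderiv_fun_mul hf hg]
  simp only [add_apply, smul_apply, smul_eq_mul]
  ring

/-- Fubini and the fundamental theorem of calculus in the `j`-th variable. The factor `x_j` kills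
the boundary term at `0`, for which boundedness of `U` in the open orthant is enough; rapid decay
kills the one at infinity. -/
lemma integral_pderiv_coord_mul {U : (Fin d → ℝ) → ℂ} (hU : RapidOrthant U) (j : Fin d) :
    ∫ x in orthant d, pderiv j (fun x => (x j : ℂ) * U x) x = 0 := by
  obtain _ | d := d
  · exact j.elim0
  set V : (Fin (d + 1) → ℝ) → ℂ := fun x => (x j : ℂ) * U x with hV
  have hVr : RapidOrthant V := hU.coord_mul j
  have hint := (hVr.pderiv j).integrableOn
  obtain ⟨C, hC, hb⟩ := hU.exists_norm_le 2
  set e := MeasurableEquiv.piFinSuccAbove (fun _ : Fin (d + 1) => ℝ) j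
  have hmp := (measurePreserving_piFinSuccAbove
    (fun _ : Fin (d + 1) => (volume : Measure ℝ).restrict (Set.Ioi 0)) j).symm e
  rw [IntegrableOn, restrict_orthant, ← hmp.integrable_comp_emb e.symm.measurableEmbedding] at hint
  rw [restrict_orthant, ← hmp.integral_comp e.symm.measurableEmbedding,
    integral_prod_symm (fun z => pderiv j V (e.symm z)) hint]
  refine integral_eq_zero_of_ae ?_
  have hy : ∀ᵐ y ∂(Measure.pi fun _ : Fin d => (volume : Measure ℝ).restrict (Set.Ioi 0)),
      y ∈ orthant d := by
    rw [← restrict_orthant]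
    exact ae_restrict_mem measurableSet_orthant
  filter_upwards [hint.prod_left_ae, hy] with y hyi hy
  have hmem : ∀ t : ℝ, 0 < t → (j.insertNth t y : Fin (d + 1) → ℝ) ∈ orthant (d + 1) :=
    fun t ht i => by
    rcases Fin.eq_self_or_eq_succAbove j i with rfl | ⟨k, rfl⟩
    · simpa using ht
    · simpa using hy k
  have hVt : ∀ t : ℝ, V (j.insertNth t y) = (t : ℂ) * U (j.insertNth t y) := fun t => by
    simp [hV]
  have hnorm : ∀ t : ℝ, 0 < t → t ≤ ‖(j.insertNth t y : Fin (d + 1) → ℝ)‖ := fun t ht => by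
    have := norm_le_pi_norm (j.insertNth t y : Fin (d + 1) → ℝ) j
    rw [Fin.insertNth_apply_same, Real.norm_of_nonneg ht.le] at this
    exact this
  have hb1 : ∀ t : ℝ, 0 < t → ‖V (j.insertNth t y)‖ ≤ C * t := fun t ht => by
    rw [hVt, norm_mul, Complex.norm_real, Real.norm_of_nonneg ht.le, mul_comm]
    refine mul_le_mul_of_nonneg_right (le_trans ?_ (hb _ (hmem t ht))) ht.le
    refine le_mul_of_one_le_left (norm_nonneg _) (one_le_pow₀ ?_)
    linarith [norm_nonneg (j.insertNth t y : Fin (d + 1) → ℝ)]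
  have hb2 : ∀ t : ℝ, 0 < t → ‖V (j.insertNth t y)‖ ≤ C / t := fun t ht => by
    rw [hVt, norm_mul, Complex.norm_real, Real.norm_of_nonneg ht.le, le_div_iff₀ ht]
    refine le_trans ?_ (hb _ (hmem t ht))
    rw [mul_right_comm, ← pow_two]
    gcongr
    linarith [hnorm t ht]
  have key := integral_Ioi_of_hasDerivAt_of_tendsto (a := 0) (m := 0)
    (f := fun t => V (j.insertNth t y)) (f' := fun t => pderiv j V (j.insertNth t y)) ?_ ?_ hyi ?_
  · refine key.trans ?_
    simp [hVt]
  -- At `t = 0` the product is zero whatever value `U` takes outside the open orthant, and the bound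
  -- `C t` gives continuity from the right.
  · rw [ContinuousWithinAt, hVt, Complex.ofReal_zero, zero_mul]
    refine squeeze_zero_norm' (a := fun t => C * |t|) ?_ ?_
    · filter_upwards [self_mem_nhdsWithin] with t ht
      rcases (show (0 : ℝ) ≤ t from ht).eq_or_lt with rfl | ht
      · simp [hVt]
      · rw [abs_of_pos ht]; exact hb1 t ht
    · have : Continuous fun t : ℝ => C * |t| := by fun_prop
      simpa using (this.tendsto 0).mono_left nhdsWithin_le_nhds
  · intro t ht
    have := hasDerivAt_comp_update
      ((hVr.contDiffAt (hmem t ht)).differentiableAt (by simp)) j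
    simpa only [Fin.insertNth_apply_same, Fin.update_insertNth] using this
  · refine squeeze_zero_norm' (a := fun t => C / t) ?_ (tendsto_const_nhds.div_atTop Filter.tendsto_id)
    filter_upwards [Filter.eventually_gt_atTop 0] with t ht using hb2 t ht

/-- Lagrange's identity: `E f · g - f · E g` is the divergence `-∑ ∂_j (x_j (∂_j f · g - f · ∂_j
g))`, whose integral vanishes by `integral_pderiv_coord_mul`. -/
lemma integral_laguerreOp_mul {f g : (Fin d → ℝ) → ℂ} (hf : RapidOrthant f) (hg : RapidOrthant g) :
    ∫ x in orthant d, laguerreOp f x * g x = ∫ x in orthant d, f x * laguerreOp g x := by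
  have hfg : RapidOrthant fun x => laguerreOp f x * g x := hg.temperate_mul hf.laguerreOp.temperate
  have hfg' : RapidOrthant fun x => f x * laguerreOp g x := hg.laguerreOp.temperate_mul hf.temperate
  set U : Fin d → (Fin d → ℝ) → ℂ := fun j x => pderiv j f x * g x + -1 * (f x * pderiv j g x)
  have hU : ∀ j, RapidOrthant (U j) := fun j =>
    (hg.temperate_mul (hf.pderiv j).temperate).add
      (((hg.pderiv j).temperate_mul hf.temperate).const_mul (-1))
  have hd : ∀ {u : (Fin d → ℝ) → ℂ}, RapidOrthant u → ∀ x ∈ orthant d, DifferentiableAt ℝ u x :=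
    fun hu x hx => (hu.contDiffAt hx).differentiableAt (by simp)
  rw [← sub_eq_zero, ← integral_sub hfg.integrableOn hfg'.integrableOn]
  have e : Set.EqOn (fun x => laguerreOp f x * g x - f x * laguerreOp g x)
      (fun x => -∑ j, pderiv j (fun x => (x j : ℂ) * U j x) x) (orthant d) := fun x hx => by
    have e1 : ∀ j, pderiv j (fun x => (x j : ℂ) * U j x) x = U j x + (x j : ℂ) *
        (pderiv j (pderiv j f) x * g x - f x * pderiv j (pderiv j g) x) := fun j => by
      have hx1 : DifferentiableAt ℝ (fun x : Fin d → ℝ => (x j : ℂ)) x := by fun_prop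
      have hx2 : pderiv j (fun x : Fin d → ℝ => (x j : ℂ)) x = 1 :=
        (hasDerivAt_comp_update hx1 j).unique (hasDerivAt_coord j x)
      have a1 := hd hf x hx
      have a2 := hd hg x hx
      have a3 := hd (hf.pderiv j) x hx
      have a4 := hd (hg.pderiv j) x hx
      have hx3 : pderiv j (U j) x = pderiv j (pderiv j f) x * g x -
          f x * pderiv j (pderiv j g) x := by
        have h1 := pderiv_mul a3 a2 j
        have h2 := pderiv_mul a1 a4 j
        have h3 := hasDerivAt_comp_update (a3.fun_mul a2) j
        have h4 := hasDerivAt_comp_update (a1.fun_mul a4) j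
        have h5 := h3.add (h4.const_mul (-1))
        have h6 := hasDerivAt_comp_update (hd (hU j) x hx) j
        rw [h6.unique h5, h1, h2]
        ring
      rw [pderiv_mul hx1 (hd (hU j) x hx), hx2, hx3, one_mul]
    simp only [e1, laguerreOp, neg_mul, mul_neg, Finset.sum_mul, Finset.mul_sum]
    rw [← neg_add', ← sub_eq_add_neg, ← Finset.sum_sub_distrib]
    congr 1
    refine Finset.sum_congr rfl fun j _ => ?_
    simp only [U]
    ring
  rw [setIntegral_congr_fun measurableSet_orthant e, integral_neg,
    integral_finsetSum _ fun j _ => (((hU j).coord_mul j).pderiv j).integrableOn,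
    Finset.sum_eq_zero fun j _ => integral_pderiv_coord_mul (hU j) j, neg_zero]

lemma laguerreCoeff_iterate_laguerreOp {f : (Fin d → ℝ) → ℂ} (hf : RapidOrthant f) (N : ℕ)
    (n : MultiIndex d) :
    laguerreCoeff (laguerreOp^[N] f) n = (len n : ℂ) ^ N * laguerreCoeff f n := by
  induction N with
  | zero => simp
  | succ N ih =>
    rw [Function.iterate_succ_apply', laguerreCoeff,
      integral_laguerreOp_mul (hf.laguerreOp_iterate N) (tempFam_laguerre.rapidOrthant n),
      laguerreOp_laguerreFun, pow_succ', mul_assoc, ← ih, laguerreCoeff, ← integral_const_mul]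
    congr 1
    funext x
    ring

lemma eLpNorm_laguerreFun (n : MultiIndex d) :
    eLpNorm (fun x => (laguerreFun n x : ℂ)) 2 (volume.restrict (orthant d)) = 1 := by
  have h := tempFam_laguerre.rapidOrthant n
  have hm : AEStronglyMeasurable (fun x => (laguerreFun n x : ℂ)) (volume.restrict (orthant d)) :=
    h.1.continuousOn.aestronglyMeasurable measurableSet_orthant
  have e : ∀ x : Fin d → ℝ, (laguerreFun n x : ℂ) * (laguerreFun n x : ℂ) =
      ((‖(laguerreFun n x : ℂ)‖ ^ (2 : ℝ) : ℝ) : ℂ) := fun x => by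
    rw [Complex.norm_real, Real.rpow_two, Real.norm_eq_abs, sq_abs]
    push_cast
    ring
  have h1 := integral_laguerreFun_mul n n
  rw [if_pos rfl] at h1
  simp_rw [e, integral_complex_ofReal] at h1
  have hL : MemLp (fun x => (laguerreFun n x : ℂ)) 2 (volume.restrict (orthant d)) := by
    rw [memLp_two_iff_integrable_sq_norm hm]
    refine (h.temperate_mul h.temperate).integrableOn.norm.congr (.of_forall fun x => ?_)
    simp only
    rw [norm_mul, pow_two]
  rw [hL.eLpNorm_eq_integral_rpow_norm two_ne_zero ENNReal.ofNat_ne_top]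
  simp only [ENNReal.toReal_ofNat]
  rw [show ∫ x in orthant d, ‖(laguerreFun n x : ℂ)‖ ^ (2 : ℝ) = 1 by exact_mod_cast h1]
  simp

lemma enorm_laguerreCoeff_le {f : (Fin d → ℝ) → ℂ} (hf : RapidOrthant f) (n : MultiIndex d) :
    ‖laguerreCoeff f n‖ₑ ≤ eLpNorm f 2 (volume.restrict (orthant d)) := by
  have m1 : AEStronglyMeasurable f (volume.restrict (orthant d)) :=
    hf.1.continuousOn.aestronglyMeasurable measurableSet_orthant
  have m2 : AEStronglyMeasurable (fun x => (laguerreFun n x : ℂ)) (volume.restrict (orthant d)) :=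
    (tempFam_laguerre.1 n).continuous.aestronglyMeasurable
  calc _ ≤ ∫⁻ x in orthant d, ‖f x * (laguerreFun n x : ℂ)‖ₑ :=
        enorm_integral_le_lintegral_enorm _
    _ = eLpNorm (f • fun x => (laguerreFun n x : ℂ)) 1 (volume.restrict (orthant d)) := by
        rw [eLpNorm_one_eq_lintegral_enorm]; rfl
    _ ≤ eLpNorm f 2 (volume.restrict (orthant d)) *
        eLpNorm (fun x => (laguerreFun n x : ℂ)) 2 (volume.restrict (orthant d)) :=
        eLpNorm_smul_le_mul_eLpNorm m2 m1
    _ = _ := by rw [eLpNorm_laguerreFun, mul_one]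

/-- Symmetry gives `|n|^N a_n` as the coefficient of `E^N f`, and Cauchy–Schwarz with `l_n` of norm
one bounds it by the `L²` norm. No polynomial loss occurs, hence `q = 0`. -/
lemma MemG.expDecay_laguerreCoeff {α : ℝ} (hα : 0 < α) {f : (Fin d → ℝ) → ℂ}
    (hf : MemG α f) : ExpDecay α (laguerreCoeff f) := by
  obtain ⟨hf, h, hh, C, hle⟩ := hf
  have hr := hf.rapidOrthant
  refine expDecay_of_pow_bound hα (C := max C 0) (q := 0) (le_max_right _ _) hh fun N n => ?_
  rw [pow_zero, mul_one]
  have e1 := (enorm_laguerreCoeff_le (hr.laguerreOp_iterate N) n).trans (hle N)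
  rw [laguerreCoeff_iterate_laguerreOp hr, ← ofReal_norm, norm_mul, norm_pow,
    Complex.norm_natCast] at e1
  refine (ENNReal.ofReal_le_ofReal_iff (by positivity)).1 (e1.trans (ENNReal.ofReal_le_ofReal ?_))
  gcongr
  exact le_max_left _ _


/-! ### Composition with the quadratic maps -/

lemma two_nsmul_injective : Function.Injective fun n : MultiIndex d => 2 • n := fun m m' hm => by
  funext j
  simpa using congrFun hm j

lemma exists_eq_two_nsmul {k : MultiIndex d} (hk : ∀ j, Even (k j)) :
    ∃ n : MultiIndex d, 2 • n = k := ⟨fun j => k j / 2, by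
  funext j
  simpa using Nat.two_mul_div_two_of_even (hk j)⟩

lemma evenPart_eq_self {b : MultiIndex d → ℂ}
    (h0 : ∀ k : MultiIndex d, (¬ ∀ j, Even (k j)) → b k = 0) : evenPart b = b := by
  classical
  funext k
  rw [evenPart]
  split_ifs with hk
  · rfl
  · exact (h0 k hk).symm

lemma hasSum_two_nsmul {b : MultiIndex d → ℂ}
    (h0 : ∀ k : MultiIndex d, (¬ ∀ j, Even (k j)) → b k = 0) {u : MultiIndex d → ℂ} {S : ℂ}
    (h : HasSum (fun n => b n * u n) S) : HasSum (fun n => b (2 • n) * u (2 • n)) S := by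
  refine (two_nsmul_injective.hasSum_iff fun k hk => ?_).2 h
  rw [h0 k fun hk' => hk (exists_eq_two_nsmul hk'), zero_mul]

lemma vMap_update (j : Fin d) (x : Fin d → ℝ) :
    vMap (Function.update x j (-(x j))) = vMap x := by
  funext i
  rcases eq_or_ne i j with rfl | hij
  · simp [vMap]
  · simp [vMap, hij]

/-- The expansion of a function in `𝐆^α_α` with respect to the Laguerre functions. -/
lemma MemG.hasSum_laguerre {α : ℝ} (hα : 0 < α) {f : (Fin d → ℝ) → ℂ} (hf : MemG α f)
    {x : Fin d → ℝ} (hx : x ∈ closedOrthant d) :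
    HasSum (fun n => laguerreCoeff f n * (laguerreFun n x : ℂ)) (f x) := by
  obtain ⟨C, hC⟩ := hf.1.decay 0 0
  exact PilipovicOrthant.hasSum_laguerre hf.1.cont (C := C) (fun x hx => by simpa using hC x hx)
    ((hf.expDecay_laguerreCoeff hα).rapid hα) hx

/-- The expansion of a function in `𝓗_{α/2}` with respect to the Hermite functions. -/
lemma MemH.hasSum_hermite {α : ℝ} (hα : 0 < α) {f : (Fin d → ℝ) → ℂ} (hf : MemH (α / 2) f)
    (x : Fin d → ℝ) : HasSum (fun n => hermiteCoeff f n * (hermiteFun n x : ℂ)) (f x) := by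
  obtain ⟨h, hh, C, hC, hle⟩ := hf.2
  exact PilipovicOrthant.hasSum_hermite hf.1.continuous (C := C)
    (fun x => by simpa using hle 0 x) ((hf.expDecay_hermiteCoeff hα).rapid hα) x

section Laguerre

variable {α : ℝ} {f : (Fin d → ℝ) → ℂ}

lemma MemG.eqOn_tsum (hα : 0 < α) (hf : MemG α f) : Set.EqOn f
    (fun x => ∑' n, laguerreCoeff f n * (laguerreFun n x : ℂ)) (closedOrthant d) :=
  fun _ hx => (hf.hasSum_laguerre hα hx).tsum_eq.symm

lemma MemG.hermiteCoeff_comp_vMap_of_odd (hα : 0 < α) (hf : MemG α f) (k : MultiIndex d)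
    (hk : ¬ ∀ j, Even (k j)) : hermiteCoeff (f ∘ vMap) k = 0 :=
  PilipovicOrthant.hermiteCoeff_comp_vMap_of_odd ((hf.expDecay_laguerreCoeff hα).rapid hα)
    (hf.eqOn_tsum hα) hk

lemma MemG.hasSum_hermiteCoeff_comp_vMap (hα : 0 < α) (hf : MemG α f) (n : MultiIndex d) :
    HasSum (fun k => (((∏ j, connCoeff (k j)) * ∏ j, evenRatio (n j) : ℝ) : ℂ) *
      laguerreCoeff f (k + n)) (hermiteCoeff (f ∘ vMap) (2 • n)) := by
  simpa only [mul_comm] using hasSum_hermiteCoeff_comp_vMap_even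
    ((hf.expDecay_laguerreCoeff hα).rapid hα) (hf.eqOn_tsum hα) n

lemma MemG.expDecay_hermiteCoeff_comp_vMap (hα : 0 < α) (hf : MemG α f) :
    ExpDecay α (hermiteCoeff (f ∘ vMap)) := by
  refine ExpDecay.of_two_nsmul hα (hf.hermiteCoeff_comp_vMap_of_odd hα) ?_
  -- Each coordinate contributes a factor of absolute value at most `1 · 2`, so the coefficients are
  -- bounded by `2^d` without growth.
  have h := ((hf.expDecay_laguerreCoeff hα).conv hα (K := 2 ^ d) (p := 0)
    (c := fun n k => (((∏ j, connCoeff (k j)) * ∏ j, evenRatio (n j) : ℝ) : ℂ)) fun n k => ?_).2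
  · simpa only [(hf.hasSum_hermiteCoeff_comp_vMap hα _).tsum_eq] using h
  · rw [pow_zero, mul_one, ← Finset.prod_mul_distrib, Complex.norm_real, norm_prod]
    refine (Finset.prod_le_prod (fun _ _ => norm_nonneg _) (g := fun _ => (2 : ℝ)) fun j _ => ?_).trans
      (by simp)
    rw [norm_mul, Real.norm_eq_abs, Real.norm_eq_abs]
    exact (mul_le_mul (abs_connCoeff_le _) (abs_evenRatio_le _) (abs_nonneg _) zero_le_one).trans
      (by norm_num)

lemma MemG.hasSum_hermite_comp_vMap (hα : 0 < α) (hf : MemG α f) (x : Fin d → ℝ) :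
    HasSum (fun n => hermiteCoeff (f ∘ vMap) n * (hermiteFun n x : ℂ)) (f (vMap x)) := by
  obtain ⟨u, hu, hb⟩ := (tempFam_laguerre.smoothSummable
    ((hf.expDecay_laguerreCoeff hα).rapid hα)).bound 0
  refine PilipovicOrthant.hasSum_hermite (f := f ∘ vMap)
    (continuousOn_univ.1 (hf.1.cont.comp continuous_vMap.continuousOn
      fun x _ => vMap_mem_closedOrthant x)) (C := ∑' n, u n) (fun x => ?_)
    ((hf.expDecay_hermiteCoeff_comp_vMap hα).rapid hα) x
  rw [Function.comp_apply, hf.eqOn_tsum hα (vMap_mem_closedOrthant x)]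
  exact tsum_of_norm_bounded hu.hasSum fun n => by
    simpa using hb n _ (vMap_mem_closedOrthant x)

lemma MemG.memHEven_comp_vMap (hα : 0 < α) (hf : MemG α f) : MemHEven (α / 2) (f ∘ vMap) :=
  ⟨memH_of_expDecay hα (hf.expDecay_hermiteCoeff_comp_vMap hα)
    fun x => (hf.hasSum_hermite_comp_vMap hα x).tsum_eq.symm,
    fun j x => by simp only [Function.comp_apply, vMap_update]⟩

end Laguerre

section Hermite

variable {α : ℝ} {f : (Fin d → ℝ) → ℂ}

lemma MemHEven.hasSum_laguerreCoeff_comp_wMap (hα : 0 < α) (hf : MemHEven (α / 2) f)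
    (n : MultiIndex d) :
    HasSum (fun k => ((∏ j, (evenRatio (k j + n j))⁻¹ * connCoeffInv (k j) : ℝ) : ℂ) *
      hermiteCoeff f (2 • (k + n))) (laguerreCoeff (f ∘ wMap) n) := by
  simpa only [mul_comm] using PilipovicOrthant.hasSum_laguerreCoeff_comp_wMap
    ((hf.1.expDecay_hermiteCoeff hα).rapid hα) (fun k hk => hermiteCoeff_eq_zero_of_even hf.2 hk)
    (fun x => (hf.1.hasSum_hermite hα x).tsum_eq.symm) n

lemma MemHEven.expDecay_laguerreCoeff_comp_wMap (hα : 0 < α) (hf : MemHEven (α / 2) f) :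
    ExpDecay α (laguerreCoeff (f ∘ wMap)) := by
  -- The inverse ratios grow at most like `2m + 1 ≤ 2(m + 1)` in each coordinate, whence the
  -- exponent `p = d`.
  have h := (((hf.1.expDecay_hermiteCoeff hα).comp_two_nsmul hα).conv hα (K := 2 ^ d) (p := d)
    (c := fun n k => ((∏ j, (evenRatio (k j + n j))⁻¹ * connCoeffInv (k j) : ℝ) : ℂ))
    fun n k => ?_).2
  · simpa only [(hf.hasSum_laguerreCoeff_comp_wMap hα _).tsum_eq] using h
  · rw [← mul_pow, Complex.norm_real, norm_prod]
    refine (Finset.prod_le_prod (fun _ _ => norm_nonneg _)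
      (g := fun _ => 2 * ((len (k + n) : ℝ) + 1)) fun j _ => ?_).trans (by simp)
    rw [norm_mul, Real.norm_eq_abs, Real.norm_eq_abs]
    refine (mul_le_mul (abs_evenRatio_inv_le _) (abs_connCoeffInv_le _) (abs_nonneg _)
      (by positivity)).trans ?_
    have : ((k j + n j : ℕ) : ℝ) ≤ len (k + n) := by exact_mod_cast le_len (k + n) j
    linarith

lemma MemHEven.hasSum_laguerre_comp_wMap (hα : 0 < α) (hf : MemHEven (α / 2) f)
    {x : Fin d → ℝ} (hx : x ∈ closedOrthant d) :
    HasSum (fun n => laguerreCoeff (f ∘ wMap) n * (laguerreFun n x : ℂ)) (f (wMap x)) := by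
  obtain ⟨h, hh, C, hC, hle⟩ := hf.1.2
  exact PilipovicOrthant.hasSum_laguerre (f := f ∘ wMap)
    (hf.1.1.continuous.comp continuous_wMap).continuousOn (C := C)
    (fun x _ => by simpa using hle 0 (wMap x))
    ((hf.expDecay_laguerreCoeff_comp_wMap hα).rapid hα) hx

/-- Since `√` is not differentiable at `0`, smoothness of `f ∘ w` up to the boundary is not read off
from the composition. It comes from the Laguerre series with exponentially decaying coefficients. -/
lemma MemHEven.memG_comp_wMap (hα : 0 < α) (hf : MemHEven (α / 2) f) : MemG α (f ∘ wMap) :=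
  memG_of_expDecay hα (hf.expDecay_laguerreCoeff_comp_wMap hα)
    fun _ hx => (hf.hasSum_laguerre_comp_wMap hα hx).tsum_eq.symm

end Hermite

lemma prod_evenRatio_inv_mul (n k : MultiIndex d) :
    ∏ j, (evenRatio (k j + n j))⁻¹ * connCoeffInv (k j) =
      (-1) ^ len n * 2 ^ len n / Real.pi ^ ((d : ℝ) / 4) *
        (mbinom (fun j => (k j : ℝ) - 3 / 2) k *
          ((-1) ^ len k * 2 ^ len k * (mfact (k + n) : ℝ) / √(mfact (2 • (k + n)) : ℝ))) := by
  have h := prod_evenRatio (k + n)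
  have hs : ((-1 : ℝ) ^ len (k + n))⁻¹ = (-1) ^ len k * (-1) ^ len n := by
    rw [← inv_pow, inv_neg, inv_one, len_add, pow_add]
  have hm : (mfact (k + n) : ℝ) ≠ 0 := by
    simp only [mfact, Nat.cast_ne_zero]
    exact Finset.prod_ne_zero_iff.2 fun j _ => Nat.factorial_ne_zero _
  rw [Finset.prod_mul_distrib, ← mbinom_sub_three_halves, Finset.prod_inv_distrib]
  simp only [Pi.add_apply] at h
  rw [h, inv_div, div_eq_mul_inv, mul_inv, mul_inv, hs, len_add, pow_add]
  simp only [div_eq_mul_inv]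
  ring

end PilipovicOrthant

/-! ### Assembly of the two directions. -/

theorem mainTheorem4 (d : ℕ) (hd : 0 < d) (α : ℝ) (hα : 0 < α) :
    (∀ f : (Fin d → ℝ) → ℂ, PilipovicOrthant.MemG α f →
      PilipovicOrthant.MemHEven (α / 2) (f ∘ PilipovicOrthant.vMap) ∧
      PilipovicOrthant.MemEll (α / 2)
        (PilipovicOrthant.evenPart
          (PilipovicOrthant.hermiteCoeff (f ∘ PilipovicOrthant.vMap))) ∧
      (∀ x : Fin d → ℝ,
        HasSum
          (fun n : PilipovicOrthant.MultiIndex d =>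
            PilipovicOrthant.hermiteCoeff (f ∘ PilipovicOrthant.vMap) (2 • n) *
              (PilipovicOrthant.hermiteFun (2 • n) x : ℂ))
          (f (PilipovicOrthant.vMap x))) ∧
      (∀ n : PilipovicOrthant.MultiIndex d,
        Summable (fun k : PilipovicOrthant.MultiIndex d =>
          PilipovicOrthant.laguerreCoeff f (k + n) *
            (PilipovicOrthant.mbinom (fun j => (k j : ℝ) - 1 / 2) k : ℂ)) ∧
        PilipovicOrthant.hermiteCoeff (f ∘ PilipovicOrthant.vMap) (2 • n) =
          (((-1) ^ PilipovicOrthant.len n * Real.pi ^ ((d : ℝ) / 4) *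
              √(PilipovicOrthant.mfact (2 • n) : ℝ) /
              (2 ^ PilipovicOrthant.len n * (PilipovicOrthant.mfact n : ℝ)) : ℝ) : ℂ) *
            ∑' k : PilipovicOrthant.MultiIndex d,
              PilipovicOrthant.laguerreCoeff f (k + n) *
                (PilipovicOrthant.mbinom (fun j => (k j : ℝ) - 1 / 2) k : ℂ))) ∧
    (∀ f : (Fin d → ℝ) → ℂ, PilipovicOrthant.MemHEven (α / 2) f →
      PilipovicOrthant.MemG α (f ∘ PilipovicOrthant.wMap) ∧
      PilipovicOrthant.MemEll (α / 2)
        (PilipovicOrthant.laguerreCoeff (f ∘ PilipovicOrthant.wMap)) ∧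
      (∀ x ∈ PilipovicOrthant.closedOrthant d,
        HasSum
          (fun n : PilipovicOrthant.MultiIndex d =>
            PilipovicOrthant.laguerreCoeff (f ∘ PilipovicOrthant.wMap) n *
              (PilipovicOrthant.laguerreFun n x : ℂ))
          (f (PilipovicOrthant.wMap x))) ∧
      (∀ n : PilipovicOrthant.MultiIndex d,
        Summable (fun k : PilipovicOrthant.MultiIndex d =>
          (PilipovicOrthant.mbinom (fun j => (k j : ℝ) - 3 / 2) k : ℂ) *
            (((-1) ^ PilipovicOrthant.len k * 2 ^ PilipovicOrthant.len k *
                (PilipovicOrthant.mfact (k + n) : ℝ) /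
                √(PilipovicOrthant.mfact (2 • (k + n)) : ℝ) : ℝ) : ℂ) *
            PilipovicOrthant.hermiteCoeff f (2 • (k + n))) ∧
        PilipovicOrthant.laguerreCoeff (f ∘ PilipovicOrthant.wMap) n =
          (((-1) ^ PilipovicOrthant.len n * 2 ^ PilipovicOrthant.len n /
              Real.pi ^ ((d : ℝ) / 4) : ℝ) : ℂ) *
            ∑' k : PilipovicOrthant.MultiIndex d,
              (PilipovicOrthant.mbinom (fun j => (k j : ℝ) - 3 / 2) k : ℂ) *
                (((-1) ^ PilipovicOrthant.len k * 2 ^ PilipovicOrthant.len k *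
                    (PilipovicOrthant.mfact (k + n) : ℝ) /
                    √(PilipovicOrthant.mfact (2 • (k + n)) : ℝ) : ℝ) : ℂ) *
                PilipovicOrthant.hermiteCoeff f (2 • (k + n)))) := by
  refine ⟨fun f hf => ?_, fun f hf => ?_⟩
  · have h0 := hf.hermiteCoeff_comp_vMap_of_odd hα
    have hs : ∀ n k : PilipovicOrthant.MultiIndex d,
        PilipovicOrthant.laguerreCoeff f (k + n) *
          (PilipovicOrthant.mbinom (fun j => (k j : ℝ) - 1 / 2) k : ℂ) *
          ((∏ j, PilipovicOrthant.evenRatio (n j) : ℝ) : ℂ) =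
        (((∏ j, PilipovicOrthant.connCoeff (k j)) * ∏ j, PilipovicOrthant.evenRatio (n j) : ℝ) : ℂ) *
          PilipovicOrthant.laguerreCoeff f (k + n) := fun n k => by
      rw [PilipovicOrthant.mbinom_sub_half]
      push_cast
      ring
    -- The prefactor depends only on `n` and is nonzero, so convergence of the scaled series is
    -- equivalent to that of the series itself. For families of complex numbers, `HasSum` and
    -- `Summable` mean absolute convergence.
    have hne : ∀ n : PilipovicOrthant.MultiIndex d,
        ((∏ j, PilipovicOrthant.evenRatio (n j) : ℝ) : ℂ) ≠ 0 := fun n =>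
      Complex.ofReal_ne_zero.2 (Finset.prod_ne_zero_iff.2 fun j _ =>
        PilipovicOrthant.evenRatio_ne_zero _)
    -- The full Hermite series is known to converge to the function; its coefficients at indices
    -- that are not entirely even vanish, so the series may be restricted to the indices `2n`.
    refine ⟨hf.memHEven_comp_vMap hα, ?_, fun x => PilipovicOrthant.hasSum_two_nsmul
      (u := fun n => (PilipovicOrthant.hermiteFun n x : ℂ)) h0 (hf.hasSum_hermite_comp_vMap hα x), fun n => ?_⟩
    · rw [PilipovicOrthant.evenPart_eq_self h0]
      exact (hf.expDecay_hermiteCoeff_comp_vMap hα).memEll hα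
    · have h := hf.hasSum_hermiteCoeff_comp_vMap hα n
      simp_rw [← hs] at h
      refine ⟨(summable_mul_right_iff (hne n)).1 h.summable, ?_⟩
      rw [← PilipovicOrthant.prod_evenRatio, ← h.tsum_eq, tsum_mul_right, mul_comm]
  · refine ⟨hf.memG_comp_wMap hα, (hf.expDecay_laguerreCoeff_comp_wMap hα).memEll hα,
      fun x hx => hf.hasSum_laguerre_comp_wMap hα hx, fun n => ?_⟩
    have h := hf.hasSum_laguerreCoeff_comp_wMap hα n
    simp_rw [PilipovicOrthant.prod_evenRatio_inv_mul, Complex.ofReal_mul (_ / _) (_ * _),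
      Complex.ofReal_mul (PilipovicOrthant.mbinom _ _), mul_assoc] at h
    have hne : (((-1) ^ PilipovicOrthant.len n * 2 ^ PilipovicOrthant.len n /
        Real.pi ^ ((d : ℝ) / 4) : ℝ) : ℂ) ≠ 0 :=
      Complex.ofReal_ne_zero.2 (div_ne_zero (mul_ne_zero (pow_ne_zero _ (by norm_num))
        (pow_ne_zero _ two_ne_zero)) (Real.rpow_pos_of_pos Real.pi_pos _).ne')
    simp_rw [mul_assoc]
    refine ⟨(summable_mul_left_iff hne).1 h.summable, ?_⟩
    rw [← h.tsum_eq, tsum_mul_left]
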